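/- Let $r\ge 1$ and let $X_1,\dots,X_r$ be locally compact Hadamard spaces (complete geodesic metric spaces all of whose triangles satisfy the CAT$(0)$ inequality), with metrics $d_1,\dots,d_r$, and let $X=X_1\times\cdots\times X_r$ carry the product distance $d=\sqrt{d_1^2+\cdots+d_r^2}$. For $x,z\in X$ let $H(x,z)=(d_1(x_1,z_1),\dots,d_r(x_r,z_r))\in\mathbb R^r_{\ge 0}$ be the distance vector, and let $\|\cdot\|$ be the Euclidean norm on $\mathbb R^r$. An isometry $\varphi$ of $X_i$ is called rank one if there are $l>0$ and a geodesic line $\sigma:\mathbb R\to X_i$ which does not bound a flat half-plane such that $\varphi(\sigma(t))=\sigma(t+l)$ for all $t$; its translation length is $l=\min_x d_i(x,\varphi x)$. Two such isometries $\varphi,\psi$ are independent if for every $x\in X_i$ the map $\mathbb Z\times\mathbb Z\to[0,\infty)$, $(m,n)\mapsto d_i(\varphi^m x,\psi^n x)$, is proper. An element $\gamma=(\gamma_1,\dots,\gamma_r)$ of $\mathrm{Is}(X_1)\times\cdots\times\mathrm{Is}(X_r)$ is called regular axial if every $\gamma_i$ is rank one; its translation vector $L(\gamma)\in\mathbb R^r_{>0}$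 has as its $i$-th coordinate the translation length of $\gamma_i$, and $\mathrm{Ax}(\gamma)$ is the set of all $x\in X$ for which $d(x,\gamma x)$ is minimal. Two regular axial isometries are independent if their components are independent in every factor. Let $\Gamma<\mathrm{Is}(X_1)\times\cdots\times\mathrm{Is}(X_r)$ be a group acting properly discontinuously on $X$ and containing two independent regular axial isometries $g$ and $h$, and fix a base point $o\in\mathrm{Ax}(h)$. The limit cone $\ell_\Gamma$ is the closure in $\mathbb R^r_{\ge 0}$ of the union of the half-lines spanned by the vectors $L(\gamma)$, $\gamma\in\Gamma$ regular axial. An open cone in $\mathbb R^r_{>0}$ is an open subset of $\mathbb R^r_{>0}$ which is invariant under multiplication by positive scalars. Then there is a constant $\kappa>0$ such that for every open cone $\mathcal C\subset\mathbb R^r_{>0}$ with $\mathcal C\cap\ell_\Gamma\neq\emptyset$ there exist independent regular axial isometries $\alpha,\beta\in\Gamma$ with $L(\alpha),L(\beta)\in\mathcal C$ such that the semigroup $\langle\alpha,\beta\rangle^+\subset\Gamma$ generated by $\alpha$ and $\beta$ is free on $\alpha,\beta$. Moreover, if $\Phi:\langle\alpha,\beta\rangle^+\to\mathbb R^r$ is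 the unique homomorphism of semigroups with $\Phi(\alpha)=L(\alpha)$ and $\Phi(\beta)=L(\beta)$, then for every word $\gamma\in\langle\alpha,\beta\rangle^+$ of length $n\ge 1$ in the generators $\alpha,\beta$ one has $$H(o,\gamma o)\in\mathcal C\qquad\text{and}\qquad \|H(o,\gamma o)-\Phi(\gamma)\|\le\kappa\cdot n .$$ -/

import Mathlib

universe u

namespace HadamardProducts

section SingleSpace

variable {X : Type u} [MetricSpace X]

/-- `σ`, restricted to `[0, l]`, is a geodesic path of length `l` joining `x` to `y`.
The values of `σ` outside `[0, l]` are irrelevant. -/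
def IsGeodesicPath (σ : ℝ → X) (l : ℝ) (x y : X) : Prop :=
  0 ≤ l ∧ σ 0 = x ∧ σ l = y ∧
    ∀ s ∈ Set.Icc 0 l, ∀ t ∈ Set.Icc 0 l, dist (σ s) (σ t) = |s - t|

/-- A geodesic line: an isometric embedding of the real line. -/
def IsGeodesicLine (σ : ℝ → X) : Prop :=
  ∀ s t : ℝ, dist (σ s) (σ t) = |s - t|

variable (X) in
/-- The `CAT(0)` inequality for all geodesic triangles: for a triangle with vertices `x, y, z`,
a comparison triangle `x', y', z'` in the Euclidean plane, and points `p`, `q` on two of the sides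
(called `σ` and `τ` here, both issuing from their common vertex `x`), the distance of
`p` and `q` is at most the distance of their comparison points. -/
def SatisfiesCAT0 : Prop :=
  ∀ (x y z : X) (x' y' z' : EuclideanSpace ℝ (Fin 2)),
    dist x' y' = dist x y → dist x' z' = dist x z → dist y' z' = dist y z →
    ∀ σ τ : ℝ → X, IsGeodesicPath σ (dist x y) x y → IsGeodesicPath τ (dist x z) x z →
      ∀ a ∈ Set.Icc (0 : ℝ) 1, ∀ b ∈ Set.Icc (0 : ℝ) 1,
        dist (σ (a * dist x y)) (τ (b * dist x z)) ≤
          dist (AffineMap.lineMap x' y' a) (AffineMap.lineMap x' z' b)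

variable (X) in
/-- Hadamard spaces: complete geodesic metric spaces all of whose triangles
satisfy the `CAT(0)` inequality. -/
structure IsHadamardSpace : Prop where
  complete : CompleteSpace X
  geodesic : ∀ x y : X, ∃ (σ : ℝ → X) (l : ℝ), IsGeodesicPath σ l x y
  cat0 : SatisfiesCAT0 X

/-- A subset is (geodesically) convex if it contains every geodesic path joining
two of its points. -/
def IsGeodesicallyConvex (A : Set X) : Prop :=
  ∀ x ∈ A, ∀ y ∈ A, ∀ (σ : ℝ → X) (l : ℝ), IsGeodesicPath σ l x y →
    ∀ t ∈ Set.Icc 0 l, σ t ∈ A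

/-- The Euclidean half-plane `[0, ∞) × ℝ`. -/
abbrev HalfPlane : Type := {p : EuclideanSpace ℝ (Fin 2) // 0 ≤ p 0}

/-- The point `(0, t)` on the boundary line of the half-plane. -/
def HalfPlane.bdry (t : ℝ) : HalfPlane := ⟨!₂[0, t], by simp⟩

/-- `σ` bounds a flat half-plane. -/
def BoundsFlatHalfPlane (σ : ℝ → X) : Prop :=
  ∃ ι : HalfPlane → X, Isometry ι ∧ IsClosed (Set.range ι) ∧
    IsGeodesicallyConvex (Set.range ι) ∧ ∀ t : ℝ, σ t = ι (HalfPlane.bdry t)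

/-- A rank one geodesic: a geodesic line which does not bound a flat half-plane. -/
def IsRankOneGeodesic (σ : ℝ → X) : Prop :=
  IsGeodesicLine σ ∧ ¬ BoundsFlatHalfPlane σ

/-- `σ` is an axis of `h`, along which `h` translates by `l > 0`. -/
def IsAxis (h : X ≃ᵢ X) (l : ℝ) (σ : ℝ → X) : Prop :=
  0 < l ∧ IsGeodesicLine σ ∧ ∀ t : ℝ, h (σ t) = σ (t + l)

/-- Axial isometries. -/
def IsAxial (h : X ≃ᵢ X) : Prop := ∃ (l : ℝ) (σ : ℝ → X), IsAxis h l σ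

/-- Rank one isometries: axial isometries which possess a rank one axis. -/
def IsRankOne (h : X ≃ᵢ X) : Prop :=
  IsAxial h ∧ ∃ (l : ℝ) (σ : ℝ → X), IsAxis h l σ ∧ IsRankOneGeodesic σ

/-- The translation length: the infimum of the displacement function.
For an axial isometry it is the number by which any axis is translated,
see `translationLength_eq`. -/
noncomputable def translationLength (h : X ≃ᵢ X) : ℝ := ⨅ x : X, dist x (h x)

theorem translationLength_eq {h : X ≃ᵢ X} {l : ℝ} {σ : ℝ → X} (hσ : IsAxis h l σ) :
    translationLength h = l := by
  obtain ⟨hl, hg, hh⟩ := hσ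
  have hbdd : BddBelow (Set.range fun x : X => dist x (h x)) :=
    ⟨0, by rintro _ ⟨x, rfl⟩; exact dist_nonneg⟩
  have : Nonempty X := ⟨σ 0⟩
  apply le_antisymm
  · refine (ciInf_le hbdd (σ 0)).trans (le_of_eq ?_)
    rw [hh, hg]; simp [abs_of_pos hl]
  · refine le_ciInf fun x => ?_
    have hit : ∀ n : ℕ, (⇑h)^[n] (σ 0) = σ (n * l) := by
      intro n
      induction n with
      | zero => simp
      | succ n ih => rw [Function.iterate_succ_apply', ih, hh]; congr 1; push_cast; ring
    have hiso : ∀ (n : ℕ) (y z : X), dist ((⇑h)^[n] y) ((⇑h)^[n] z) = dist y z := by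
      intro n y z
      induction n with
      | zero => rfl
      | succ n ih => rw [Function.iterate_succ_apply', Function.iterate_succ_apply', h.dist_eq, ih]
    have hd : ∀ n : ℕ, dist x ((⇑h)^[n] x) ≤ n * dist x (h x) := by
      intro n
      induction n with
      | zero => simp
      | succ n ih =>
        have h1 : dist ((⇑h)^[n] x) ((⇑h)^[n + 1] x) = dist x (h x) := by
          rw [Function.iterate_succ_apply]
          exact hiso n x (h x)
        have h2 := dist_triangle x ((⇑h)^[n] x) ((⇑h)^[n + 1] x)
        push_cast
        linarith
    have hb : ∀ n : ℕ, (n : ℝ) * (l - dist x (h x)) ≤ 2 * dist (σ 0) x := by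
      intro n
      have h1 : dist (σ 0) ((⇑h)^[n] (σ 0)) = n * l := by
        rw [hit, hg, zero_sub, abs_neg, abs_of_nonneg (by positivity)]
      have h2 := dist_triangle4 (σ 0) x ((⇑h)^[n] x) ((⇑h)^[n] (σ 0))
      have h3 : dist ((⇑h)^[n] x) ((⇑h)^[n] (σ 0)) = dist x (σ 0) :=
        hiso n _ _
      have h4 := hd n
      rw [h3, dist_comm x (σ 0)] at h2
      linarith
    by_contra hlt
    push Not at hlt
    obtain ⟨n, hn⟩ := exists_nat_gt (2 * dist (σ 0) x / (l - dist x (h x)))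
    rw [div_lt_iff₀ (by linarith)] at hn
    linarith [hb n]

/-- Independence of two isometries (used for axial ones): for every point `x` the map
`ℤ × ℤ → [0, ∞)`, `(m, n) ↦ d (g ^ m x) (h ^ n x)` is proper. -/
def AreIndependent (g h : X ≃ᵢ X) : Prop :=
  ∀ x : X, IsProperMap fun p : ℤ × ℤ => nndist ((g ^ p.1) x) ((h ^ p.2) x)

end SingleSpace

section Product

variable {r : ℕ} {X : Fin r → Type u} [∀ i, MetricSpace (X i)]

/-- The group `Is(X₁) × ⋯ × Is(X_r)`. -/
abbrev IsomProd (X : Fin r → Type u) [∀ i, MetricSpace (X i)] : Type u := ∀ i, X i ≃ᵢ X i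

/-- The action of `Is(X₁) × ⋯ × Is(X_r)` on the product `X₁ × ⋯ × X_r`. -/
def act (γ : IsomProd X) (x : ∀ i, X i) : ∀ i, X i := fun i => γ i (x i)

/-- The distance vector `H(x, z)`. Its Euclidean norm is the distance of `x` and `z`
for the product distance `d = √(d₁² + ⋯ + d_r²)`. -/
noncomputable def distVec (x z : ∀ i, X i) : EuclideanSpace ℝ (Fin r) :=
  WithLp.toLp 2 fun i => dist (x i) (z i)

/-- `Γ` acts properly discontinuously on the product (which carries the product topology). -/
def ActsProperlyDiscontinuously (Γ : Subgroup (IsomProd X)) : Prop :=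
  ∀ K : Set (∀ i, X i), IsCompact K → {γ | γ ∈ Γ ∧ (act γ '' K ∩ K).Nonempty}.Finite

/-- Regular axial isometries: all the projections to the factors are rank one. -/
def IsRegularAxial (h : IsomProd X) : Prop := ∀ i, IsRankOne (h i)

/-- The translation vector `L(h)`. -/
noncomputable def translationVec (h : IsomProd X) : EuclideanSpace ℝ (Fin r) :=
  WithLp.toLp 2 fun i => translationLength (h i)

/-- `g` and `h` are independent regular axial isometries. -/
def AreIndependentRegularAxial (g h : IsomProd X) : Prop :=
  IsRegularAxial g ∧ IsRegularAxial h ∧ ∀ i, AreIndependent (g i) (h i)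

/-- `Ax(h)`: the points of the product at which the displacement of `h`, with respect to
the product distance, equals the translation length of `h`. -/
def axisSet (h : IsomProd X) : Set (∀ i, X i) :=
  {x | ‖distVec x (act h x)‖ = ⨅ y : ∀ i, X i, ‖distVec y (act h y)‖}

/-- The limit cone: the closure of the union of the half-lines spanned by the translation vectors
of the regular axial elements of `Γ`. -/
def limitCone (Γ : Subgroup (IsomProd X)) : Set (EuclideanSpace ℝ (Fin r)) :=
  closure {v | ∃ γ ∈ Γ, IsRegularAxial γ ∧ ∃ t : ℝ, 0 ≤ t ∧ v = t • translationVec γ}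

end Product

/-- `C` is an open cone contained in the open positive orthant of `ℝ^r`. -/
structure IsOpenConeInPosOrthant {r : ℕ} (C : Set (EuclideanSpace ℝ (Fin r))) : Prop where
  isOpen : IsOpen C
  smul_mem : ∀ v ∈ C, ∀ t : ℝ, 0 < t → t • v ∈ C
  pos : ∀ v ∈ C, ∀ i, 0 < v i

section Semigroup

variable {G : Type u} [Group G]

/-- The semigroup `⟨α, β⟩⁺` generated by `α` and `β`. -/
def semigroupGen (α β : G) : Subsemigroup G := Subsemigroup.closure {α, β}

theorem left_mem_semigroupGen (α β : G) : α ∈ semigroupGen α β :=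
  Subsemigroup.subset_closure (by simp)

theorem right_mem_semigroupGen (α β : G) : β ∈ semigroupGen α β :=
  Subsemigroup.subset_closure (by simp)

/-- The value in `G` of a (non-empty) word in two letters, the letters being read as `α`, `β`. -/
def wordValue (α β : G) : FreeSemigroup (Fin 2) →ₙ* G := FreeSemigroup.lift ![α, β]

/-- `α` and `β` freely generate the semigroup `⟨α, β⟩⁺`: distinct words have distinct values. -/
def GeneratesFreeSemigroup (α β : G) : Prop := Function.Injective (wordValue α β)

/-- `Φ` is a homomorphism of semigroups from `⟨α, β⟩⁺` to the additive group `V` which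
sends `α` to `a` and `β` to `b`. -/
def IsSemigroupHomSending {V : Type*} [AddCommGroup V] {α β : G}
    (Φ : semigroupGen α β → V) (a b : V) : Prop :=
  (∀ γ δ, Φ (γ * δ) = Φ γ + Φ δ) ∧
    Φ ⟨α, left_mem_semigroupGen α β⟩ = a ∧ Φ ⟨β, right_mem_semigroupGen α β⟩ = b

end Semigroup

end HadamardProducts

open HadamardProducts

/-! The proof rests on the contraction property `Tight` of a rank one axis: a geodesic whose
endpoints project far apart onto the axis passes uniformly close to each point of the axis well
between the projections. If normalized distance functions converge along a line to an affine
function of slope strictly between -1 and 1, then limits of geodesics toward the moving points sweep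
out a flat half-plane (`HasFlatDirection.boundsFlatHalfPlane`). A rank one axis therefore admits no
such limit. Two things follow: geodesics joining neighbourhoods of its two ends return to a fixed
ball (`exists_radius_of_not_hasFlatDirection`), and points projecting far out lie in such a
neighbourhood (`IsAxis.exists_near_end`). Translating along the axis gives `IsAxis.exists_tight`.

Independence makes widely spaced translates of the axis of `h i` under powers of `g i` project
boundedly onto each other. For such lines Behrstock's inequality holds: a point cannot project far
out on two of them.

Let `γ` have its translation vector in the cone and put `φ = γ ^ n`. Let `F j` be conjugates of a
fixed long power of `h`, translating along `2 * r + 2` such lines in every factor. The `2 * r`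
points `φ i (o i)` and `(φ i)⁻¹ (o i)` spoil at most one index each, so two indices are good in all
factors at once. The products `F j * φ` for these two indices play ping-pong in every factor
(`Schottky`). Geodesics between suitable orbit points then pass near `o`, so displacements add up
along words with a bounded error per letter. Freeness and independence come from the same
projections, and recurrence of geodesics near `o` yields rank one (`isRankOne_of_recurrent`).

The ping-pong constants depend only on the fixed lines, which makes `κ` independent of the cone. The
exponent `n` remains free: the error per letter is bounded independently of `n`, whereas the
displacement of a letter grows like `n` times the translation vector of `γ`, so for large `n` all
directions stay in the cone. -/

namespace HadamardProducts

open Filter Topology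

/-! ### Elementary geometry of `CAT(0)` spaces -/

section Comparison

/-- The first vertex is the origin and `y` lies on the first coordinate axis. The law of cosines
dictates the first coordinate `u` of `z`, and the triangle inequalities amount to `|u| ≤ b`, which
leaves room for the second coordinate. -/
theorem exists_comparison_triangle {a b c : ℝ} (ha : 0 ≤ a) (hb : 0 ≤ b) (hc : 0 ≤ c)
    (h1 : a ≤ b + c) (h2 : b ≤ a + c) (h3 : c ≤ a + b) :
    ∃ y z : EuclideanSpace ℝ (Fin 2), dist 0 y = a ∧ dist 0 z = b ∧ dist y z = c := by
  rcases ha.eq_or_lt with rfl | ha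
  · have hbc : b = c := by linarith
    subst hbc
    refine ⟨0, !₂[b, 0], by simp, ?_, ?_⟩ <;>
    simp [EuclideanSpace.dist_eq, Fin.sum_univ_two, Real.dist_eq, Real.sqrt_sq hb]
  · set u := (a ^ 2 + b ^ 2 - c ^ 2) / (2 * a) with hu
    have hua : 2 * a * u = a ^ 2 + b ^ 2 - c ^ 2 := by rw [hu]; field_simp
    have hle : u ^ 2 ≤ b ^ 2 := by
      apply sq_le_sq'
      · have : 2 * a * (-b) ≤ 2 * a * u := by rw [hua]; nlinarith
        exact le_of_mul_le_mul_left this (by positivity)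
      · have : 2 * a * u ≤ 2 * a * b := by rw [hua]; nlinarith
        exact le_of_mul_le_mul_left this (by positivity)
    have hv : Real.sqrt (b ^ 2 - u ^ 2) ^ 2 = b ^ 2 - u ^ 2 := Real.sq_sqrt (by linarith)
    refine ⟨!₂[a, 0], !₂[u, Real.sqrt (b ^ 2 - u ^ 2)], ?_, ?_, ?_⟩
    · simp [EuclideanSpace.dist_eq, Fin.sum_univ_two, Real.dist_eq, Real.sqrt_sq ha.le]
    · rw [EuclideanSpace.dist_eq, Real.sqrt_eq_iff_mul_self_eq (by positivity) hb]
      simp [Fin.sum_univ_two, Real.dist_eq, sq_abs, hv]; ring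
    · rw [EuclideanSpace.dist_eq, Real.sqrt_eq_iff_mul_self_eq (by positivity) hc]
      simp [Fin.sum_univ_two, Real.dist_eq, sq_abs, hv]; linarith

/-- Stewart's theorem; it turns the comparison inequality into the inequality of Bruhat and Tits. -/
theorem dist_lineMap_sq {E : Type*} [NormedAddCommGroup E] [InnerProductSpace ℝ E]
    (p x y : E) (t : ℝ) :
    dist p (AffineMap.lineMap x y t) ^ 2 =
      (1 - t) * dist p x ^ 2 + t * dist p y ^ 2 - t * (1 - t) * dist x y ^ 2 := by
  have e1 : p - AffineMap.lineMap x y t = (1 - t) • (p - x) + t • (p - y) := by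
    rw [AffineMap.lineMap_apply_module]; module
  have e2 : x - y = (p - y) - (p - x) := by abel
  rw [dist_eq_norm, dist_eq_norm, dist_eq_norm, dist_eq_norm, e1, e2]
  generalize p - x = v
  generalize p - y = w
  rw [norm_add_sq_real, norm_sub_sq_real, norm_smul, norm_smul, inner_smul_left,
    inner_smul_right, real_inner_comm v w, mul_pow, mul_pow, Real.norm_eq_abs, Real.norm_eq_abs,
    sq_abs, sq_abs]
  simp only [conj_trivial]
  ring

end Comparison

/-- The point `z` divides the pair `x, y` in the proportion `t : 1 - t`. -/
def DividesAt {X : Type*} [MetricSpace X] (x y : X) (t : ℝ) (z : X) : Prop :=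
  dist x z = t * dist x y ∧ dist z y = (1 - t) * dist x y

/-- The properties of `CAT(0)` spaces that are used below: existence of geodesics and the
inequality of Bruhat and Tits. -/
class CatZero (X : Type*) [MetricSpace X] : Prop where
  exists_dividesAt : ∀ (x y : X) (t : ℝ), 0 ≤ t → t ≤ 1 → ∃ z, DividesAt x y t z
  dist_sq_le : ∀ (p x y z : X) (t : ℝ), 0 ≤ t → t ≤ 1 → DividesAt x y t z →
    dist p z ^ 2 ≤ (1 - t) * dist p x ^ 2 + t * dist p y ^ 2 - t * (1 - t) * dist x y ^ 2

theorem IsGeodesicPath.length_eq {X : Type*} [MetricSpace X] {σ : ℝ → X} {l : ℝ} {x y : X}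
    (h : IsGeodesicPath σ l x y) : l = dist x y := by
  obtain ⟨hl, h0, h1, hd⟩ := h
  have := hd 0 ⟨le_rfl, hl⟩ l ⟨hl, le_rfl⟩
  rw [h0, h1] at this
  rw [this]; simp [abs_of_nonneg hl]

theorem IsGeodesicPath.dividesAt {X : Type*} [MetricSpace X] {σ : ℝ → X} {l : ℝ} {x y : X}
    (h : IsGeodesicPath σ l x y) {t : ℝ} (ht0 : 0 ≤ t) (ht1 : t ≤ 1) :
    DividesAt x y t (σ (t * dist x y)) := by
  have hl := h.length_eq
  subst hl
  obtain ⟨hl, h0, h1, hd⟩ := h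
  have hm : t * dist x y ∈ Set.Icc 0 (dist x y) :=
    ⟨by positivity, mul_le_of_le_one_left hl ht1⟩
  constructor
  · have := hd 0 ⟨le_rfl, hl⟩ _ hm
    rw [h0] at this
    rw [this, zero_sub, abs_neg, abs_of_nonneg hm.1]
  · have := hd _ hm _ ⟨hl, le_rfl⟩
    rw [h1] at this
    rw [this, abs_sub_comm, abs_of_nonneg (by linarith [hm.2])]; ring

theorem IsHadamardSpace.catZero {X : Type*} [MetricSpace X] (hX : IsHadamardSpace X) :
    CatZero X := by
  have key : ∀ (p x y : X) (t : ℝ), 0 ≤ t → t ≤ 1 → ∃ z, DividesAt x y t z ∧ ∀ p,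
      dist p z ^ 2 ≤
        (1 - t) * dist p x ^ 2 + t * dist p y ^ 2 - t * (1 - t) * dist x y ^ 2 := by
    intro p x y t ht0 ht1
    obtain ⟨σ, l, hσ⟩ := hX.geodesic x y
    refine ⟨σ (t * dist x y), hσ.dividesAt ht0 ht1, fun p => ?_⟩
    obtain ⟨τ, m, hτ⟩ := hX.geodesic x p
    have hl := hσ.length_eq
    have hm := hτ.length_eq
    subst hl hm
    obtain ⟨y', p', hy, hp, hyp⟩ := exists_comparison_triangle (dist_nonneg (x := x) (y := y))
      (dist_nonneg (x := x) (y := p)) (dist_nonneg (x := y) (y := p))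
      (by linarith [dist_triangle x p y, dist_comm y p]) (dist_triangle x y p)
      (by linarith [dist_triangle y x p, dist_comm x y])
    have := hX.cat0 x y p 0 y' p' hy hp hyp σ τ hσ hτ t ⟨ht0, ht1⟩ 1 ⟨zero_le_one, le_rfl⟩
    rw [one_mul, hτ.2.2.1, AffineMap.lineMap_apply_one] at this
    rw [dist_comm p]
    refine (pow_le_pow_left₀ dist_nonneg this 2).trans (le_of_eq ?_)
    rw [dist_comm, dist_lineMap_sq, dist_comm p' 0, hp, dist_comm p' y', hyp, hy, dist_comm p x,
      dist_comm p y]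
  refine ⟨fun x y t h0 h1 => ?_, fun p x y z t h0 h1 hz => ?_⟩
  · obtain ⟨z, hz, -⟩ := key x x y t h0 h1
    exact ⟨z, hz⟩
  · obtain ⟨w, hw, hc⟩ := key x x y t h0 h1
    have hzw : z = w := by
      -- A point dividing the pair need not a priori lie on the chosen geodesic. For `p = z` the
      -- right-hand side is `(1 - t) * t ^ 2 + t * (1 - t) ^ 2 - t * (1 - t) = 0` times a square, so
      -- `z` is the point `w` of that geodesic.
      have := hc z
      rw [dist_comm z x, hz.1, hz.2] at this
      have h2 : dist z w ^ 2 ≤ 0 := by nlinarith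
      exact dist_eq_zero.1 (pow_eq_zero_iff two_ne_zero |>.1 (le_antisymm h2 (by positivity)))
    rw [hzw]; exact hc p

/-! ### Geodesics and convexity from the inequality of Bruhat and Tits -/

section CatZero

variable {X : Type*} [MetricSpace X] [CatZero X]

theorem DividesAt.unique {x y z w : X} {t : ℝ} (h0 : 0 ≤ t) (h1 : t ≤ 1)
    (hz : DividesAt x y t z) (hw : DividesAt x y t w) : z = w := by
  have := CatZero.dist_sq_le z x y w t h0 h1 hw
  rw [dist_comm z x, hz.1, hz.2] at this
  have h2 : dist z w ^ 2 ≤ 0 := by nlinarith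
  exact dist_eq_zero.1 (pow_eq_zero_iff two_ne_zero |>.1 (le_antisymm h2 (by positivity)))

open Classical in
/-- The geodesic from `x` to `y`, parametrized proportionally to arc length by `[0, 1]`. -/
noncomputable def geo (x y : X) (t : ℝ) : X :=
  if h : 0 ≤ t ∧ t ≤ 1 then (CatZero.exists_dividesAt x y t h.1 h.2).choose else x

theorem geo_dividesAt (x y : X) {t : ℝ} (h0 : 0 ≤ t) (h1 : t ≤ 1) :
    DividesAt x y t (geo x y t) := by
  rw [geo, dif_pos ⟨h0, h1⟩]
  exact (CatZero.exists_dividesAt x y t h0 h1).choose_spec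

theorem dist_left_geo (x y : X) {t : ℝ} (h0 : 0 ≤ t) (h1 : t ≤ 1) :
    dist x (geo x y t) = t * dist x y := (geo_dividesAt x y h0 h1).1

theorem dist_geo_right (x y : X) {t : ℝ} (h0 : 0 ≤ t) (h1 : t ≤ 1) :
    dist (geo x y t) y = (1 - t) * dist x y := (geo_dividesAt x y h0 h1).2

theorem DividesAt.eq_geo {x y z : X} {t : ℝ} (h0 : 0 ≤ t) (h1 : t ≤ 1)
    (hz : DividesAt x y t z) : z = geo x y t :=
  hz.unique h0 h1 (geo_dividesAt x y h0 h1)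

theorem dist_geo_sq_le (p x y : X) {t : ℝ} (h0 : 0 ≤ t) (h1 : t ≤ 1) :
    dist p (geo x y t) ^ 2 ≤
      (1 - t) * dist p x ^ 2 + t * dist p y ^ 2 - t * (1 - t) * dist x y ^ 2 :=
  CatZero.dist_sq_le p x y _ t h0 h1 (geo_dividesAt x y h0 h1)

@[simp] theorem geo_zero (x y : X) : geo x y 0 = x := by
  have := dist_left_geo x y le_rfl zero_le_one
  rw [zero_mul] at this
  exact (dist_eq_zero.1 this).symm

@[simp] theorem geo_one (x y : X) : geo x y 1 = y := by
  have := dist_geo_right x y zero_le_one le_rfl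
  rw [sub_self, zero_mul] at this
  exact dist_eq_zero.1 this

theorem geo_symm (x y : X) {t : ℝ} (h0 : 0 ≤ t) (h1 : t ≤ 1) : geo y x (1 - t) = geo x y t := by
  refine DividesAt.eq_geo h0 h1 ⟨?_, ?_⟩
  · rw [dist_comm, dist_geo_right y x (by linarith) (by linarith), dist_comm]; ring
  · rw [dist_comm, dist_left_geo y x (by linarith) (by linarith), dist_comm]

/-- Bruhat–Tits is applied twice, from `geo p x t` to the side `p y` and from `y` to the side `p x`;
all terms except `(t * dist x y) ^ 2` cancel. -/
theorem dist_geo_geo_le_right (p x y : X) {t : ℝ} (h0 : 0 ≤ t) (h1 : t ≤ 1) :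
    dist (geo p x t) (geo p y t) ≤ t * dist x y := by
  have a := dist_geo_sq_le (geo p x t) p y h0 h1
  have b := dist_geo_sq_le y p x h0 h1
  rw [dist_comm (geo p x t) p, dist_left_geo p x h0 h1, dist_comm (geo p x t) y] at a
  rw [dist_comm y p, dist_comm y x] at b
  have c := mul_le_mul_of_nonneg_left b h0
  refine (pow_le_pow_iff_left₀ dist_nonneg (by positivity) two_ne_zero).1 ?_
  nlinarith

theorem dist_geo_geo_le_left (x y p : X) {t : ℝ} (h0 : 0 ≤ t) (h1 : t ≤ 1) :
    dist (geo x p t) (geo y p t) ≤ (1 - t) * dist x y := by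
  rw [← geo_symm x p h0 h1, ← geo_symm y p h0 h1]
  exact dist_geo_geo_le_right p x y (by linarith) (by linarith)

theorem dist_geo_geo_le (x y x' y' : X) {t : ℝ} (h0 : 0 ≤ t) (h1 : t ≤ 1) :
    dist (geo x y t) (geo x' y' t) ≤ (1 - t) * dist x x' + t * dist y y' := by
  have a := dist_geo_geo_le_right x y y' h0 h1
  have b := dist_geo_geo_le_left x x' y' h0 h1
  linarith [dist_triangle (geo x y t) (geo x y' t) (geo x' y' t)]

theorem dist_geo_le (p x y : X) {t : ℝ} (h0 : 0 ≤ t) (h1 : t ≤ 1) :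
    dist p (geo x y t) ≤ (1 - t) * dist p x + t * dist p y := by
  have a := dist_geo_geo_le p p x y h0 h1
  have : geo p p t = p := (DividesAt.eq_geo h0 h1 (by constructor <;> simp)).symm
  rwa [this] at a

theorem dist_geo_same (x y : X) {s t : ℝ} (hs0 : 0 ≤ s) (hs1 : s ≤ 1) (ht0 : 0 ≤ t)
    (ht1 : t ≤ 1) : dist (geo x y s) (geo x y t) = |s - t| * dist x y := by
  have key : ∀ s t : ℝ, 0 ≤ s → s ≤ t → t ≤ 1 →
      dist (geo x y s) (geo x y t) = (t - s) * dist x y := by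
    intro s t hs hst ht
    have ht0 : 0 ≤ t := hs.trans hst
    apply le_antisymm
    · rcases ht0.eq_or_lt with h | h
      · have : s = 0 := by linarith
        subst h this; simp
      · have hq0 : 0 ≤ s / t := by positivity
        have hq1 : s / t ≤ 1 := (div_le_one h).2 hst
        have e : geo x y s = geo x (geo x y t) (s / t) := by
          symm
          refine DividesAt.eq_geo hs (hst.trans ht) ⟨?_, ?_⟩
          · rw [dist_left_geo _ _ hq0 hq1, dist_left_geo _ _ ht0 ht]; field_simp
          · apply le_antisymm
            · refine (dist_triangle _ (geo x y t) _).trans (le_of_eq ?_)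
              rw [dist_geo_right _ _ hq0 hq1, dist_left_geo _ _ ht0 ht, dist_geo_right _ _ ht0 ht]
              field_simp; ring
            · have := dist_triangle x (geo x (geo x y t) (s / t)) y
              rw [dist_left_geo _ _ hq0 hq1, dist_left_geo _ _ ht0 ht] at this
              have e2 : s / t * (t * dist x y) = s * dist x y := by field_simp
              linarith
        rw [e, dist_geo_right _ _ hq0 hq1, dist_left_geo _ _ ht0 ht]
        refine le_of_eq ?_
        field_simp
    · have := dist_triangle x (geo x y s) (geo x y t)
      rw [dist_left_geo _ _ hs (hst.trans ht), dist_left_geo _ _ ht0 ht] at this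
      linarith
  rcases le_total s t with h | h
  · rw [key s t hs0 h ht1, abs_of_nonpos (by linarith)]; ring
  · rw [dist_comm, key t s ht0 h hs1, abs_of_nonneg (by linarith)]

/-- The quadrilateral inequality. -/
theorem dist_sq_add_dist_sq_le (a b c d : X) :
    dist a c ^ 2 + dist b d ^ 2 ≤
      dist a b ^ 2 + dist b c ^ 2 + dist c d ^ 2 + dist d a ^ 2 := by
  have h0 : (0 : ℝ) ≤ 1 / 2 := by norm_num
  have h1 : (1 / 2 : ℝ) ≤ 1 := by norm_num
  have e := dist_geo_sq_le b a c h0 h1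
  have f := dist_geo_sq_le d a c h0 h1
  have g := dist_triangle_right b d (geo a c (1 / 2))
  have g' : dist b d ^ 2 ≤ (dist b (geo a c (1 / 2)) + dist d (geo a c (1 / 2))) ^ 2 :=
    pow_le_pow_left₀ dist_nonneg g 2
  rw [dist_comm b a] at e
  rw [dist_comm d c] at f
  nlinarith [sq_nonneg (dist b (geo a c (1 / 2)) - dist d (geo a c (1 / 2)))]

theorem map_geo (f : X ≃ᵢ X) (x y : X) {t : ℝ} (h0 : 0 ≤ t) (h1 : t ≤ 1) :
    f (geo x y t) = geo (f x) (f y) t := by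
  refine DividesAt.eq_geo h0 h1 ⟨?_, ?_⟩
  · rw [f.dist_eq, f.dist_eq, dist_left_geo _ _ h0 h1]
  · rw [f.dist_eq, f.dist_eq, dist_geo_right _ _ h0 h1]

/-- A point between `x` and `y` lies on the geodesic from `x` to `y`. -/
theorem exists_eq_geo_of_dist_add {x y z : X} (h : dist x z + dist z y = dist x y) :
    ∃ t, 0 ≤ t ∧ t ≤ 1 ∧ z = geo x y t := by
  rcases (dist_nonneg (x := x) (y := y)).eq_or_lt with h0 | h0
  · refine ⟨0, le_rfl, zero_le_one, ?_⟩
    rw [geo_zero]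
    have : dist x z = 0 := by
      linarith [dist_nonneg (x := x) (y := z), dist_nonneg (x := z) (y := y)]
    exact (dist_eq_zero.1 this).symm
  · have ht0 : 0 ≤ dist x z / dist x y := by positivity
    have ht1 : dist x z / dist x y ≤ 1 := by
      rw [div_le_one h0]; linarith [dist_nonneg (x := z) (y := y)]
    refine ⟨dist x z / dist x y, ht0, ht1, DividesAt.eq_geo ht0 ht1 ⟨?_, ?_⟩⟩
    · field_simp
    · field_simp; linarith

theorem dist_add_dist_geo (x y : X) {t : ℝ} (h0 : 0 ≤ t) (h1 : t ≤ 1) :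
    dist x (geo x y t) + dist (geo x y t) y = dist x y := by
  rw [dist_left_geo _ _ h0 h1, dist_geo_right _ _ h0 h1]; ring

/-- The point at distance `s` from `x` on the geodesic from `x` to `y`. -/
noncomputable def pt (x y : X) (s : ℝ) : X := geo x y (s / dist x y)

theorem dist_left_pt {x y : X} {s : ℝ} (h0 : 0 ≤ s) (h1 : s ≤ dist x y) :
    dist x (pt x y s) = s := by
  rw [pt, dist_left_geo _ _ (by positivity) (div_le_one_of_le₀ h1 dist_nonneg)]
  rcases (dist_nonneg (x := x) (y := y)).eq_or_lt with h | h
  · rw [← h] at h1 ⊢; linarith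
  · field_simp

theorem dist_pt_right {x y : X} {s : ℝ} (h0 : 0 ≤ s) (h1 : s ≤ dist x y) :
    dist (pt x y s) y = dist x y - s := by
  have := dist_left_pt h0 h1
  rw [pt] at this ⊢
  have h2 := dist_add_dist_geo x y (div_nonneg h0 dist_nonneg) (div_le_one_of_le₀ h1 dist_nonneg)
  linarith

theorem dist_pt_pt {x y : X} {s t : ℝ} (hs0 : 0 ≤ s) (hs1 : s ≤ dist x y) (ht0 : 0 ≤ t)
    (ht1 : t ≤ dist x y) : dist (pt x y s) (pt x y t) = |s - t| := by
  rw [pt, pt, dist_geo_same _ _ (div_nonneg hs0 dist_nonneg) (div_le_one_of_le₀ hs1 dist_nonneg)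
    (div_nonneg ht0 dist_nonneg) (div_le_one_of_le₀ ht1 dist_nonneg), ← sub_div, abs_div,
    abs_of_nonneg (dist_nonneg (x := x) (y := y))]
  rcases (dist_nonneg (x := x) (y := y)).eq_or_lt with h | h
  · have : s = t := by linarith
    subst this; simp
  · field_simp

/-- The distance to a geodesic line satisfies the inequality of Bruhat and Tits. -/
theorem IsGeodesicLine.dist_sq_le {σ : ℝ → X} (hσ : IsGeodesicLine σ) (p : X) (a b : ℝ) {t : ℝ}
    (h0 : 0 ≤ t) (h1 : t ≤ 1) :
    dist p (σ ((1 - t) * a + t * b)) ^ 2 ≤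
      (1 - t) * dist p (σ a) ^ 2 + t * dist p (σ b) ^ 2 - t * (1 - t) * (a - b) ^ 2 := by
  have := CatZero.dist_sq_le p (σ a) (σ b) (σ ((1 - t) * a + t * b)) t h0 h1 ⟨?_, ?_⟩
  · rwa [hσ a b, sq_abs] at this
  · rw [hσ, hσ, show a - ((1 - t) * a + t * b) = t * (a - b) by ring, abs_mul, abs_of_nonneg h0]
  · rw [hσ, hσ, show (1 - t) * a + t * b - b = (1 - t) * (a - b) by ring, abs_mul,
      abs_of_nonneg (by linarith : 0 ≤ 1 - t)]

theorem IsGeodesicLine.eq_geo {σ : ℝ → X} (hσ : IsGeodesicLine σ) (a b : ℝ) {t : ℝ}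
    (h0 : 0 ≤ t) (h1 : t ≤ 1) : σ ((1 - t) * a + t * b) = geo (σ a) (σ b) t := by
  refine DividesAt.eq_geo h0 h1 ⟨?_, ?_⟩
  · rw [hσ, hσ, show a - ((1 - t) * a + t * b) = t * (a - b) by ring, abs_mul, abs_of_nonneg h0]
  · rw [hσ, hσ, show (1 - t) * a + t * b - b = (1 - t) * (a - b) by ring, abs_mul,
      abs_of_nonneg (by linarith : 0 ≤ 1 - t)]

theorem IsGeodesicLine.convexOn_dist {σ τ : ℝ → X} (hσ : IsGeodesicLine σ)
    (hτ : IsGeodesicLine τ) (v : ℝ) :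
    ConvexOn ℝ Set.univ fun t => dist (σ (t + v)) (τ t) := by
  refine ⟨convex_univ, fun a _ b _ m n hm hn hmn => ?_⟩
  have hm' : m = 1 - n := by linarith
  subst hm'
  have hn1 : n ≤ 1 := by linarith
  simp only [smul_eq_mul]
  rw [show (1 - n) * a + n * b + v = (1 - n) * (a + v) + n * (b + v) by ring,
    hσ.eq_geo _ _ hn hn1, hτ.eq_geo _ _ hn hn1]
  exact dist_geo_geo_le _ _ _ _ hn hn1

theorem IsGeodesicLine.convexOn_dist_point {σ : ℝ → X} (hσ : IsGeodesicLine σ) (p : X) :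
    ConvexOn ℝ Set.univ fun t => dist p (σ t) := by
  refine ⟨convex_univ, fun a _ b _ m n hm hn hmn => ?_⟩
  have hm' : m = 1 - n := by linarith
  subst hm'
  have hn1 : n ≤ 1 := by linarith
  simp only [smul_eq_mul]
  rw [hσ.eq_geo _ _ hn hn1]
  exact dist_geo_le _ _ _ hn hn1

theorem IsGeodesicLine.abs_dist_sub_le {X : Type*} [MetricSpace X] {σ : ℝ → X}
    (hσ : IsGeodesicLine σ) (p : X) (s t : ℝ) : |dist p (σ s) - dist p (σ t)| ≤ |s - t| := by
  have := _root_.abs_dist_sub_le (σ s) (σ t) p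
  rwa [hσ, dist_comm _ p, dist_comm _ p] at this

theorem IsGeodesicLine.comp_isometryEquiv {X : Type*} [MetricSpace X] {σ : ℝ → X}
    (hσ : IsGeodesicLine σ) (f : X ≃ᵢ X) : IsGeodesicLine fun t => f (σ t) := fun s t => by
  rw [f.dist_eq, hσ]

/-- A nearest point on a line makes an angle of at least `π / 2`. -/
theorem IsGeodesicLine.sq_add_sq_le {σ : ℝ → X} (hσ : IsGeodesicLine σ) {p : X} {a : ℝ}
    (ha : ∀ t, dist p (σ a) ≤ dist p (σ t)) (v : ℝ) :
    dist p (σ a) ^ 2 + (a - v) ^ 2 ≤ dist p (σ v) ^ 2 := by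
  by_contra hlt
  push Not at hlt
  set R := dist p (σ a)
  have hR : 0 ≤ R := dist_nonneg
  set e := R ^ 2 + (a - v) ^ 2 - dist p (σ v) ^ 2 with he
  have he0 : 0 < e := by linarith
  -- Moving from `σ a` by the fraction `m` toward `σ v` changes the squared distance by at most `m *
  -- (m * (a - v) ^ 2 - e)`. This `m` makes the bracket negative, against minimality at `a`.
  set m := e / (e + (a - v) ^ 2 + 1) with hm
  have hm0 : 0 < m := by positivity
  have hm1 : m ≤ 1 := by rw [hm, div_le_one (by positivity)]; nlinarith [sq_nonneg (a - v)]
  have h1 := hσ.dist_sq_le p a v hm0.le hm1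
  have b : R ^ 2 ≤ dist p (σ ((1 - m) * a + m * v)) ^ 2 := pow_le_pow_left₀ hR (ha _) 2
  have c : m * (e + (a - v) ^ 2 + 1) = e := by rw [hm]; field_simp
  have d : m * (R ^ 2) ≤ m * (dist p (σ v) ^ 2 - (1 - m) * (a - v) ^ 2) := by nlinarith
  have d' := le_of_mul_le_mul_left d hm0
  nlinarith [sq_nonneg (a - v)]

theorem IsGeodesicLine.continuous {X : Type*} [MetricSpace X] {σ : ℝ → X}
    (hσ : IsGeodesicLine σ) : Continuous σ :=
  (Isometry.of_dist_eq fun s t => by rw [hσ, Real.dist_eq]).continuous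

end CatZero

/-! ### Locally compact Hadamard spaces are proper -/

/-- The Hopf–Rinow argument. The set `S` of radii with compact closed ball contains its supremum:
pushing points along geodesics into a slightly smaller ball gives total boundedness. By local
compactness a compact ball has a compact thickening, so the supremum cannot be finite. -/
theorem IsHadamardSpace.properSpace {X : Type*} [MetricSpace X] [LocallyCompactSpace X]
    (hX : IsHadamardSpace X) : ProperSpace X := by
  have := hX.complete
  have := hX.catZero
  have hsub : ∀ (o : X) (r δ : ℝ), 0 ≤ r → 0 ≤ δ → ∀ x ∈ Metric.closedBall o (r + δ),
      ∃ y ∈ Metric.closedBall o r, dist x y ≤ δ := by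
    intro o r δ hr hδ x hx
    rw [Metric.mem_closedBall, dist_comm] at hx
    rcases le_total (dist o x) r with h | h
    · exact ⟨x, by rwa [Metric.mem_closedBall, dist_comm], by simpa⟩
    · refine ⟨pt o x r, ?_, ?_⟩
      · rw [Metric.mem_closedBall, dist_comm, dist_left_pt hr h]
      · rw [dist_comm, dist_pt_right hr h]; linarith
  refine ProperSpace.of_isCompact_closedBall_of_le 0 fun o R hR => ?_
  set S := {r : ℝ | 0 ≤ r ∧ IsCompact (Metric.closedBall o r)} with hS
  have h0 : (0 : ℝ) ∈ S := ⟨le_rfl, by simp⟩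
  have hdown : ∀ r ∈ S, ∀ s ≤ r, 0 ≤ s → s ∈ S := fun r hr s hs h => ⟨h,
    hr.2.of_isClosed_subset Metric.isClosed_closedBall (Metric.closedBall_subset_closedBall hs)⟩
  by_contra hnot
  have hbdd : BddAbove S := by
    refine ⟨R, fun r hr => ?_⟩
    by_contra hlt
    exact hnot (hdown r hr R (not_le.1 hlt).le hR).2
  set ρ := sSup S with hρ
  have hρ0 : 0 ≤ ρ := le_csSup hbdd h0
  have hlt : ∀ r < ρ, 0 ≤ r → r ∈ S := by
    intro r hr h
    obtain ⟨s, hs, hrs⟩ := exists_lt_of_lt_csSup ⟨0, h0⟩ hr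
    exact hdown s hs r hrs.le h
  have hρS : ρ ∈ S := by
    refine ⟨hρ0, TotallyBounded.isCompact_of_isClosed ?_ Metric.isClosed_closedBall⟩
    rcases hρ0.eq_or_lt with h | h
    · rw [← h]; simp
    rw [Metric.totallyBounded_iff]
    intro ε hε
    set δ := min ρ (ε / 2) with hδ
    have hδ0 : 0 < δ := lt_min h (by linarith)
    have hc := (hlt (ρ - δ) (by linarith) (by linarith [min_le_left ρ (ε / 2)])).2
    obtain ⟨t, ht, hcov⟩ := Metric.totallyBounded_iff.1 hc.totallyBounded (ε / 2) (by linarith)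
    refine ⟨t, ht, fun x hx => ?_⟩
    obtain ⟨y, hy, hxy⟩ := hsub o (ρ - δ) δ (by linarith [min_le_left ρ (ε / 2)]) hδ0.le x
      (by simpa using hx)
    obtain ⟨z, hz, hyz⟩ := Set.mem_iUnion₂.1 (hcov hy)
    refine Set.mem_iUnion₂.2 ⟨z, hz, ?_⟩
    rw [Metric.mem_ball] at hyz ⊢
    linarith [dist_triangle x y z, min_le_right ρ (ε / 2)]
  obtain ⟨δ, hδ, hc⟩ := hρS.2.exists_isCompact_cthickening
  have : ρ + δ ∈ S := by
    refine ⟨by linarith, hc.of_isClosed_subset Metric.isClosed_closedBall fun x hx => ?_⟩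
    obtain ⟨y, hy, hxy⟩ := hsub o ρ δ hρ0 hδ.le x hx
    exact Metric.mem_cthickening_of_dist_le x y δ _ hy hxy
  linarith [le_csSup hbdd this]

end HadamardProducts

namespace HadamardProducts

open Filter Topology

/-! ### Flat half-planes from linear Busemann functions -/

theorem exists_tendsto_of_bounded {X : Type*} [MetricSpace X] [ProperSpace X] {ι : Type*}
    (U : Ultrafilter ι) (x : ι → X) (o : X) (C : ℝ) (h : ∀ᶠ i in U, dist (x i) o ≤ C) :
    ∃ y, Tendsto x U (𝓝 y) := by
  obtain ⟨y, -, hy⟩ := (isCompact_closedBall o C).ultrafilter_le_nhds (U.map x) (by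
    rw [le_principal_iff]; exact h)
  exact ⟨y, hy⟩

/-- A sequence of points whose distance functions, restricted to `σ`, converge to an affine
function of slope different from `±1` after normalization. -/
def HasFlatDirection {X : Type*} [MetricSpace X] (σ : ℝ → X) : Prop :=
  ∃ c : ℝ, |c| < 1 ∧ ∃ (ι : Type) (U : Filter ι) (_ : U.NeBot) (x : ι → X),
    ∀ t, Tendsto (fun i => dist (x i) (σ t) - dist (x i) (σ 0)) U (𝓝 (c * t))

theorem HasFlatDirection.of_neg {X : Type*} [MetricSpace X] {σ : ℝ → X}
    (h : HasFlatDirection fun t => σ (-t)) : HasFlatDirection σ := by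
  obtain ⟨c, hc, ι, U, hU, x, hx⟩ := h
  refine ⟨-c, by rwa [abs_neg], ι, U, hU, x, fun t => ?_⟩
  have := hx (-t)
  simpa using this

/-- Only the lower bound is missing. A segment descending from `(y, w)` through `(y', w')` is
prolonged to its boundary point `(y0, 0)`; both distances to that point are exact, and the triangle
inequality does the rest. -/
theorem dist_sq_eq_of_halfPlane_map {X : Type*} [MetricSpace X] {F : ℝ → ℝ → X}
    (hle : ∀ y w y' w', 0 ≤ w → 0 ≤ w' →
      dist (F y w) (F y' w') ^ 2 ≤ (y - y') ^ 2 + (w - w') ^ 2)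
    (hbdry : ∀ y w y', 0 ≤ w → dist (F y w) (F y' 0) ^ 2 = (y - y') ^ 2 + w ^ 2)
    {y w y' w' : ℝ} (hw : 0 ≤ w) (hw' : 0 ≤ w') :
    dist (F y w) (F y' w') ^ 2 = (y - y') ^ 2 + (w - w') ^ 2 := by
  have key : ∀ y w y' w', 0 ≤ w' → w' < w →
      Real.sqrt ((y - y') ^ 2 + (w - w') ^ 2) ≤ dist (F y w) (F y' w') := by
    intro y w y' w' hw' hlt
    set E := Real.sqrt ((y - y') ^ 2 + (w - w') ^ 2) with hE
    have hE2 : E ^ 2 = (y - y') ^ 2 + (w - w') ^ 2 := Real.sq_sqrt (by positivity)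
    have hE0 : 0 ≤ E := Real.sqrt_nonneg _
    have hww : 0 < w - w' := sub_pos.2 hlt
    set r := w / (w - w') with hr
    have hrw : r * (w - w') = w := by rw [hr]; field_simp
    have hr1 : 1 ≤ r := by rw [hr, le_div_iff₀ hww]; linarith
    set y0 := y + r * (y' - y) with hy0
    have e1 : dist (F y w) (F y0 0) = r * E := by
      rw [← abs_of_nonneg (dist_nonneg (x := F y w)), ← abs_of_nonneg (by positivity : 0 ≤ r * E),
        ← sq_eq_sq_iff_abs_eq_abs, hbdry _ _ _ (hw'.trans hlt.le), mul_pow, hE2, hy0]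
      linear_combination (-(w + r * (w - w'))) * hrw
    have e2 : dist (F y' w') (F y0 0) = (r - 1) * E := by
      have h0 : 0 ≤ (r - 1) * E := mul_nonneg (by linarith) hE0
      rw [← abs_of_nonneg (dist_nonneg (x := F y' w')), ← abs_of_nonneg h0,
        ← sq_eq_sq_iff_abs_eq_abs, hbdry _ _ _ hw', mul_pow, hE2, hy0]
      have : (r - 1) * (w - w') = w' := by linarith
      linear_combination (-(w' + (r - 1) * (w - w'))) * this
    have := dist_triangle (F y w) (F y' w') (F y0 0)
    rw [e1, e2] at this
    linarith
  refine le_antisymm (hle _ _ _ _ hw hw') ?_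
  have hgoal : Real.sqrt ((y - y') ^ 2 + (w - w') ^ 2) ≤ dist (F y w) (F y' w') := by
    rcases lt_trichotomy w w' with h | h | h
    · rw [dist_comm]
      convert key y' w' y w hw h using 2
      ring
    · subst h
      rw [sub_self, zero_pow two_ne_zero, add_zero, Real.sqrt_sq_eq_abs]
      -- A horizontal segment never meets the boundary, so one endpoint is raised by `ε`.
      refine le_of_forall_pos_le_add fun ε hε => ?_
      have h1 := key y (w + ε) y' w hw (by linarith)
      have h2 : |y - y'| ≤ Real.sqrt ((y - y') ^ 2 + (w + ε - w) ^ 2) :=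
        Real.abs_le_sqrt (by nlinarith)
      have h3 : dist (F y (w + ε)) (F y w) ≤ ε := by
        have := hle y (w + ε) y w (by linarith) hw
        rw [sub_self, zero_pow two_ne_zero, zero_add, add_sub_cancel_left] at this
        exact (pow_le_pow_iff_left₀ dist_nonneg hε.le two_ne_zero).1 this
      linarith [dist_triangle (F y (w + ε)) (F y w) (F y' w)]
    · exact key y w y' w' hw' h
  have := pow_le_pow_left₀ (Real.sqrt_nonneg _) hgoal 2
  rwa [Real.sq_sqrt (by positivity)] at this

section

variable {X : Type*} [MetricSpace X] [CatZero X]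

/-- Bruhat–Tits applied twice, arranged so that `x` enters only through `dist q x - dist p x` and
through the quotients `s / dist p x` and `s' / dist q x`, which vanish as `x` goes to infinity. -/
theorem dist_pt_pt_sq_le {p q x : X} {s s' : ℝ} (hs : 0 ≤ s) (hs' : 0 ≤ s')
    (hp : s ≤ dist p x) (hq : s' ≤ dist q x) (hp0 : 0 < dist p x) (hq0 : 0 < dist q x) :
    dist (pt p x s) (pt q x s') ^ 2 ≤
      (1 - s' / dist q x) * ((1 - s / dist p x) * dist p q ^ 2 +
        2 * s * (dist q x - dist p x) + s / dist p x * (dist q x - dist p x) ^ 2 + s ^ 2)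
      - 2 * s' * (dist q x - dist p x + s) + s' / dist q x * (dist q x - dist p x + s) ^ 2
      + s' ^ 2 := by
  have a := dist_geo_sq_le (pt p x s) q x (t := s' / dist q x) (by positivity)
    ((div_le_one hq0).2 hq)
  have b := dist_geo_sq_le q p x (t := s / dist p x) (by positivity) ((div_le_one hp0).2 hp)
  change dist (pt p x s) (pt q x s') ^ 2 ≤ _ at a
  change dist q (pt p x s) ^ 2 ≤ _ at b
  rw [dist_pt_right hs hp, dist_comm _ q] at a
  rw [dist_comm q p] at b
  have c := mul_le_mul_of_nonneg_left b (sub_nonneg.2 ((div_le_one hq0).2 hq))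
  refine a.trans ((add_le_add_left (add_le_add_left c _) _).trans (le_of_eq ?_))
  field_simp
  ring

theorem boundsFlatHalfPlane_of_map {σ : ℝ → X} {F : ℝ → ℝ → X} (hσ : ∀ y, F y 0 = σ y)
    (h : ∀ y w y' w', 0 ≤ w → 0 ≤ w' →
      dist (F y w) (F y' w') ^ 2 = (y - y') ^ 2 + (w - w') ^ 2) :
    BoundsFlatHalfPlane σ := by
  set ι : HalfPlane → X := fun p => F (p.1 1) (p.1 0) with hι
  have hiso : Isometry ι := by
    refine Isometry.of_dist_eq fun p q => ?_
    rw [Subtype.dist_eq, EuclideanSpace.dist_eq, Fin.sum_univ_two, Real.dist_eq, Real.dist_eq,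
      sq_abs, sq_abs, add_comm, ← h _ _ _ _ p.2 q.2, Real.sqrt_sq dist_nonneg]
  have hcl : IsClosed {p : EuclideanSpace ℝ (Fin 2) | 0 ≤ p 0} :=
    isClosed_le continuous_const (by fun_prop)
  have : CompleteSpace HalfPlane := hcl.completeSpace_coe
  refine ⟨ι, hiso, hiso.isClosedEmbedding.isClosed_range, ?_, fun t => ?_⟩
  · rintro _ ⟨p, rfl⟩ _ ⟨q, rfl⟩ τ l hτ t ht
    have hl := hτ.length_eq
    subst hl
    set m := t / dist (ι p) (ι q) with hm
    have hm0 : 0 ≤ m := div_nonneg ht.1 dist_nonneg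
    have hm1 : m ≤ 1 := div_le_one_of_le₀ ht.2 dist_nonneg
    have hmt : m * dist (ι p) (ι q) = t := by
      rcases (dist_nonneg (x := ι p) (y := ι q)).eq_or_lt with h0 | h0
      · have h2 := ht.2
        rw [← h0] at h2
        rw [← h0]
        linarith [ht.1]
      · rw [hm]; field_simp
    have hd := hτ.dividesAt hm0 hm1
    rw [hmt] at hd
    have hmem : 0 ≤ (AffineMap.lineMap (p : EuclideanSpace ℝ (Fin 2)) q m :
        EuclideanSpace ℝ (Fin 2)) 0 := by
      rw [AffineMap.lineMap_apply_module]
      simp only [PiLp.add_apply, PiLp.smul_apply, smul_eq_mul]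
      have := p.2
      have := q.2
      have : 0 ≤ 1 - m := by linarith
      positivity
    refine ⟨⟨_, hmem⟩, ?_⟩
    refine DividesAt.unique hm0 hm1 ⟨?_, ?_⟩ hd
    · rw [hiso.dist_eq, hiso.dist_eq, Subtype.dist_eq, Subtype.dist_eq, dist_left_lineMap,
        Real.norm_of_nonneg hm0]
    · rw [hiso.dist_eq, hiso.dist_eq, Subtype.dist_eq, Subtype.dist_eq, dist_lineMap_right,
        Real.norm_of_nonneg (by linarith)]
  · simp [hι, HalfPlane.bdry, hσ]

/-- Let `ρ t s` be the limit of the points at distance `s` from `σ t` on the geodesics toward `x i`.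
In the limit Bruhat–Tits bounds the distances of these points by the Euclidean ones for parallel
rays whose angle with the line has cosine `-c`. Equality against boundary points is forced by
Bruhat–Tits at the midpoint `σ t` of `σ t'` and `σ (2 * t - t')`; `dist_sq_eq_of_halfPlane_map` then
gives equality everywhere. -/
theorem HasFlatDirection.boundsFlatHalfPlane [ProperSpace X] {σ : ℝ → X}
    (hσ : IsGeodesicLine σ) (hflat : HasFlatDirection σ) : BoundsFlatHalfPlane σ := by
  obtain ⟨c, hc, ι, V, hV, x, hxV⟩ := hflat
  set U : Ultrafilter ι := Ultrafilter.of V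
  have hx : ∀ t, Tendsto (fun i => dist (x i) (σ t) - dist (x i) (σ 0)) U (𝓝 (c * t)) :=
    fun t => (hxV t).mono_left (Ultrafilter.of_le V)
  have hdiff : ∀ t t', Tendsto (fun i => dist (σ t') (x i) - dist (σ t) (x i)) U
      (𝓝 (c * (t' - t))) := by
    intro t t'
    have := (hx t').sub (hx t)
    rw [mul_sub]
    refine this.congr fun i => ?_
    rw [dist_comm (σ t'), dist_comm (σ t)]; ring
  -- The limit increments at `t + v` and `t - v` cancel, so eventually twice the distance to `σ t`
  -- is at least the sum of the distances to `σ (t + v)` and `σ (t - v)` minus 1, hence at least `2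
  -- * v - 1`.
  have hD : ∀ t, Tendsto (fun i => dist (σ t) (x i)) U atTop := by
    intro t
    rw [tendsto_atTop]
    intro B
    set v := max B 0 + 1
    have hv : 0 < v := by positivity
    have h1 := hdiff t (t + v)
    have h2 := hdiff t (t - v)
    have h3 := h1.add h2
    rw [show c * (t + v - t) + c * (t - v - t) = 0 by ring] at h3
    filter_upwards [h3.eventually (gt_mem_nhds (zero_lt_one (α := ℝ)))] with i hi
    have h4 := dist_triangle_right (σ (t + v)) (σ (t - v)) (x i)
    rw [hσ, show t + v - (t - v) = 2 * v by ring, abs_of_pos (by positivity)] at h4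
    have : B ≤ max B 0 := le_max_left _ _
    have : v = max B 0 + 1 := rfl
    linarith
  have hsmall : ∀ t s : ℝ, Tendsto (fun i => s / dist (σ t) (x i)) U (𝓝 0) :=
    fun t s => (hD t).const_div_atTop s
  have hex : ∀ t s, ∃ y, 0 ≤ s → Tendsto (fun i => pt (σ t) (x i) s) U (𝓝 y) := by
    intro t s
    by_cases hs : 0 ≤ s
    · obtain ⟨y, hy⟩ := exists_tendsto_of_bounded U (fun i => pt (σ t) (x i) s) (σ t) s (by
        filter_upwards [(hD t).eventually_ge_atTop s] with i hi
        rw [dist_comm, dist_left_pt hs hi])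
      exact ⟨y, fun _ => hy⟩
    · exact ⟨σ t, fun h => absurd h hs⟩
  choose ρ hρ using hex
  have hupper : ∀ t s t' s', 0 ≤ s → 0 ≤ s' → dist (ρ t s) (ρ t' s') ^ 2 ≤
      (t - t') ^ 2 + (s - s') ^ 2 - 2 * c * (t - t') * (s - s') := by
    intro t s t' s' hs hs'
    have l1 := ((hρ t s hs).dist (hρ t' s' hs')).pow 2
    have hμ := hsmall t' s'
    have hν := hsmall t s
    have hε := hdiff t t'
    have one : Tendsto (fun _ : ι => (1 : ℝ)) U (𝓝 1) := tendsto_const_nhds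
    have l2 := ((((one.sub hμ).mul (((((one.sub hν).mul
      (tendsto_const_nhds (x := dist (σ t) (σ t') ^ 2))).add
      (hε.const_mul (2 * s))).add (hν.mul (hε.pow 2))).add
      (tendsto_const_nhds (x := s ^ 2)))).sub
      ((hε.add (tendsto_const_nhds (x := s))).const_mul (2 * s'))).add
      (hμ.mul ((hε.add (tendsto_const_nhds (x := s))).pow 2))).add
      (tendsto_const_nhds (x := s' ^ 2))
    refine (le_of_tendsto_of_tendsto l1 l2 ?_).trans (le_of_eq ?_)
    · filter_upwards [(hD t).eventually_ge_atTop s, (hD t').eventually_ge_atTop s',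
        (hD t).eventually_gt_atTop 0, (hD t').eventually_gt_atTop 0] with i h1 h2 h3 h4
      exact dist_pt_pt_sq_le hs hs' h1 h2 h3 h4
    · rw [hσ, sq_abs]; ring
  have hρ0 : ∀ t, ρ t 0 = σ t := fun t => by
    refine tendsto_nhds_unique (hρ t 0 le_rfl) ?_
    simp [pt]
  have hρs : ∀ t s, 0 ≤ s → dist (ρ t s) (σ t) = s := fun t s hs => by
    refine tendsto_nhds_unique ((hρ t s hs).dist (tendsto_const_nhds (x := σ t))) ?_
    refine tendsto_const_nhds.congr' ?_
    filter_upwards [(hD t).eventually_ge_atTop s] with i h1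
    rw [dist_comm, dist_left_pt hs h1]
  have hbase : ∀ t s t', 0 ≤ s → dist (ρ t s) (σ t') ^ 2 =
      (t - t') ^ 2 + s ^ 2 - 2 * c * (t - t') * s := by
    intro t s t' hs
    have a := hσ.dist_sq_le (ρ t s) t' (2 * t - t') (t := 1 / 2) (by norm_num) (by norm_num)
    rw [show (1 - 1 / 2) * t' + 1 / 2 * (2 * t - t') = t by ring, hρs t s hs] at a
    have u1 := hupper t s t' 0 hs le_rfl
    have u2 := hupper t s (2 * t - t') 0 hs le_rfl
    rw [hρ0] at u1 u2
    nlinarith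
  set k := Real.sqrt (1 - c ^ 2) with hk
  have hc2 : 0 < 1 - c ^ 2 := by
    rw [← sq_abs]; nlinarith [abs_nonneg c]
  have hk0 : 0 < k := Real.sqrt_pos.2 hc2
  have hk2 : k ^ 2 = 1 - c ^ 2 := Real.sq_sqrt hc2.le
  -- Passage from oblique to orthonormal coordinates: `ρ t s` has height `w = k * s` above the line
  -- and foot `y = t - c * s`, where `k` is the sine of the angle.
  refine boundsFlatHalfPlane_of_map (F := fun y w => ρ (y + c * (w / k)) (w / k)) ?_ ?_
  · intro y
    simp [hρ0]
  · intro y w y' w' hw hw'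
    have ek : ∀ w w' : ℝ, (w - w') ^ 2 = (1 - c ^ 2) * (w / k - w' / k) ^ 2 := by
      intro w w'
      rw [← hk2]; field_simp
    refine dist_sq_eq_of_halfPlane_map (F := fun y w => ρ (y + c * (w / k)) (w / k))
      ?_ ?_ hw hw'
    · intro y w y' w' hw hw'
      refine (hupper _ _ _ _ (by positivity) (by positivity)).trans (le_of_eq ?_)
      rw [ek w w']; ring
    · intro y w y' hw
      simp only [zero_div, mul_zero, add_zero, hρ0]
      rw [hbase _ _ _ (by positivity)]
      have := ek w 0
      rw [sub_zero, zero_div, sub_zero] at this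
      rw [this]; ring

end

end HadamardProducts

namespace HadamardProducts

open Filter Topology

/-! ### Geodesics with endpoints close to the ends of a rank one line -/

theorem _root_.ConvexOn.eq_of_bddAbove {f : ℝ → ℝ} (hf : ConvexOn ℝ Set.univ f) {C : ℝ}
    (hC : ∀ t, f t ≤ C) (a b : ℝ) : f a = f b := by
  have key : ∀ a b, f b ≤ f a := by
    intro a b
    by_contra hlt
    push Not at hlt
    obtain ⟨n, hn⟩ := exists_nat_gt ((C - f a) / (f b - f a))
    rw [div_lt_iff₀ (by linarith)] at hn
    have hm : (0 : ℝ) < n + 1 := by positivity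
    have h1 : (1 : ℝ) / (n + 1) ≤ 1 := by rw [div_le_one hm]; linarith [n.cast_nonneg (α := ℝ)]
    have := hf.2 (Set.mem_univ a) (Set.mem_univ (a + (n + 1) * (b - a)))
      (sub_nonneg.2 h1) (by positivity : (0 : ℝ) ≤ 1 / (n + 1)) (by ring)
    simp only [smul_eq_mul] at this
    rw [show (1 - 1 / ((n : ℝ) + 1)) * a + 1 / (n + 1) * (a + (n + 1) * (b - a)) = b by
      field_simp; ring] at this
    have h2 := this.trans (add_le_add_right (mul_le_mul_of_nonneg_left
      (hC (a + (n + 1) * (b - a))) (by positivity : (0 : ℝ) ≤ 1 / (n + 1))) _)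
    have h3 := mul_le_mul_of_nonneg_left h2 hm.le
    rw [show ((n : ℝ) + 1) * ((1 - 1 / (n + 1)) * f a + 1 / (n + 1) * C) = n * f a + C by
      field_simp; ring] at h3
    nlinarith
  exact le_antisymm (key b a) (key a b)

section

variable {X : Type*} [MetricSpace X] [CatZero X]

/-- A flat strip argument. Bounded convex functions are constant, so every `dist (W (s + v)) (σ s)`
depends on `v` alone. Both diagonals of the quadrilateral `σ 0, σ t, W t, W 0` have square at least
`R ^ 2 + t ^ 2` by the angle at the nearest point `W 0`, and the quadrilateral inequality bounds
their sum by twice that. -/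
theorem dist_sq_eq_of_parallel {σ W : ℝ → X} (hσ : IsGeodesicLine σ) (hW : IsGeodesicLine W)
    {R : ℝ} (h1 : ∀ t, dist (W t) (σ t) ≤ R) (h2 : ∀ t, R ≤ dist (W t) (σ 0))
    (t : ℝ) : dist (W 0) (σ t) ^ 2 = R ^ 2 + t ^ 2 := by
  have hconst : ∀ v s, dist (W (s + v)) (σ s) = dist (W v) (σ 0) := by
    intro v s
    have := (hW.convexOn_dist hσ v).eq_of_bddAbove (C := |v| + R) (fun t => ?_) s 0
    · simpa using this
    · have a := dist_triangle (W (t + v)) (W t) (σ t)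
      rw [hW, add_sub_cancel_left] at a
      linarith [h1 t]
  have h0 : dist (W 0) (σ 0) = R := le_antisymm (h1 0) (h2 0)
  have hlow : ∀ v, R ^ 2 + v ^ 2 ≤ dist (W v) (σ 0) ^ 2 := by
    intro v
    have := hW.sq_add_sq_le (p := σ 0) (a := 0) (fun t => ?_) v
    · rwa [dist_comm, h0, zero_sub, neg_sq, dist_comm (σ 0)] at this
    · rw [dist_comm, h0, dist_comm]; exact h2 t
  have hq := dist_sq_add_dist_sq_le (σ 0) (σ t) (W t) (W 0)
  have hc : dist (W t) (σ t) = R := by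
    have := hconst 0 t
    rwa [add_zero, h0] at this
  rw [dist_comm (σ t) (W t), hc, hW, hσ, h0] at hq
  simp only [sub_zero, zero_sub, sq_abs, abs_neg] at hq
  have e1 := hlow t
  have e2 := hlow (-t)
  rw [← hconst (-t) t, add_neg_cancel] at e2
  rw [dist_comm (σ 0) (W t), dist_comm (σ t) (W 0)] at hq
  nlinarith

theorem pt_pt {x y : X} {s m : ℝ} (h0 : 0 ≤ s) (h1 : s ≤ m) (h2 : m ≤ dist x y) :
    pt x (pt x y m) s = pt x y s := by
  have hm : 0 ≤ m := h0.trans h1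
  have hd := dist_left_pt hm h2
  symm
  rw [pt.eq_1 x (pt x y m), hd]
  have e : s / m * m = s := by
    rcases hm.eq_or_lt with h | h
    · rw [← h]; linarith
    · field_simp
  refine DividesAt.eq_geo (by positivity) (div_le_one_of_le₀ h1 hm) ⟨?_, ?_⟩
  · rw [dist_left_pt h0 (h1.trans h2), hd, e]
  · rw [dist_pt_pt h0 (h1.trans h2) hm h2, hd, sub_mul, e, abs_sub_comm,
      abs_of_nonneg (by linarith), one_mul]

theorem IsGeodesicLine.pt_eq {σ : ℝ → X} (hσ : IsGeodesicLine σ) {s n : ℝ} (h0 : 0 ≤ s)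
    (h1 : s ≤ n) : pt (σ 0) (σ n) s = σ s := by
  have hn := h0.trans h1
  rw [pt, hσ, zero_sub, abs_neg, abs_of_nonneg hn,
    ← hσ.eq_geo _ _ (by positivity) (div_le_one_of_le₀ h1 hn)]
  congr 1
  rcases hn.eq_or_lt with h | h
  · rw [← h]; simp; linarith
  · field_simp; ring

theorem dist_pt_line_le {σ : ℝ → X} (hσ : IsGeodesicLine σ) {x : X} {s n : ℝ} (h0 : 0 ≤ s)
    (h1 : s ≤ n) (hn : 0 < n) (hx : n ≤ dist (σ 0) x) (h : dist (pt (σ 0) x n) (σ n) ≤ 1) :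
    dist (pt (σ 0) x s) (σ s) ≤ s / n := by
  have hd := dist_left_pt hn.le hx
  rw [← pt_pt h0 h1 hx, ← hσ.pt_eq h0 h1]
  generalize pt (σ 0) x n = w at *
  rw [pt, pt, hd, hσ, zero_sub, abs_neg, abs_of_pos hn]
  refine (dist_geo_geo_le_right _ _ _ (by positivity) (div_le_one_of_le₀ h1 hn.le)).trans ?_
  exact mul_le_of_le_one_right (by positivity) h

/-- Points at equal proportion are at most `dist p q` apart. The second summand is the price of
passing to equal arc length, and it vanishes as `x` recedes. -/
theorem dist_pt_pt_le_of_common_end {p q x : X} {s : ℝ} (h0 : 0 ≤ s) (hp : s ≤ dist p x)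
    (hq : s ≤ dist q x) :
    dist (pt p x s) (pt q x s) ≤ dist p q + s * dist p q / dist p x := by
  rcases (h0.trans hp).eq_or_lt with h | h
  · have : s = 0 := by linarith
    subst this
    simp [pt]
  have hl0 : 0 ≤ s / dist p x := by positivity
  have hl1 : s / dist p x ≤ 1 := (div_le_one h).2 hp
  have a := dist_geo_geo_le_left p q x hl0 hl1
  have b : dist (geo q x (s / dist p x)) (pt q x s) ≤ s * dist p q / dist p x := by
    rw [pt, dist_geo_same _ _ hl0 hl1 (by positivity) (div_le_one_of_le₀ hq dist_nonneg)]
    have e : |s / dist p x - s / dist q x| * dist q x ≤ s * |dist q x - dist p x| / dist p x := by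
      rcases (h0.trans hq).eq_or_lt with h' | h'
      · rw [← h', mul_zero]; positivity
      · rw [div_sub_div _ _ h.ne' h'.ne', abs_div, ← mul_sub_comm s, abs_mul,
          abs_of_nonneg h0, abs_of_pos (mul_pos h h')]
        refine le_of_eq ?_
        field_simp
    refine e.trans ?_
    gcongr
    rw [dist_comm p q]
    exact abs_dist_sub_le q p x
  have c := dist_triangle (geo p x (s / dist p x)) (geo q x (s / dist p x)) (pt q x s)
  have d : (1 - s / dist p x) * dist p q ≤ dist p q :=
    mul_le_of_le_one_left dist_nonneg (by linarith)
  change dist (geo p x (s / dist p x)) (pt q x s) ≤ _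
  linarith
where
  mul_sub_comm (s : ℝ) {a b : ℝ} : s * (a - b) = s * a - b * s := by ring

theorem continuousOn_geo (x y : X) : ContinuousOn (geo x y) (Set.Icc 0 1) := by
  refine LipschitzOnWith.continuousOn (K := nndist x y) (LipschitzOnWith.of_dist_le_mul ?_)
  intro s hs t ht
  rw [dist_geo_same x y hs.1 hs.2 ht.1 ht.2, Real.dist_eq, mul_comm, coe_nndist]

/-- If a family of geodesics starts close to `o` and ends far from it, then one of its members is
at a prescribed distance from `o`. -/
theorem exists_geo_at_dist {o : X} {p q : ℝ → X} {K R : ℝ} (hK : 0 ≤ K)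
    (hp : ∀ a ∈ Set.Icc (0 : ℝ) 1, ∀ b ∈ Set.Icc (0 : ℝ) 1, dist (p a) (p b) ≤ K * |a - b|)
    (hq : ∀ a ∈ Set.Icc (0 : ℝ) 1, ∀ b ∈ Set.Icc (0 : ℝ) 1, dist (q a) (q b) ≤ K * |a - b|)
    (h0 : ∃ m ∈ Set.Icc (0 : ℝ) 1, dist o (geo (p 0) (q 0) m) ≤ R)
    (h1 : ∀ m ∈ Set.Icc (0 : ℝ) 1, R ≤ dist o (geo (p 1) (q 1) m)) :
    ∃ a ∈ Set.Icc (0 : ℝ) 1, ∃ m ∈ Set.Icc (0 : ℝ) 1, dist o (geo (p a) (q a) m) = R ∧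
      ∀ k ∈ Set.Icc (0 : ℝ) 1, R ≤ dist o (geo (p a) (q a) k) := by
  have hne : (Set.Icc (0 : ℝ) 1).Nonempty := ⟨0, by simp⟩
  have hmin : ∀ a : ℝ, ∃ m ∈ Set.Icc (0 : ℝ) 1, ∀ k ∈ Set.Icc (0 : ℝ) 1,
      dist o (geo (p a) (q a) m) ≤ dist o (geo (p a) (q a) k) := fun a =>
    isCompact_Icc.exists_isMinOn hne ((continuous_const.dist continuous_id).comp_continuousOn (continuousOn_geo _ _))
  choose m hm hmk using hmin
  set F : ℝ → ℝ := fun a => dist o (geo (p a) (q a) (m a)) with hF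
  have hcont : ContinuousOn F (Set.Icc 0 1) := by
    refine LipschitzOnWith.continuousOn (K := K.toNNReal)
      (LipschitzOnWith.of_le_add_mul _ fun a ha b hb => ?_)
    have e1 := hmk a (m b) (hm b)
    have e2 := dist_geo_geo_le (p b) (q b) (p a) (q a) (hm b).1 (hm b).2
    have e3 := dist_triangle o (geo (p b) (q b) (m b)) (geo (p a) (q a) (m b))
    have e4 := mul_le_mul_of_nonneg_left (hp b hb a ha) (sub_nonneg.2 (hm b).2)
    have e5 := mul_le_mul_of_nonneg_left (hq b hb a ha) (hm b).1
    rw [Real.coe_toNNReal _ hK, Real.dist_eq, abs_sub_comm]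
    simp only [hF]
    linarith
  obtain ⟨k, hk, hk2⟩ := h0
  obtain ⟨a, ha, haR⟩ := intermediate_value_Icc zero_le_one hcont
    (⟨(hmk 0 k hk).trans hk2, h1 _ (hm 1)⟩ : R ∈ Set.Icc (F 0) (F 1))
  exact ⟨a, ha, m a, hm a, haR, fun k hk => haR ▸ hmk a k hk⟩

theorem dist_pt_pt_of_between {x y z : X} (h : dist x z + dist z y = dist x y) {s t : ℝ}
    (hs0 : 0 ≤ s) (hs1 : s ≤ dist z x) (ht0 : 0 ≤ t) (ht1 : t ≤ dist z y) :
    dist (pt z x s) (pt z y t) = s + t := by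
  have a := dist_left_pt hs0 hs1
  have b := dist_left_pt ht0 ht1
  have c := dist_pt_right hs0 hs1
  have d := dist_pt_right ht0 ht1
  have e := dist_triangle4 x (pt z x s) (pt z y t) y
  have f := dist_triangle_left (pt z x s) (pt z y t) z
  rw [dist_comm x (pt z x s), c, d] at e
  rw [dist_comm x z] at h
  linarith [dist_comm x y]

theorem pt_between {x y z : X} (h : dist x z + dist z y = dist x y) {s : ℝ}
    (hs0 : 0 ≤ s) (hs1 : s ≤ dist z x) :
    dist x (pt z x s) + dist (pt z x s) y = dist x y := by
  have a := dist_left_pt hs0 hs1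
  have c := dist_pt_right hs0 hs1
  have e := dist_triangle x (pt z x s) y
  have f := dist_triangle_left (pt z x s) y z
  rw [dist_comm x (pt z x s), c] at e ⊢
  rw [dist_comm x z] at h
  linarith [dist_comm x y]

/-- If geodesics with endpoints arbitrarily close to the ends of a line stay outside the ball of
radius `R`, then there is a point which sees the line as if from a parallel line at
distance `R`. -/
theorem exists_dist_sq_eq [ProperSpace X] {σ : ℝ → X} (hσ : IsGeodesicLine σ) {R : ℝ}
    (hR : 1 ≤ R)
    (h : ∀ n : ℝ, 0 < n → ∃ x y, n ≤ dist (σ 0) x ∧ n ≤ dist (σ 0) y ∧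
      dist (pt (σ 0) x n) (σ (-n)) ≤ 1 ∧ dist (pt (σ 0) y n) (σ n) ≤ 1 ∧
      ∀ z, dist x z + dist z y = dist x y → R < dist z (σ 0)) :
    ∃ z, ∀ t, dist z (σ t) ^ 2 = R ^ 2 + t ^ 2 := by
  have hneg : IsGeodesicLine fun t => σ (-t) := fun s t => by
    rw [hσ, ← abs_neg]; congr 1; ring
  have hstep : ∀ n : ℕ, ∃ x y z : X, 0 < n → (n : ℝ) ≤ dist (σ 0) x ∧ (n : ℝ) ≤ dist (σ 0) y ∧
      dist (pt (σ 0) x n) (σ (-n)) ≤ 1 ∧ dist (pt (σ 0) y n) (σ n) ≤ 1 ∧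
      dist x z + dist z y = dist x y ∧ dist (σ 0) z = R ∧
      ∀ w, dist x w + dist w y = dist x y → R ≤ dist w (σ 0) := by
    intro n
    rcases Nat.eq_zero_or_pos n with h0 | h0
    · exact ⟨σ 0, σ 0, σ 0, fun hh => absurd hh (by omega)⟩
    have hn : (0 : ℝ) < n := by exact_mod_cast h0
    obtain ⟨x, y, hx, hy, hxn, hyn, hfar⟩ := h n hn
    set o := σ 0
    -- The endpoints slide outward from distance `n` at `a = 0` to `x` and `y` at `a = 1`. At `a =
    -- 0` the midpoint of the geodesic is within 1 of `o`, hence within `R`; at `a = 1` the geodesic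
    -- avoids the ball. In between, some geodesic has distance exactly `R` from `o`.
    set p : ℝ → X := fun a => pt o x (n + a * (dist o x - n)) with hp
    set q : ℝ → X := fun a => pt o y (n + a * (dist o y - n)) with hq
    have hrange : ∀ x, (n : ℝ) ≤ dist o x → ∀ a ∈ Set.Icc (0 : ℝ) 1,
        (n : ℝ) ≤ n + a * (dist o x - n) ∧ n + a * (dist o x - n) ≤ dist o x := by
      intro x hx a ha
      constructor
      · nlinarith [ha.1]
      · nlinarith [ha.2]
    have hlip : ∀ x, (n : ℝ) ≤ dist o x → ∀ a ∈ Set.Icc (0 : ℝ) 1, ∀ b ∈ Set.Icc (0 : ℝ) 1,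
        dist (pt o x (n + a * (dist o x - n))) (pt o x (n + b * (dist o x - n))) =
          (dist o x - n) * |a - b| := by
      intro x hx a ha b hb
      have r1 := hrange x hx a ha
      have r2 := hrange x hx b hb
      rw [dist_pt_pt (hn.le.trans r1.1) r1.2 (hn.le.trans r2.1) r2.2,
        show n + a * (dist o x - n) - (n + b * (dist o x - n)) = (dist o x - n) * (a - b) by ring,
        abs_mul, abs_of_nonneg (by linarith)]
    obtain ⟨a, ha, m, hm, hmR, hall⟩ := exists_geo_at_dist (o := o) (p := p) (q := q)
      (K := dist o x + dist o y) (R := R) (by positivity)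
      (fun a ha b hb => by
        rw [hlip x hx a ha b hb]
        refine mul_le_mul_of_nonneg_right ?_ (abs_nonneg _)
        linarith [dist_nonneg (x := o) (y := y)])
      (fun a ha b hb => by
        rw [hlip y hy a ha b hb]
        refine mul_le_mul_of_nonneg_right ?_ (abs_nonneg _)
        linarith [dist_nonneg (x := o) (y := x)])
      ⟨1 / 2, by constructor <;> norm_num, by
        have e := hσ.eq_geo (-n) n (t := 1 / 2) (by norm_num) (by norm_num)
        rw [show (1 - 1 / 2) * (-(n : ℝ)) + 1 / 2 * n = 0 by ring] at e
        have f := dist_geo_geo_le (σ (-n)) (σ n) (p 0) (q 0) (t := 1 / 2) (by norm_num)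
          (by norm_num)
        rw [← e] at f
        simp only [hp, hq, zero_mul, add_zero] at f ⊢
        rw [dist_comm _ (pt o x n), dist_comm _ (pt o y n)] at f
        linarith⟩
      (fun m hm => by
        simp only [hp, hq, one_mul, add_sub_cancel]
        have e1 : ∀ x, pt o x (dist o x) = x := fun x => by
          rcases (dist_nonneg (x := o) (y := x)).eq_or_lt with h | h
          · have := dist_eq_zero.1 h.symm
            subst this; simp [pt]
          · rw [pt, div_self h.ne', geo_one]
        rw [e1, e1, dist_comm]
        exact (hfar _ (dist_add_dist_geo x y hm.1 hm.2)).le)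
    have rx := hrange x hx a ha
    have ry := hrange y hy a ha
    refine ⟨p a, q a, geo (p a) (q a) m, fun _ => ⟨?_, ?_, ?_, ?_, ?_, hmR, ?_⟩⟩
    · rw [dist_left_pt (hn.le.trans rx.1) rx.2]; exact rx.1
    · rw [dist_left_pt (hn.le.trans ry.1) ry.2]; exact ry.1
    · rwa [pt_pt hn.le rx.1 rx.2]
    · rwa [pt_pt hn.le ry.1 ry.2]
    · exact dist_add_dist_geo _ _ hm.1 hm.2
    · intro w hw
      obtain ⟨k, hk0, hk1, rfl⟩ := exists_eq_geo_of_dist_add hw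
      rw [dist_comm]
      exact hall k ⟨hk0, hk1⟩
  choose x y z hxyz using hstep
  -- The geodesic from `x n` to `y n`, parametrized by arc length from its point `z n` at distance
  -- `R` from `σ 0`. Its limit `W` will be a line parallel to `σ`.
  set w : ℕ → ℝ → X := fun n t => if t ≤ 0 then pt (z n) (x n) (-t) else pt (z n) (y n) t with hw
  have hzx : ∀ n : ℕ, 0 < n → (n : ℝ) - R ≤ dist (z n) (x n) := fun n hn => by
    obtain ⟨h1, -, -, -, -, h6, -⟩ := hxyz n hn
    linarith [dist_triangle (σ 0) (z n) (x n)]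
  have hzy : ∀ n : ℕ, 0 < n → (n : ℝ) - R ≤ dist (z n) (y n) := fun n hn => by
    obtain ⟨-, h1, -, -, -, h6, -⟩ := hxyz n hn
    linarith [dist_triangle (σ 0) (z n) (y n)]
  set U : Ultrafilter ℕ := Filter.hyperfilter ℕ with hU
  have hlarge : ∀ B : ℝ, ∀ᶠ n : ℕ in U, 0 < n ∧ B ≤ (n : ℝ) - R := by
    intro B
    have : ∀ᶠ n : ℕ in atTop, 0 < n ∧ B ≤ (n : ℝ) - R := by
      filter_upwards [eventually_gt_atTop 0, eventually_ge_atTop ⌈B + R⌉₊] with n hn hB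
      exact ⟨hn, by linarith [Nat.le_of_ceil_le hB]⟩
    exact Nat.hyperfilter_le_atTop this
  have hww : ∀ s t : ℝ, ∀ᶠ n in U, dist (w n s) (w n t) = |s - t| := by
    intro s t
    filter_upwards [hlarge (max |s| |t|)] with n hn
    have h1 := hn.2.trans (hzx n hn.1)
    have h2 := hn.2.trans (hzy n hn.1)
    obtain ⟨-, -, -, -, h5, -, -⟩ := hxyz n hn.1
    have s1 := (le_max_left |s| |t|).trans h1
    have s2 := (le_max_left |s| |t|).trans h2
    have t1 := (le_max_right |s| |t|).trans h1
    have t2 := (le_max_right |s| |t|).trans h2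
    simp only [hw]
    split_ifs with a b b
    · rw [abs_of_nonpos a] at s1
      rw [abs_of_nonpos b] at t1
      rw [dist_pt_pt (by linarith) s1 (by linarith) t1, ← abs_neg]; congr 1; ring
    · push Not at b
      rw [abs_of_nonpos a] at s1
      rw [abs_of_pos b] at t2
      rw [dist_pt_pt_of_between h5 (by linarith) s1 b.le t2, abs_of_nonpos (by linarith)]; ring
    · push Not at a
      rw [abs_of_pos a] at s2
      rw [abs_of_nonpos b] at t1
      rw [dist_comm, dist_pt_pt_of_between h5 (by linarith) t1 a.le s2,
        abs_of_nonneg (by linarith)]; ring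
    · push Not at a b
      rw [abs_of_pos a] at s2
      rw [abs_of_pos b] at t2
      rw [dist_pt_pt a.le s2 b.le t2]
  have hwz : ∀ n, w n 0 = z n := fun n => by simp [hw, pt]
  have hw0 : ∀ᶠ n in U, dist (w n 0) (σ 0) = R := by
    filter_upwards [hlarge 0] with n hn
    rw [hwz, dist_comm]
    exact (hxyz n hn.1).2.2.2.2.2.1
  have hlim : ∀ t, ∃ y, Tendsto (fun n => w n t) U (𝓝 y) := by
    intro t
    refine exists_tendsto_of_bounded U _ (σ 0) (|t| + R) ?_
    filter_upwards [hw0, hww t 0] with n h1 h2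
    rw [sub_zero] at h2
    linarith [dist_triangle (w n t) (w n 0) (σ 0)]
  choose W hWl using hlim
  have hWline : IsGeodesicLine W := fun s t =>
    tendsto_nhds_unique_of_eventuallyEq ((hWl s).dist (hWl t)) tendsto_const_nhds (hww s t)
  have hWfar : ∀ t, R ≤ dist (W t) (σ 0) := by
    intro t
    refine ge_of_tendsto ((hWl t).dist (tendsto_const_nhds (x := σ 0))) ?_
    filter_upwards [hlarge |t|] with n hn
    have h1 := hn.2.trans (hzx n hn.1)
    have h2 := hn.2.trans (hzy n hn.1)
    obtain ⟨-, -, -, -, h5, -, h7⟩ := hxyz n hn.1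
    apply h7
    simp only [hw]
    split_ifs with a
    · rw [abs_of_nonpos a] at h1
      exact pt_between h5 (by linarith) h1
    · push Not at a
      rw [abs_of_pos a] at h2
      have h5' : dist (y n) (z n) + dist (z n) (x n) = dist (y n) (x n) := by
        rw [dist_comm (y n) (z n), dist_comm (z n) (x n), dist_comm (y n) (x n), add_comm, h5]
      have := pt_between h5' a.le h2
      rw [dist_comm (x n), dist_comm _ (y n), add_comm, this, dist_comm]
  -- Stated for a general line `τ` through `σ 0`, so as to serve for both halves of `W`: for `σ` and
  -- for its reversal.
  have hest : ∀ (τ : ℝ → X), IsGeodesicLine τ → τ 0 = σ 0 → ∀ (x : X) (n : ℕ) (s : ℝ), 0 ≤ s →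
      0 < n → s + 1 ≤ (n : ℝ) - R → (n : ℝ) ≤ dist (τ 0) x → dist (pt (τ 0) x n) (τ n) ≤ 1 →
      dist (σ 0) (z n) = R → dist (pt (z n) x s) (τ s) ≤ R + s * R * (n - R)⁻¹ + s / n := by
    intro τ hτ hτ0 x n s hs hn0 hn hx hxn hz
    have hn0' : (0 : ℝ) < n := by exact_mod_cast hn0
    have hzx : (n : ℝ) - R ≤ dist (z n) x := by
      rw [hτ0] at hx
      linarith [dist_triangle (σ 0) (z n) x]
    have a := dist_pt_pt_le_of_common_end (p := z n) (q := τ 0) (x := x) hs (by linarith)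
      (by linarith)
    have b := dist_pt_line_le hτ hs (by linarith) hn0' hx hxn
    have c := dist_triangle (pt (z n) x s) (pt (τ 0) x s) (τ s)
    rw [dist_comm (z n) (τ 0), hτ0, hz] at a
    rw [hτ0] at b c
    have d : s * R / dist (z n) x ≤ s * R * (n - R)⁻¹ := by
      rw [div_eq_mul_inv]
      have : 0 < (n : ℝ) - R := by linarith
      gcongr
    linarith
  have htend : Tendsto (fun n : ℕ => (n : ℝ)) U atTop :=
    tendsto_natCast_atTop_atTop.mono_left Nat.hyperfilter_le_atTop
  have hbound : ∀ s, Tendsto (fun n : ℕ => R + s * R * ((n : ℝ) - R)⁻¹ + s / n) U (𝓝 R) := by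
    intro s
    have h1 : Tendsto (fun n : ℕ => ((n : ℝ) - R)⁻¹) U (𝓝 0) :=
      tendsto_inv_atTop_zero.comp (tendsto_atTop_add_const_right _ (-R) htend)
    have h2 : Tendsto (fun n : ℕ => s / (n : ℝ)) U (𝓝 0) := htend.const_div_atTop s
    have := (tendsto_const_nhds (x := R)).add (h1.const_mul (s * R)) |>.add h2
    simpa using this
  have hWclose : ∀ t, dist (W t) (σ t) ≤ R := by
    intro t
    refine le_of_tendsto_of_tendsto ((hWl t).dist (tendsto_const_nhds (x := σ t)))
      (hbound |t|) ?_
    filter_upwards [hlarge (|t| + 1)] with n hn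
    obtain ⟨h1, h2, h3, h4, -, h6, -⟩ := hxyz n hn.1
    simp only [hw]
    split_ifs with a
    · rw [abs_of_nonpos a] at hn ⊢
      have := hest (fun t => σ (-t)) hneg (by simp) (x n) n (-t) (by linarith) hn.1 hn.2
        (by simpa using h1) (by simpa using h3) h6
      simpa using this
    · push Not at a
      rw [abs_of_pos a] at hn ⊢
      exact hest σ hσ rfl (y n) n t a.le hn.1 hn.2 h2 h4 h6
  exact ⟨W 0, dist_sq_eq_of_parallel hσ hWline hWclose hWfar⟩

/-- If every radius `n + 1` failed, there would be points `z n` with `dist (z n) (σ t) ^ 2 = (n + 1)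
^ 2 + t ^ 2`. Their normalized distance functions tend to 0, a flat direction of slope 0. -/
theorem exists_radius_of_not_hasFlatDirection [ProperSpace X] {σ : ℝ → X}
    (hσ : IsGeodesicLine σ) (hflat : ¬ HasFlatDirection σ) :
    ∃ R S : ℝ, 0 < R ∧ 0 < S ∧ ∀ x y, S ≤ dist (σ 0) x → S ≤ dist (σ 0) y →
      dist (pt (σ 0) x S) (σ (-S)) ≤ 1 → dist (pt (σ 0) y S) (σ S) ≤ 1 →
      ∃ z, dist x z + dist z y = dist x y ∧ dist z (σ 0) ≤ R := by
  by_contra hcon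
  push Not at hcon
  have hex : ∀ n : ℕ, ∃ z, ∀ t, dist z (σ t) ^ 2 = ((n : ℝ) + 1) ^ 2 + t ^ 2 := fun n =>
    exists_dist_sq_eq hσ (by linarith [n.cast_nonneg (α := ℝ)]) fun S hS =>
      hcon (n + 1) S (by positivity) hS
  choose z hz using hex
  refine hflat ⟨0, by simp, ℕ, atTop, inferInstance, z, fun t => ?_⟩
  rw [zero_mul]
  have h0 : ∀ n, dist (z n) (σ 0) = n + 1 := fun n => by
    have := hz n 0
    rw [zero_pow two_ne_zero, add_zero] at this
    exact (pow_left_inj₀ dist_nonneg (by positivity) two_ne_zero).1 this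
  have hlim : Tendsto (fun n : ℕ => t ^ 2 / ((n : ℝ) + 1)) atTop (𝓝 0) :=
    (tendsto_atTop_add_const_right _ 1 tendsto_natCast_atTop_atTop).const_div_atTop _
  refine squeeze_zero (fun n => ?_) (fun n => ?_) hlim
  · rw [h0, sub_nonneg]
    refine (pow_le_pow_iff_left₀ (by positivity) dist_nonneg two_ne_zero).1 ?_
    rw [hz]; nlinarith
  · rw [h0, sub_le_iff_le_add]
    refine (pow_le_pow_iff_left₀ dist_nonneg (by positivity) two_ne_zero).1 ?_
    have : (t ^ 2 / ((n : ℝ) + 1) + (n + 1)) ^ 2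
      = (t ^ 2 / ((n : ℝ) + 1)) ^ 2 + 2 * t ^ 2 + ((n : ℝ) + 1) ^ 2 := by field_simp; ring
    rw [hz, this]
    nlinarith [sq_nonneg (t ^ 2 / ((n : ℝ) + 1)), sq_nonneg t]

end

end HadamardProducts

namespace HadamardProducts

open Filter Topology

/-! ### Projections to geodesic lines -/

open Classical in
/-- The parameter of the point of the line `σ` which is nearest to `x`. -/
noncomputable def pr {X : Type*} [MetricSpace X] (σ : ℝ → X) (x : X) : ℝ :=
  if h : ∃ a, ∀ t, dist x (σ a) ≤ dist x (σ t) then h.choose else 0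

theorem IsGeodesicLine.dist_pr_le {X : Type*} [MetricSpace X] {σ : ℝ → X}
    (hσ : IsGeodesicLine σ) (x : X) (t : ℝ) : dist x (σ (pr σ x)) ≤ dist x (σ t) := by
  have hex : ∃ a, ∀ t, dist x (σ a) ≤ dist x (σ t) := by
    set d := dist x (σ 0) with hd
    have hd0 : 0 ≤ d := dist_nonneg
    obtain ⟨a, -, hmin⟩ := isCompact_Icc.exists_isMinOn (s := Set.Icc (-(2 * d)) (2 * d))
      ⟨0, by constructor <;> linarith⟩ (continuous_const.dist hσ.continuous).continuousOn
    refine ⟨a, fun t => ?_⟩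
    by_cases ht : t ∈ Set.Icc (-(2 * d)) (2 * d)
    · exact hmin ht
    · have h0 : dist x (σ a) ≤ d := hmin (⟨by linarith, by linarith⟩ : (0 : ℝ) ∈ Set.Icc _ _)
      have h1 := dist_triangle_left (σ 0) (σ t) x
      rw [hσ, zero_sub, abs_neg] at h1
      have h2 : 2 * d < |t| := by
        by_contra hle
        exact ht (abs_le.1 (not_lt.1 hle))
      linarith
  rw [pr, dif_pos hex]
  exact hex.choose_spec t

section

variable {X : Type*} [MetricSpace X] [CatZero X] {σ : ℝ → X}

theorem IsGeodesicLine.dist_pr_sq (hσ : IsGeodesicLine σ) (x : X) (t : ℝ) :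
    dist x (σ (pr σ x)) ^ 2 + (pr σ x - t) ^ 2 ≤ dist x (σ t) ^ 2 :=
  hσ.sq_add_sq_le (hσ.dist_pr_le x) t

theorem IsGeodesicLine.pr_eq (hσ : IsGeodesicLine σ) {x : X} {a : ℝ}
    (ha : ∀ t, dist x (σ a) ≤ dist x (σ t)) : pr σ x = a := by
  have h1 := hσ.dist_pr_sq x a
  have h2 := pow_le_pow_left₀ dist_nonneg (ha (pr σ x)) 2
  have h3 : (pr σ x - a) ^ 2 ≤ 0 := by linarith
  exact sub_eq_zero.1 (pow_eq_zero_iff two_ne_zero |>.1 (le_antisymm h3 (sq_nonneg _)))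

/-- The quadrilateral inequality for the two points and their feet, combined with the obtuse angles
at the feet. -/
theorem IsGeodesicLine.abs_pr_sub_le (hσ : IsGeodesicLine σ) (x y : X) :
    |pr σ x - pr σ y| ≤ dist x y := by
  refine abs_le_of_sq_le_sq ?_ dist_nonneg
  have h1 := hσ.dist_pr_sq x (pr σ y)
  have h2 := hσ.dist_pr_sq y (pr σ x)
  have h3 := dist_sq_add_dist_sq_le x (σ (pr σ x)) (σ (pr σ y)) y
  rw [hσ, sq_abs, dist_comm (σ (pr σ x)) y, dist_comm (σ (pr σ y)) y, dist_comm y x] at h3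
  nlinarith

theorem IsGeodesicLine.pr_apply (hσ : IsGeodesicLine σ) (t : ℝ) : pr σ (σ t) = t :=
  hσ.pr_eq fun s => by rw [dist_self]; exact dist_nonneg

theorem IsGeodesicLine.abs_pr_sub_le_dist (hσ : IsGeodesicLine σ) (x : X) (t : ℝ) :
    |pr σ x - t| ≤ dist x (σ t) := by
  have := hσ.abs_pr_sub_le x (σ t)
  rwa [hσ.pr_apply] at this

theorem IsGeodesicLine.pr_map (hσ : IsGeodesicLine σ) (f : X ≃ᵢ X) (x : X) :
    pr (fun t => f (σ t)) (f x) = pr σ x :=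
  (hσ.comp_isometryEquiv f).pr_eq fun t => by
    rw [f.dist_eq, f.dist_eq]; exact hσ.dist_pr_le x t

theorem IsGeodesicLine.add {X : Type*} [MetricSpace X] {σ : ℝ → X} (hσ : IsGeodesicLine σ) (s : ℝ) :
    IsGeodesicLine fun t => σ (t + s) := fun a b => by
  rw [hσ]; congr 1; ring

theorem IsGeodesicLine.neg {X : Type*} [MetricSpace X] {σ : ℝ → X} (hσ : IsGeodesicLine σ) : IsGeodesicLine fun t => σ (-t) :=
  fun a b => by rw [hσ, ← abs_neg]; congr 1; ring

theorem IsGeodesicLine.pr_add (hσ : IsGeodesicLine σ) (s : ℝ) (x : X) :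
    pr (fun t => σ (t + s)) x = pr σ x - s :=
  (hσ.add s).pr_eq fun t => by
    rw [sub_add_cancel]; exact hσ.dist_pr_le x _

theorem IsGeodesicLine.pr_neg (hσ : IsGeodesicLine σ) (x : X) :
    pr (fun t => σ (-t)) x = -pr σ x :=
  hσ.neg.pr_eq fun t => by
    rw [neg_neg]; exact hσ.dist_pr_le x _

theorem IsAxis.pr_apply {f : X ≃ᵢ X} {l : ℝ} (h : IsAxis f l σ) (x : X) :
    pr σ (f x) = pr σ x + l := by
  have h1 := h.2.1.pr_map f x
  have h2 : (fun t => f (σ t)) = fun t => σ (t + l) := funext h.2.2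
  rw [h2, h.2.1.pr_add] at h1
  linarith

theorem IsAxis.zpow_apply {X : Type*} [MetricSpace X] {σ : ℝ → X} {f : X ≃ᵢ X} {l : ℝ}
    (h : IsAxis f l σ) (k : ℤ) (t : ℝ) :
    (f ^ k) (σ t) = σ (t + k * l) := by
  induction k using Int.induction_on generalizing t with
  | zero => simp
  | succ k ih =>
    rw [zpow_add_one, IsometryEquiv.mul_apply, h.2.2, ih]; congr 1; push_cast; ring
  | pred k ih =>
    have : f⁻¹ (σ t) = σ (t - l) := by
      rw [← IsometryEquiv.symm_apply_apply f (σ (t - l)), h.2.2, sub_add_cancel]; rfl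
    rw [zpow_sub_one, IsometryEquiv.mul_apply, this, ih]; congr 1; push_cast; ring

theorem IsAxis.pr_zpow_apply {f : X ≃ᵢ X} {l : ℝ} (h : IsAxis f l σ) (k : ℤ) (x : X) :
    pr σ ((f ^ k) x) = pr σ x + k * l := by
  have h1 := h.2.1.pr_map (f ^ k) x
  have h2 : (fun t => (f ^ k) (σ t)) = fun t => σ (t + k * l) := funext fun t => h.zpow_apply k t
  rw [h2, h.2.1.pr_add] at h1
  linarith

theorem IsAxis.inv {X : Type*} [MetricSpace X] {σ : ℝ → X} {f : X ≃ᵢ X} {l : ℝ}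
    (h : IsAxis f l σ) : IsAxis f⁻¹ l fun t => σ (-t) := by
  refine ⟨h.1, fun a b => by rw [h.2.1, ← abs_neg]; congr 1; ring, fun t => ?_⟩
  have := h.zpow_apply (-1) (-t)
  rw [zpow_neg_one] at this
  rw [this]; congr 1; push_cast; ring

theorem IsAxis.dist_zpow_neg {X : Type*} [MetricSpace X] {σ : ℝ → X} {f : X ≃ᵢ X} {l : ℝ}
    (h : IsAxis f l σ) (k : ℤ) (x : X) (t : ℝ) :
    dist ((f ^ (-k)) x) (σ t) = dist x (σ (t + k * l)) := by
  rw [← h.zpow_apply k, ← (f ^ k).dist_eq, ← IsometryEquiv.mul_apply, ← zpow_add, add_neg_cancel,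
    zpow_zero]; rfl

/-! ### Asymptotic slopes of distance functions -/

theorem _root_.ConvexOn.mul_slope_le {f : ℝ → ℝ} (hf : ConvexOn ℝ Set.univ f) {s t a b : ℝ}
    (hst : s < t) (hta : t ≤ a) (hab : a < b) :
    (f t - f s) * (b - a) ≤ (f b - f a) * (t - s) := by
  have h1 : (f t - f s) / (t - s) ≤ (f b - f a) / (b - a) := by
    rcases hta.eq_or_lt with rfl | h
    · exact hf.slope_mono_adjacent (Set.mem_univ _) (Set.mem_univ _) hst hab
    · exact (hf.slope_mono_adjacent (Set.mem_univ _) (Set.mem_univ _) hst h).trans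
        (hf.slope_mono_adjacent (Set.mem_univ _) (Set.mem_univ _) h hab)
  rwa [div_le_div_iff₀ (by linarith) (by linarith)] at h1

theorem IsGeodesicLine.dist_mono (hσ : IsGeodesicLine σ) {x : X} {s t : ℝ}
    (hs : pr σ x ≤ s) (hst : s ≤ t) : dist x (σ s) ≤ dist x (σ t) := by
  have hc := (hσ.convexOn_dist_point x).le_max_of_mem_Icc (Set.mem_univ (pr σ x))
    (Set.mem_univ t) ⟨hs, hst⟩
  simpa [hσ.dist_pr_le x t] using hc

/-- Slopes of a distance function on the line are at most 1 and increase by convexity; the claim is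
that they approach 1 uniformly. Otherwise a limit `H` of offending distance functions is convex,
nondecreasing on the positive axis, and has slopes bounded away from 1. Its slopes increase to some
`c < 1`, and pulling back by large powers of `f` straightens `H` into a linear function of slope
`c`, a flat direction. -/
theorem IsAxis.exists_slope_bound {f : X ≃ᵢ X} {l : ℝ} (h : IsAxis f l σ)
    (hflat : ¬ HasFlatDirection σ) {S δ : ℝ} (hS : 0 < S) (hδ : 0 < δ) :
    ∃ M, ∀ x, pr σ x ≤ 0 → ∀ t, M ≤ t → S - δ ≤ dist x (σ t) - dist x (σ (t - S)) := by
  have hσ := h.2.1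
  by_contra hcon
  push Not at hcon
  choose x hx T hT hslope using fun n : ℕ => hcon n
  set U : Ultrafilter ℕ := Filter.hyperfilter ℕ
  have hlim : ∀ t, ∃ y, Tendsto (fun n => dist (x n) (σ t) - dist (x n) (σ 0)) U (𝓝 y) := by
    intro t
    refine exists_tendsto_of_bounded U _ 0 |t| (Eventually.of_forall fun n => ?_)
    have := hσ.abs_dist_sub_le (x n) t 0
    rw [sub_zero] at this
    rwa [Real.dist_eq, sub_zero]
  choose H hH using hlim
  have hsub : ∀ s t, Tendsto (fun n => dist (x n) (σ t) - dist (x n) (σ s)) U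
      (𝓝 (H t - H s)) := fun s t =>
    ((hH t).sub (hH s)).congr fun n => by ring
  have hHslope : ∀ s t a b, s < t → t ≤ a → a < b →
      (H t - H s) * (b - a) ≤ (H b - H a) * (t - s) := by
    intro s t a b hst hta hab
    exact le_of_tendsto_of_tendsto ((hsub s t).mul_const _) ((hsub a b).mul_const _)
      (Eventually.of_forall fun n =>
        (hσ.convexOn_dist_point (x n)).mul_slope_le hst hta hab)
  have hpos : ∀ s t, 0 ≤ s → s ≤ t → 0 ≤ H t - H s := fun s t hs hst =>
    ge_of_tendsto (hsub s t) (Eventually.of_forall fun n =>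
      sub_nonneg.2 (hσ.dist_mono ((hx n).trans hs) hst))
  have hup : ∀ s t, s < t → (H t - H s) * S ≤ (S - δ) * (t - s) := by
    intro s t hst
    refine le_of_tendsto ((hsub s t).mul_const S) ?_
    have hev : ∀ᶠ n : ℕ in U, t + S ≤ n :=
      Nat.hyperfilter_le_atTop (by
        filter_upwards [eventually_ge_atTop ⌈t + S⌉₊] with n hn using Nat.le_of_ceil_le hn)
    filter_upwards [hev] with n hn
    have h1 := (hσ.convexOn_dist_point (x n)).mul_slope_le hst
      (by linarith [hT n] : t ≤ T n - S) (by linarith : T n - S < T n)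
    rw [sub_sub_cancel] at h1
    exact h1.trans (mul_le_mul_of_nonneg_right (hslope n).le (by linarith))
  set A : Set ℝ := {c | ∃ s t, 0 ≤ s ∧ s < t ∧ c = (H t - H s) / (t - s)} with hA
  have hAle : ∀ c ∈ A, c ≤ (S - δ) / S := by
    rintro _ ⟨s, t, -, hst, rfl⟩
    rw [div_le_div_iff₀ (by linarith) hS]
    exact hup s t hst
  have hAne : (H 1 - H 0) / (1 - 0) ∈ A := ⟨0, 1, le_rfl, zero_lt_one, rfl⟩
  have hAb : BddAbove A := ⟨_, hAle⟩
  set c := sSup A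
  have hc0 : 0 ≤ c := by
    refine le_trans ?_ (le_csSup hAb hAne)
    have := hpos 0 1 le_rfl zero_le_one
    simpa using this
  have hc1 : c < 1 := by
    refine (csSup_le ⟨_, hAne⟩ hAle).trans_lt ?_
    rw [div_lt_one hS]; linarith
  have hcle : ∀ s t, 0 ≤ s → s ≤ t → H t - H s ≤ c * (t - s) := by
    intro s t hs hst
    rcases hst.eq_or_lt with rfl | hst
    · simp
    · rw [← div_le_iff₀ (by linarith)]
      exact le_csSup hAb ⟨s, t, hs, hst, rfl⟩
  have hcge : ∀ ε > 0, ∃ t0, 0 ≤ t0 ∧ ∀ s t, t0 ≤ s → s ≤ t → (c - ε) * (t - s) ≤ H t - H s := by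
    intro ε hε
    obtain ⟨_, ⟨s0, t0, hs0, hst0, rfl⟩, hlt⟩ := exists_lt_of_lt_csSup ⟨_, hAne⟩
      (sub_lt_self c hε)
    refine ⟨t0, hs0.trans hst0.le, fun s t hs hst => ?_⟩
    rcases hst.eq_or_lt with rfl | hst
    · simp
    · rw [lt_div_iff₀ (by linarith)] at hlt
      have h1 := hHslope s0 t0 s t hst0 hs hst
      have h2 : (c - ε) * (t - s) * (t0 - s0) ≤ (H t - H s) * (t0 - s0) := by
        nlinarith
      exact le_of_mul_le_mul_right h2 (by linarith)
  -- The flat direction is an iterated limit: for each large exponent `m`, the index `n` runs along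
  -- `U`. The filter `Filter.curry` expresses this without extracting a diagonal sequence.
  have hne : (Filter.curry (atTop : Filter ℕ) (U : Filter ℕ)).NeBot := by
    refine ⟨fun hbot => ?_⟩
    have : ∀ᶠ p in Filter.curry (atTop : Filter ℕ) (U : Filter ℕ), False := by
      rw [hbot]; exact eventually_bot
    rw [eventually_curry_iff] at this
    obtain ⟨_, hm⟩ := this.exists
    exact hm.exists.choose_spec
  refine hflat ⟨c, by rwa [abs_of_nonneg hc0], ℕ × ℕ, Filter.curry atTop U, hne,
    fun p => (f ^ (-(p.1 : ℤ))) (x p.2), fun t => ?_⟩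
  rw [Metric.tendsto_nhds]
  intro ε hε
  rw [eventually_curry_iff]
  set η := ε / (2 * (|t| + 1)) with hη
  have hη0 : 0 < η := by positivity
  have hηt : η * |t| ≤ ε / 2 := by
    rw [hη, div_mul_eq_mul_div, div_le_div_iff₀ (by positivity) (by norm_num)]
    nlinarith [abs_nonneg t]
  obtain ⟨t0, ht0, hge⟩ := hcge η hη0
  filter_upwards [eventually_ge_atTop ⌈(t0 + |t|) / l⌉₊] with m hm
  have hml : t0 + |t| ≤ m * l := by
    have := Nat.le_of_ceil_le hm
    rwa [div_le_iff₀ h.1] at this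
  have hHm : |H (t + m * l) - H (0 + m * l) - c * t| ≤ ε / 2 := by
    refine le_trans ?_ hηt
    rcases le_total 0 t with h0 | h0
    · rw [abs_of_nonneg h0] at hml ⊢
      have h1 := hcle (0 + m * l) (t + m * l) (by linarith) (by linarith)
      have h2 := hge (0 + m * l) (t + m * l) (by linarith) (by linarith)
      rw [abs_le]; constructor <;> nlinarith
    · rw [abs_of_nonpos h0] at hml ⊢
      have h1 := hcle (t + m * l) (0 + m * l) (by linarith) (by linarith)
      have h2 := hge (t + m * l) (0 + m * l) (by linarith) (by linarith)
      rw [abs_le]; constructor <;> nlinarith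
  filter_upwards [(Metric.tendsto_nhds.1 (hsub (0 + m * l) (t + m * l))) (ε / 2) (by linarith)]
    with n hn
  rw [h.dist_zpow_neg, h.dist_zpow_neg]
  rw [Real.dist_eq] at hn ⊢
  push_cast
  have := abs_add_le (dist (x n) (σ (t + m * l)) - dist (x n) (σ (0 + m * l)) -
    (H (t + m * l) - H (0 + m * l))) (H (t + m * l) - H (0 + m * l) - c * t)
  rw [sub_add_sub_cancel] at this
  linarith

/-- The hypothesis says that `q` is almost between `p` and `x`. Bruhat–Tits bounds the squared
distance from `q` to the geodesic point at its own distance `S` from `p` by `2 * S * δ + δ ^ 2`. -/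
theorem dist_pt_le_one_of_slope {p q x : X} {S δ : ℝ} (hS : dist p q = S) (hS0 : 0 < S)
    (hδ : 0 < δ) (hδ1 : 2 * S * δ + δ ^ 2 ≤ 1) (hD : S ≤ dist p x)
    (h : S - δ ≤ dist p x - dist q x) : dist (pt p x S) q ≤ 1 := by
  have hD0 : 0 < dist p x := hS0.trans_le hD
  have a := dist_geo_sq_le q p x (t := S / dist p x) (by positivity) ((div_le_one hD0).2 hD)
  rw [dist_comm q p, hS] at a
  rw [pt, dist_comm]
  refine (sq_le_one_iff₀ dist_nonneg).1 (a.trans (le_trans ?_ hδ1))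
  set D := dist p x
  have b : dist q x ^ 2 ≤ (D - S + δ) ^ 2 := pow_le_pow_left₀ dist_nonneg (by linarith) 2
  have c := mul_le_mul_of_nonneg_left b (by positivity : 0 ≤ S / D)
  have e : (1 - S / D) * S ^ 2 + S / D * (D - S + δ) ^ 2 - S / D * (1 - S / D) * D ^ 2
      = 2 * S * δ - S / D * (2 * S * δ) + S / D * δ ^ 2 := by
    field_simp; ring
  have f : S / D * δ ^ 2 ≤ 1 * δ ^ 2 :=
    mul_le_mul_of_nonneg_right ((div_le_one hD0).2 hD) (by positivity)
  have g : 0 ≤ S / D * (2 * S * δ) := by positivity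
  linarith

theorem IsAxis.exists_near_end {f : X ≃ᵢ X} {l : ℝ} (h : IsAxis f l σ)
    (hflat : ¬ HasFlatDirection σ) {S : ℝ} (hS : 0 < S) :
    ∃ M, ∀ x, pr σ x ≤ -M → S ≤ dist (σ 0) x ∧ dist (pt (σ 0) x S) (σ (-S)) ≤ 1 := by
  have hσ := h.2.1
  set δ := 1 / (2 * S + 1) with hδ
  have hδ0 : 0 < δ := by positivity
  have hδ1 : δ < 1 := by rw [hδ, div_lt_one (by positivity)]; linarith
  have hδ2 : (2 * S + 1) * δ = 1 := by rw [hδ]; field_simp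
  -- The extra unit makes `S ≤ dist (σ 0) x` automatic, since `S + 1 - δ ≥ S`; the increment over
  -- length `S` is recovered because the distance function is 1-Lipschitz along the line.
  obtain ⟨M, hM⟩ := h.exists_slope_bound hflat (S := S + 1) (by linarith) hδ0
  set j := ⌈M / l⌉₊ with hj
  have hjM : M ≤ j * l := by
    have := Nat.le_ceil (M / l)
    rwa [div_le_iff₀ h.1] at this
  refine ⟨j * l, fun x hx => ?_⟩
  have h1 := hM ((f ^ (-(-(j : ℤ)))) x) (by
    rw [h.pr_zpow_apply]; push_cast; linarith) (j * l) hjM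
  rw [h.dist_zpow_neg, h.dist_zpow_neg] at h1
  push_cast at h1
  rw [show (j : ℝ) * l + -j * l = 0 by ring,
    show (j : ℝ) * l - (S + 1) + -j * l = -(S + 1) by ring] at h1
  have h2 := hσ.abs_dist_sub_le x (-S) (-(S + 1))
  rw [show -S - -(S + 1) = 1 by ring, abs_one] at h2
  have h3 := (abs_le.1 h2).2
  have h4 := dist_nonneg (x := x) (y := σ (-(S + 1)))
  have hD : S ≤ dist (σ 0) x := by rw [dist_comm]; linarith
  refine ⟨hD, dist_pt_le_one_of_slope (δ := δ) ?_ hS hδ0 (by nlinarith) hD ?_⟩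
  · rw [hσ, zero_sub, neg_neg, abs_of_pos hS]
  · rw [dist_comm (σ 0), dist_comm (σ (-S))]; linarith

/-- A contracting line: a geodesic between points with distant projections to the line passes
within distance `Q` of the part of the line between the projections. -/
structure Tight {X : Type*} [MetricSpace X] (σ : ℝ → X) (Q : ℝ) : Prop where
  line : IsGeodesicLine σ
  squeeze : ∀ x y t, pr σ x + Q ≤ t → t ≤ pr σ y - Q →
    ∃ z, dist x z + dist z y = dist x y ∧ dist z (σ t) ≤ Q

/-- A power of `f` brings `σ t` within one period of `σ 0`. The endpoints then project far out on
both sides, so they are near the two ends and the geodesic meets the ball of radius `R`; the summand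
`l` in `Q` pays for the period. -/
theorem IsAxis.exists_tight [ProperSpace X] {f : X ≃ᵢ X} {l : ℝ} (h : IsAxis f l σ)
    (hrank : ¬ BoundsFlatHalfPlane σ) : ∃ Q, Tight σ Q := by
  have hσ := h.2.1
  have hflat : ¬ HasFlatDirection σ := fun hf => hrank (hf.boundsFlatHalfPlane hσ)
  have hflat' : ¬ HasFlatDirection fun t => σ (-t) := fun hf => hflat hf.of_neg
  obtain ⟨R, S, hR, hS, hRS⟩ := exists_radius_of_not_hasFlatDirection hσ hflat
  obtain ⟨M, hM⟩ := h.exists_near_end hflat hS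
  obtain ⟨M', hM'⟩ := h.inv.exists_near_end hflat' hS
  simp only [hσ.pr_neg, neg_zero, neg_neg] at hM'
  set Q := max (max M M') R + l with hQ
  have q1 : M ≤ max (max M M') R := (le_max_left _ _).trans (le_max_left _ _)
  have q2 : M' ≤ max (max M M') R := (le_max_right _ _).trans (le_max_left _ _)
  have q3 : R ≤ max (max M M') R := le_max_right _ _
  refine ⟨Q, hσ, fun x y t hx hy => ?_⟩
  set k := ⌊t / l⌋ with hk
  have hk1 : k * l ≤ t := by
    have := Int.floor_le (t / l)
    rwa [le_div_iff₀ h.1] at this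
  have hk2 : t < k * l + l := by
    have := Int.lt_floor_add_one (t / l)
    rw [div_lt_iff₀ h.1] at this
    linarith
  obtain ⟨x1, x2⟩ := hM ((f ^ (-k)) x) (by rw [h.pr_zpow_apply]; push_cast; linarith)
  obtain ⟨y1, y2⟩ := hM' ((f ^ (-k)) y) (by rw [h.pr_zpow_apply]; push_cast; linarith)
  obtain ⟨z, hz, hzR⟩ := hRS _ _ x1 y1 x2 y2
  refine ⟨(f ^ k) z, ?_, ?_⟩
  · have e : ∀ x, x = (f ^ k) ((f ^ (-k)) x) := fun x => by
      rw [← IsometryEquiv.mul_apply, ← zpow_add, add_neg_cancel, zpow_zero]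
      rfl
    calc dist x ((f ^ k) z) + dist ((f ^ k) z) y
        = dist ((f ^ k) ((f ^ (-k)) x)) ((f ^ k) z) +
            dist ((f ^ k) z) ((f ^ k) ((f ^ (-k)) y)) := by rw [← e x, ← e y]
      _ = dist ((f ^ k) ((f ^ (-k)) x)) ((f ^ k) ((f ^ (-k)) y)) := by
        rw [(f ^ k).dist_eq, (f ^ k).dist_eq, (f ^ k).dist_eq, hz]
      _ = dist x y := by rw [← e x, ← e y]
  · have h1 : dist ((f ^ k) z) (σ (k * l)) ≤ R := by
      rw [← zero_add (k * l), ← h.zpow_apply, (f ^ k).dist_eq]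
      exact hzR
    have h2 := dist_triangle ((f ^ k) z) (σ (k * l)) (σ t)
    rw [hσ, abs_sub_comm, abs_of_nonneg (by linarith)] at h2
    linarith

theorem Tight.mono {X : Type*} [MetricSpace X] {σ : ℝ → X} {Q Q' : ℝ} (h : Tight σ Q) (hQ : Q ≤ Q') : Tight σ Q' :=
  ⟨h.line, fun x y t hx hy => by
    obtain ⟨z, hz, hd⟩ := h.squeeze x y t (by linarith) (by linarith)
    exact ⟨z, hz, hd.trans hQ⟩⟩

theorem Tight.comp {Q : ℝ} (h : Tight σ Q) (f : X ≃ᵢ X) : Tight (fun t => f (σ t)) Q := by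
  refine ⟨h.line.comp_isometryEquiv f, fun x y t hx hy => ?_⟩
  have e : ∀ x, x = f (f.symm x) := fun x => (f.apply_symm_apply x).symm
  have e2 : ∀ x, pr (fun t => f (σ t)) x = pr σ (f.symm x) := fun x => by
    conv_lhs => rw [e x, h.line.pr_map]
  rw [e2] at hx hy
  obtain ⟨z, hz, hd⟩ := h.squeeze _ _ t hx hy
  refine ⟨f z, ?_, by rwa [f.dist_eq]⟩
  rw [e x, e y, f.dist_eq, f.dist_eq, f.dist_eq]
  exact hz

end

end HadamardProducts

namespace HadamardProducts

open Filter Topology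

/-! ### Contracting lines in general position -/

section

variable {X : Type*} [MetricSpace X] [CatZero X] {σ τ : ℝ → X} {Q : ℝ}

theorem Tight.nonneg (h : Tight σ Q) : 0 ≤ Q := by
  obtain ⟨z, -, hz⟩ := h.squeeze (σ (-Q)) (σ Q) 0 (by rw [h.line.pr_apply]; linarith)
    (by rw [h.line.pr_apply]; linarith)
  exact dist_nonneg.trans hz

theorem Tight.dist_add_le {X : Type*} [MetricSpace X] {σ : ℝ → X} {Q : ℝ} (h : Tight σ Q) {x y : X} {t : ℝ}
    (ht : pr σ x + Q ≤ t ∧ t ≤ pr σ y - Q ∨ pr σ y + Q ≤ t ∧ t ≤ pr σ x - Q) :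
    dist x (σ t) + dist (σ t) y ≤ dist x y + 2 * Q := by
  have key : ∀ x y, pr σ x + Q ≤ t → t ≤ pr σ y - Q →
      dist x (σ t) + dist (σ t) y ≤ dist x y + 2 * Q := by
    intro x y h1 h2
    obtain ⟨z, hz, hd⟩ := h.squeeze x y t h1 h2
    have a := dist_triangle x z (σ t)
    have b := dist_triangle_left (σ t) y z
    linarith
  rcases ht with ⟨h1, h2⟩ | ⟨h1, h2⟩
  · exact key x y h1 h2
  · have := key y x h1 h2
    rw [dist_comm y, dist_comm _ x, dist_comm y] at this
    linarith

/-- Behrstock's inequality for two contracting lines with bounded projections to each other. -/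
theorem Tight.behrstock (hσ : Tight σ Q) (hτ : Tight τ Q) {a b C : ℝ}
    (h1 : ∀ t, |pr σ (τ t) - a| ≤ C) (h2 : ∀ t, |pr τ (σ t) - b| ≤ C) (x : X) :
    |pr σ x - a| ≤ C + 4 * Q + 1 ∨ |pr τ x - b| ≤ C + 4 * Q + 1 := by
  have hQ := hσ.nonneg
  by_contra hcon
  push Not at hcon
  -- If both projections of `x` are far out, there are `s` and `t` such that the geodesic from `x`
  -- to `τ t` passes near `σ s` and the one from `x` to `σ s` passes near `τ t`. Adding the two
  -- estimates gives `dist (σ s) (τ t) ≤ 2 * Q`, whereas the projection of `τ t` is more than `2 *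
  -- Q` away from `s`.
  have key : ∀ (σ : ℝ → X) (a : ℝ), C + 4 * Q + 1 < |pr σ x - a| →
      ∃ s, ∀ u, |pr σ u - a| ≤ C → 2 * Q < |pr σ u - s| ∧
        (pr σ x + Q ≤ s ∧ s ≤ pr σ u - Q ∨ pr σ u + Q ≤ s ∧ s ≤ pr σ x - Q) := by
    intro σ a h
    rcases lt_abs.1 h with h | h
    · refine ⟨pr σ x - Q, fun u hu => ⟨?_, Or.inr ⟨?_, le_rfl⟩⟩⟩
      · rw [lt_abs]; right; linarith [(abs_le.1 hu).2]
      · linarith [(abs_le.1 hu).2]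
    · refine ⟨pr σ x + Q, fun u hu => ⟨?_, Or.inl ⟨le_rfl, ?_⟩⟩⟩
      · rw [lt_abs]; left; linarith [(abs_le.1 hu).1]
      · linarith [(abs_le.1 hu).1]
  obtain ⟨s, hs⟩ := key σ a hcon.1
  obtain ⟨t, ht⟩ := key τ b hcon.2
  obtain ⟨hlt, hst⟩ := hs (τ t) (h1 t)
  obtain ⟨-, hts⟩ := ht (σ s) (h2 s)
  have e1 := hσ.dist_add_le hst
  have e2 := hτ.dist_add_le hts
  have e3 := hσ.line.abs_pr_sub_le_dist (τ t) s
  rw [dist_comm (σ s)] at e1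
  linarith

theorem IsGeodesicLine.exists_eq_of_between (hσ : IsGeodesicLine σ) {a b : ℝ} {z : X}
    (h : dist (σ a) z + dist z (σ b) = dist (σ a) (σ b)) : ∃ u, z = σ u := by
  obtain ⟨t, h0, h1, rfl⟩ := exists_eq_geo_of_dist_add h
  exact ⟨_, (hσ.eq_geo a b h0 h1).symm⟩

/-- If the projection of `τ` were unbounded, tightness would bring `τ` within `Q` of `σ (i * l)`
with `|i|` beyond any prescribed bound. Rounding to orbit points gives a pair of powers in a set
that properness makes finite. The bound `B` adds up `Q`, a period `m` of `h` and the distance of the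
base points. -/
theorem exists_bound_pr_of_areIndependent {g h : X ≃ᵢ X} {l m : ℝ} (hg : IsAxis g l σ)
    (hh : IsAxis h m τ) (hσ : Tight σ Q) (hind : AreIndependent g h) :
    ∃ C, ∀ t, |pr σ (τ t)| ≤ C := by
  set B := Q + m + dist (σ 0) (τ 0) with hB
  have hB0 : 0 ≤ B := by
    have := hσ.nonneg
    have := hh.1
    positivity
  have hfin : {p : ℤ × ℤ | dist ((g ^ p.1) (σ 0)) ((h ^ p.2) (σ 0)) ≤ B}.Finite := by
    have hc := (hind (σ 0)).isCompact_preimage (isCompact_closedBall (0 : NNReal) B)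
    refine (isCompact_iff_finite.1 hc).subset fun p hp => ?_
    simp only [Set.mem_preimage, Metric.mem_closedBall, NNReal.dist_eq, coe_nndist,
      NNReal.coe_zero, sub_zero]
    rw [abs_of_nonneg dist_nonneg]
    exact hp
  obtain ⟨J, hJ⟩ : ∃ J : ℕ, ∀ p ∈ {p : ℤ × ℤ | dist ((g ^ p.1) (σ 0)) ((h ^ p.2) (σ 0)) ≤ B},
      p.1.natAbs ≤ J := by
    obtain ⟨J, hJ⟩ := (hfin.image fun p => p.1.natAbs).bddAbove
    exact ⟨J, fun p hp => hJ (Set.mem_image_of_mem _ hp)⟩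
  by_contra hcon
  push Not at hcon
  set j : ℕ := max (J + 1) ⌈(|pr σ (τ 0)| + Q) / l⌉₊ with hj
  have hjJ : J < j := lt_of_lt_of_le (Nat.lt_succ_self J) (le_max_left _ _)
  have hjl : |pr σ (τ 0)| + Q ≤ j * l := by
    have h1 : ⌈(|pr σ (τ 0)| + Q) / l⌉₊ ≤ j := le_max_right _ _
    have h2 := Nat.le_of_ceil_le h1
    rwa [div_le_iff₀ hg.1] at h2
  have hpr := abs_le.1 (le_refl |pr σ (τ 0)|)
  have key : ∀ (i : ℤ) (z : X), i.natAbs = j → dist z (σ (i * l)) ≤ Q → (∃ u, z = τ u) →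
      False := by
    rintro i _ hi hd ⟨u, rfl⟩
    set k := ⌊u / m⌋
    have hk1 : k * m ≤ u := by
      have := Int.floor_le (u / m)
      rwa [le_div_iff₀ hh.1] at this
    have hk2 : u < k * m + m := by
      have := Int.lt_floor_add_one (u / m)
      rw [div_lt_iff₀ hh.1] at this
      linarith
    have hmem := hJ (i, k) (by
      change dist ((g ^ i) (σ 0)) ((h ^ k) (σ 0)) ≤ B
      have e1 : dist (τ u) ((h ^ k) (τ 0)) ≤ m := by
        rw [hh.zpow_apply, hh.2.1, zero_add, abs_of_nonneg (by linarith)]; linarith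
      have e2 : dist ((h ^ k) (τ 0)) ((h ^ k) (σ 0)) = dist (σ 0) (τ 0) := by
        rw [(h ^ k).dist_eq, dist_comm]
      rw [hg.zpow_apply, zero_add]
      have e3 := dist_triangle (σ (i * l)) (τ u) ((h ^ k) (σ 0))
      have e4 := dist_triangle (τ u) ((h ^ k) (τ 0)) ((h ^ k) (σ 0))
      rw [dist_comm _ (τ u)] at e3
      linarith)
    simp only [hi] at hmem
    omega
  obtain ⟨t, ht⟩ := hcon (j * l + Q)
  rcases lt_abs.1 ht with h1 | h1
  · obtain ⟨z, hz, hd⟩ := hσ.squeeze (τ 0) (τ t) (j * l) (by linarith) (by linarith)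
    exact key j z (by simp) (by exact_mod_cast hd) (hh.2.1.exists_eq_of_between hz)
  · obtain ⟨z, hz, hd⟩ := hσ.squeeze (τ t) (τ 0) (-(j * l)) (by linarith) (by linarith)
    exact key (-j) z (by simp) (by push_cast; rwa [neg_mul]) (hh.2.1.exists_eq_of_between hz)

/-- For large `|q|` the projections of `τ` and of its image under `g ^ q` to `σ` are disjoint
intervals with a gap. All geodesics between the two lines then pass near one point `σ s`, so the
image projects to `τ` near the projection of `σ s`. -/
theorem exists_bound_pr_zpow {g : X ≃ᵢ X} {l C : ℝ} (hg : IsAxis g l σ) (hσ : Tight σ Q)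
    (hτ : IsGeodesicLine τ) (hC : ∀ t, |pr σ (τ t)| ≤ C) :
    ∃ N : ℕ, ∀ q : ℤ, N ≤ q.natAbs → ∃ C', ∀ t, |pr τ ((g ^ q) (τ t))| ≤ C' := by
  refine ⟨⌈(2 * C + 2 * Q) / l⌉₊, fun q hq => ?_⟩
  have hq' : 2 * C + 2 * Q ≤ |(q : ℝ)| * l := by
    have := Nat.le_of_ceil_le hq
    rwa [div_le_iff₀ hg.1, Nat.cast_natAbs, Int.cast_abs] at this
  obtain ⟨s, hs⟩ : ∃ s, ∀ t' t, dist (τ t') (σ s) + dist (σ s) ((g ^ q) (τ t)) ≤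
      dist (τ t') ((g ^ q) (τ t)) + 2 * Q := by
    rcases le_total 0 (q : ℝ) with h0 | h0
    · rw [abs_of_nonneg h0] at hq'
      refine ⟨C + Q, fun t' t => hσ.dist_add_le (Or.inl ?_)⟩
      have a := abs_le.1 (hC t')
      have b := abs_le.1 (hC t)
      rw [hg.pr_zpow_apply]
      constructor <;> linarith
    · rw [abs_of_nonpos h0] at hq'
      refine ⟨-(C + Q), fun t' t => hσ.dist_add_le (Or.inr ?_)⟩
      have a := abs_le.1 (hC t')
      have b := abs_le.1 (hC t)
      rw [hg.pr_zpow_apply]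
      constructor <;> linarith
  refine ⟨|pr τ (σ s)| + (dist (σ s) (τ (pr τ (σ s))) + 2 * Q), fun t => ?_⟩
  set y := (g ^ q) (τ t)
  have h1 : dist (τ (pr τ y)) (σ s) + dist (σ s) y ≤ dist (τ (pr τ y)) y + 2 * Q :=
    hs (pr τ y) t
  have h2 := hτ.dist_pr_le y (pr τ (σ s))
  have h3 := dist_triangle y (σ s) (τ (pr τ (σ s)))
  have h4 := hτ.abs_pr_sub_le_dist (σ s) (pr τ y)
  have h5 := abs_sub_abs_le_abs_sub (pr τ y) (pr τ (σ s))
  rw [abs_sub_comm] at h5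
  rw [dist_comm (τ (pr τ y)) (σ s), dist_comm (τ (pr τ y)) y] at h1
  rw [dist_comm y (σ s)] at h3
  linarith

/-- If `φ` moves the base point far, in a direction transversal to two contracting lines close to
the base point, then the first line and the image of the second one are transversal. -/
theorem Tight.abs_pr_map_le (hσ : Tight σ Q) (hτ : IsGeodesicLine τ) {φ : X ≃ᵢ X} {o : X} {C : ℝ}
    (hσo : dist o (σ 0) ≤ Q) (hτo : dist o (τ 0) ≤ Q) (h1 : |pr σ (φ o)| ≤ C)
    (h2 : |pr τ (φ⁻¹ o)| ≤ C) (hfar : 3 * C + 9 * Q < dist o (φ o)) (t : ℝ) :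
    |pr σ (φ (τ t))| ≤ C + 3 * Q := by
  by_contra hlt
  push Not at hlt
  have hQ := hσ.nonneg
  have hC : 0 ≤ C := (abs_nonneg _).trans h1
  have hv : |pr σ (φ (τ 0))| ≤ C + Q := by
    have a := hσ.line.abs_pr_sub_le (φ (τ 0)) (φ o)
    rw [φ.dist_eq, dist_comm] at a
    have := abs_sub_abs_le_abs_sub (pr σ (φ (τ 0))) (pr σ (φ o))
    linarith
  have hv' := abs_le.1 hv
  -- A far projection makes the image line pass near `σ s`, hence a point `φ (τ u)` lie within `C +
  -- 4 * Q` of `o`. Pulled back by `φ`, this gives `|u| ≤ 2 * C + 4 * Q`. Then `dist o (φ o) ≤ (C +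
  -- 4 * Q) + (2 * C + 4 * Q) + Q`, against `hfar`.
  obtain ⟨s, u, hs, hd⟩ : ∃ s u, |s| ≤ C + 2 * Q ∧ dist (φ (τ u)) (σ s) ≤ Q := by
    have hφ := hτ.comp_isometryEquiv φ
    rcases lt_abs.1 hlt with h | h
    · obtain ⟨z, hz, hd⟩ := hσ.squeeze (φ (τ 0)) (φ (τ t)) (C + 2 * Q) (by linarith) (by linarith)
      obtain ⟨u, rfl⟩ := hφ.exists_eq_of_between hz
      exact ⟨_, u, by rw [abs_of_nonneg (by positivity)], hd⟩
    · obtain ⟨z, hz, hd⟩ := hσ.squeeze (φ (τ t)) (φ (τ 0)) (-(C + 2 * Q)) (by linarith)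
        (by linarith)
      obtain ⟨u, rfl⟩ := hφ.exists_eq_of_between hz
      exact ⟨_, u, by rw [abs_neg, abs_of_nonneg (by positivity)], hd⟩
  have e1 : dist o (φ (τ u)) ≤ C + 4 * Q := by
    have a := dist_triangle4 o (σ 0) (σ s) (φ (τ u))
    rw [hσ.line, zero_sub, abs_neg, dist_comm (σ s)] at a
    linarith
  have e2 : |u| ≤ 2 * C + 4 * Q := by
    have a := hτ.abs_pr_sub_le_dist (φ⁻¹ o) u
    rw [← φ.dist_eq, show φ (φ⁻¹ o) = o from φ.apply_symm_apply o] at a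
    have := abs_sub_abs_le_abs_sub u (pr τ (φ⁻¹ o))
    rw [abs_sub_comm] at this
    linarith
  have e3 := dist_triangle4 o (φ (τ u)) (φ (τ 0)) (φ o)
  rw [φ.dist_eq, φ.dist_eq, hτ, sub_zero, dist_comm (τ 0)] at e3
  linarith

end

/-! ### Minimally displaced points and axes -/

section

variable {X : Type*} [MetricSpace X] [CatZero X]

/-- `b` maps the midpoint of `x, b x` to that of `b x, b (b x)`, and two midpoints are at most half
of `dist x (b (b x))` apart. -/
theorem two_mul_le_dist_apply_apply {b : X ≃ᵢ X} {μ : ℝ} (h : ∀ x, μ ≤ dist x (b x)) (x : X) :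
    2 * μ ≤ dist x (b (b x)) := by
  have h0 : (0 : ℝ) ≤ 1 / 2 := by norm_num
  have h1 : (1 / 2 : ℝ) ≤ 1 := by norm_num
  have a := h (geo x (b x) (1 / 2))
  rw [map_geo b _ _ h0 h1] at a
  have e := geo_symm x (b x) h0 h1
  rw [show (1 : ℝ) - 1 / 2 = 1 / 2 by norm_num] at e
  rw [← e] at a
  linarith [dist_geo_geo_le_right (b x) x (b (b x)) h0 h1]

theorem dist_pow_two_pow_ge {a : X ≃ᵢ X} {l : ℝ} (h : ∀ x, l ≤ dist x (a x)) (k : ℕ) (x : X) :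
    2 ^ k * l ≤ dist x ((a ^ 2 ^ k) x) := by
  induction k generalizing x with
  | zero => simpa using h x
  | succ k ih =>
    have := two_mul_le_dist_apply_apply ih x
    rw [← IsometryEquiv.mul_apply, ← pow_add, ← two_mul, ← pow_succ'] at this
    rw [pow_succ']
    linarith

theorem dist_pow_le {X : Type*} [MetricSpace X] (a : X ≃ᵢ X) (x : X) (n : ℕ) :
    dist x ((a ^ n) x) ≤ n * dist x (a x) := by
  induction n with
  | zero => simp
  | succ n ih =>
    have h1 := dist_triangle x ((a ^ n) x) ((a ^ (n + 1)) x)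
    rw [pow_succ, IsometryEquiv.mul_apply, (a ^ n).dist_eq] at h1
    push_cast
    rw [pow_succ, IsometryEquiv.mul_apply]
    linarith

/-- By doubling there is no defect at the exponent `2 ^ n`, and a defect at `n ≤ 2 ^ n` would
persist there by the triangle inequality. -/
theorem dist_pow_eq_of_isMin {a : X ≃ᵢ X} {p : X} (h : ∀ x, dist p (a p) ≤ dist x (a x)) (n : ℕ) :
    dist p ((a ^ n) p) = n * dist p (a p) := by
  refine le_antisymm (dist_pow_le a p n) ?_
  have hn : n ≤ 2 ^ n := Nat.lt_two_pow_self.le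
  obtain ⟨m, hm⟩ := Nat.exists_eq_add_of_le hn
  have h1 := dist_pow_two_pow_ge h n p
  have h2 := dist_triangle p ((a ^ n) p) ((a ^ 2 ^ n) p)
  have h3 := dist_pow_le a p m
  rw [hm, pow_add, IsometryEquiv.mul_apply, (a ^ n).dist_eq] at h2
  have h4 : ((2 : ℝ) ^ n) = n + m := by exact_mod_cast hm
  rw [h4] at h1
  rw [hm, pow_add, IsometryEquiv.mul_apply] at h1
  linarith

/-- The translates of the segment from `p` to `a p` are concatenated. Since orbit points have exact
distances `n * l`, the triangle inequality between vertices leaves no shortcut. -/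
theorem exists_isAxis_of_isMin {a : X ≃ᵢ X} {p : X} (h : ∀ x, dist p (a p) ≤ dist x (a x))
    (hpos : 0 < dist p (a p)) : ∃ σ, IsAxis a (dist p (a p)) σ ∧ σ 0 = p := by
  set l := dist p (a p) with hl
  have hV : ∀ (j : ℤ) (n : ℕ), dist ((a ^ j) p) ((a ^ (j + n)) p) = n * l := by
    intro j n
    rw [zpow_add, IsometryEquiv.mul_apply, (a ^ j).dist_eq, zpow_natCast, dist_pow_eq_of_isMin h]
  set σ : ℝ → X := fun t => (a ^ ⌊t / l⌋) (geo p (a p) (Int.fract (t / l))) with hσ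
  have hfl : ∀ t : ℝ, Int.fract (t / l) * l = t - ⌊t / l⌋ * l := fun t => by
    rw [Int.fract, sub_mul]; field_simp
  have hleft : ∀ t, dist ((a ^ ⌊t / l⌋) p) (σ t) = t - ⌊t / l⌋ * l := fun t => by
    rw [hσ, (a ^ ⌊t / l⌋).dist_eq, dist_left_geo _ _ (Int.fract_nonneg _) (Int.fract_lt_one _).le,
      ← hfl]
  have hright : ∀ t, dist (σ t) ((a ^ (⌊t / l⌋ + 1)) p) = (⌊t / l⌋ + 1) * l - t := fun t => by
    rw [hσ, zpow_add_one, IsometryEquiv.mul_apply, (a ^ ⌊t / l⌋).dist_eq,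
      dist_geo_right _ _ (Int.fract_nonneg _) (Int.fract_lt_one _).le, sub_mul, ← hl, hfl]
    ring
  have hle : ∀ s t, s ≤ t → dist (σ s) (σ t) = t - s := by
    intro s t hst
    have hij : ⌊s / l⌋ ≤ ⌊t / l⌋ := Int.floor_le_floor (by gcongr)
    obtain ⟨n, hn⟩ := Int.le.dest hij
    have hn' : (⌊t / l⌋ : ℝ) = ⌊s / l⌋ + n := by exact_mod_cast hn.symm
    apply le_antisymm
    · rcases Nat.eq_zero_or_pos n with h0 | h0
      · subst h0
        rw [Nat.cast_zero, add_zero] at hn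
        have e1 := hfl s
        have e2 := hfl t
        rw [← hn] at e2
        simp only [hσ]
        rw [← hn, (a ^ ⌊s / l⌋).dist_eq, dist_geo_same _ _ (Int.fract_nonneg _)
          (Int.fract_lt_one _).le (Int.fract_nonneg _) (Int.fract_lt_one _).le, ← hl,
          ← abs_of_pos hpos, ← abs_mul, abs_of_pos hpos, sub_mul, e1, e2, abs_of_nonpos] <;>
        linarith
      · obtain ⟨m, rfl⟩ : ∃ m, n = m + 1 := ⟨n - 1, by omega⟩
        have e := hV (⌊s / l⌋ + 1) m
        rw [show ⌊s / l⌋ + 1 + (m : ℤ) = ⌊t / l⌋ by rw [← hn]; push_cast; ring] at e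
        have f := dist_triangle4 (σ s) ((a ^ (⌊s / l⌋ + 1)) p) ((a ^ ⌊t / l⌋) p) (σ t)
        rw [hright, e, hleft, hn'] at f
        push_cast at f
        linarith
    · have e := hV ⌊s / l⌋ (n + 1)
      rw [show ⌊s / l⌋ + ((n + 1 : ℕ) : ℤ) = ⌊t / l⌋ + 1 by rw [← hn]; push_cast; ring] at e
      have f := dist_triangle4 ((a ^ ⌊s / l⌋) p) (σ s) (σ t) ((a ^ (⌊t / l⌋ + 1)) p)
      rw [e, hleft, hright, hn'] at f
      push_cast at f
      linarith
  refine ⟨σ, ⟨hpos, fun s t => ?_, fun t => ?_⟩, ?_⟩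
  · rcases le_total s t with hst | hst
    · rw [hle s t hst, abs_of_nonpos (by linarith)]; ring
    · rw [dist_comm, hle t s hst, abs_of_nonneg (by linarith)]
  · simp only [hσ]
    rw [add_div, div_self hpos.ne', Int.floor_add_one, Int.fract_add_one, zpow_add, zpow_one,
      ← IsometryEquiv.mul_apply, ← zpow_one_add, zpow_add, zpow_one]
    congr 1
    exact (Commute.self_zpow a _).eq
  · simp [hσ]

/-- An isometry for which all geodesics between the two ends of its orbits return to a fixed ball
is a rank one isometry. -/
theorem isRankOne_of_recurrent [ProperSpace X] {a : X ≃ᵢ X} {o : X} {D : ℝ}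
    (hrec : ∀ B, ∃ N : ℕ, ∀ n : ℕ, N ≤ n → ∀ x y, dist o x ≤ B → dist o y ≤ B →
      ∃ z, dist ((a ^ (-(n : ℤ))) x) z + dist z ((a ^ (n : ℤ)) y) =
        dist ((a ^ (-(n : ℤ))) x) ((a ^ (n : ℤ)) y) ∧ dist z o ≤ D)
    (hgrow : ∀ n : ℕ, (n : ℝ) ≤ dist o ((a ^ n) o)) :
    IsRankOne a ∧ |translationLength a - dist o (a o)| ≤ 2 * D := by
  have hD : 0 ≤ D := by
    obtain ⟨N, hN⟩ := hrec 0
    obtain ⟨z, -, hz⟩ := hN N le_rfl o o (by simp) (by simp)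
    exact dist_nonneg.trans hz
  have hcomm : ∀ (k : ℤ) (x : X), dist ((a ^ k) x) (a ((a ^ k) x)) = dist x (a x) := by
    intro k x
    rw [← IsometryEquiv.mul_apply, ← zpow_one_add, add_comm, zpow_add_one,
      IsometryEquiv.mul_apply, (a ^ k).dist_eq]
  obtain ⟨p, hp, hmin⟩ := (isCompact_closedBall o D).exists_isMinOn (f := fun x => dist x (a x))
    ⟨o, by simpa using hD⟩ (continuous_id.dist a.continuous).continuousOn
  -- The displacement is convex along the geodesic from `a ^ (-N) x` to `a ^ N x` and equals that of
  -- `x` at both ends. This geodesic meets the ball, where `p` is minimal.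
  have hpmin : ∀ x, dist p (a p) ≤ dist x (a x) := by
    intro x
    obtain ⟨N, hN⟩ := hrec (dist o x)
    obtain ⟨z, hz, hzo⟩ := hN N le_rfl x x le_rfl le_rfl
    obtain ⟨t, h0, h1, rfl⟩ := exists_eq_geo_of_dist_add hz
    refine (hmin (a := _) (Metric.mem_closedBall.2 hzo)).trans ?_
    dsimp only
    rw [map_geo a _ _ h0 h1]
    refine (dist_geo_geo_le _ _ _ _ h0 h1).trans (le_of_eq ?_)
    rw [hcomm, hcomm]; ring
  have hppos : 0 < dist p (a p) := by
    refine dist_nonneg.lt_of_ne' fun h0 => ?_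
    obtain ⟨n, hn⟩ := exists_nat_gt (2 * dist o p)
    have h1 := dist_pow_le a p n
    rw [h0, mul_zero] at h1
    have h2 := dist_triangle4 o p ((a ^ n) p) ((a ^ n) o)
    rw [(a ^ n).dist_eq, dist_comm p o] at h2
    linarith [hgrow n]
  obtain ⟨σ, hσ, hσp⟩ := exists_isAxis_of_isMin hpmin hppos
  have hop : dist o p ≤ D := by rw [dist_comm]; exact hp
  refine ⟨⟨⟨_, σ, hσ⟩, _, σ, hσ, hσ.2.1, ?_⟩, ?_⟩
  · rintro ⟨ι, hι, -, -, hb⟩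
    -- In a flat half-plane the line `q` parallel to the axis at distance `T` would join images
    -- under `a ^ (-N)` and `a ^ N` of points within `D + T` of `o`, so it would return to within
    -- `D` of `o` and `2 * D` of `p`. Any `T > 2 * D` is a contradiction.
    set T := 3 * D + 1 with hT
    have hT0 : 0 ≤ T := by positivity
    have hmem : ∀ s : ℝ, 0 ≤ (!₂[T, s] : EuclideanSpace ℝ (Fin 2)) 0 := fun s => by simpa using hT0
    set q : ℝ → X := fun s => ι ⟨!₂[T, s], hmem s⟩ with hq
    have hqline : IsGeodesicLine q := fun s t => by
      rw [hq, hι.dist_eq, Subtype.dist_eq, EuclideanSpace.dist_eq, Fin.sum_univ_two]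
      simp [Real.dist_eq, Real.sqrt_sq_eq_abs]
    have hqσ : ∀ s t, T ≤ dist (q s) (σ t) := fun s t => by
      rw [hb, hq, hι.dist_eq, Subtype.dist_eq, EuclideanSpace.dist_eq, Fin.sum_univ_two]
      refine Real.le_sqrt_of_sq_le ?_
      simp [HalfPlane.bdry, Real.dist_eq, sq_nonneg]
    have hqσ' : ∀ s, dist (q s) (σ s) = T := fun s => by
      rw [hb, hq, hι.dist_eq, Subtype.dist_eq, EuclideanSpace.dist_eq, Fin.sum_univ_two]
      simp [HalfPlane.bdry, Real.sqrt_sq hT0]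
    obtain ⟨N, hN⟩ := hrec (D + T)
    have hend : ∀ k : ℤ, dist o ((a ^ (-k)) (q (k * dist p (a p)))) ≤ D + T := by
      intro k
      have h1 : dist p ((a ^ (-k)) (q (k * dist p (a p)))) = T := by
        rw [← hσp, dist_comm, hσ.dist_zpow_neg, zero_add, hσp, hqσ']
      linarith [dist_triangle o p ((a ^ (-k)) (q (k * dist p (a p))))]
    have hcancel : ∀ (k : ℤ) (x : X), (a ^ k) ((a ^ (-k)) x) = x := fun k x => by
      rw [← IsometryEquiv.mul_apply, ← zpow_add, add_neg_cancel, zpow_zero]; rfl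
    have e1 := hend (-(N : ℤ))
    rw [neg_neg] at e1
    obtain ⟨z, hz, hzo⟩ := hN N le_rfl _ _ e1 (hend N)
    have e2 := hcancel (-(N : ℤ)) (q (((-(N : ℤ) : ℤ) : ℝ) * dist p (a p)))
    rw [neg_neg] at e2
    rw [e2, hcancel] at hz
    obtain ⟨u, rfl⟩ := hqline.exists_eq_of_between hz
    have := hqσ u 0
    rw [hσp] at this
    linarith [dist_triangle (q u) o p]
  · rw [translationLength_eq hσ]
    have h1 := dist_triangle4 o p (a p) (a o)
    have h2 := dist_triangle4 p o (a o) (a p)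
    rw [a.dist_eq] at h1 h2
    rw [dist_comm p o] at h1 h2
    rw [abs_le]
    constructor <;> linarith

end

end HadamardProducts

namespace HadamardProducts

open Filter Topology

/-! ### Pairs of isometries in Schottky position -/

/-- Two isometries `f j * φ`, where the `f j` are long translations along transversal contracting
lines close to `o` and `φ` moves `o` transversally to these lines. -/
structure Schottky {X : Type*} [MetricSpace X] (o : X) (φ : X ≃ᵢ X) (f : Fin 2 → X ≃ᵢ X)
    (τ : Fin 2 → ℝ → X) (L P Q : ℝ) : Prop where
  axis : ∀ j, IsAxis (f j) L (τ j)
  tight : ∀ j, Tight (τ j) Q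
  base : ∀ j, dist o (τ j 0) ≤ Q
  proj : ∀ j, |pr (τ j) (φ o)| ≤ P
  -- Behrstock's alternative for `τ j` and the image of `τ k` under `φ`, read at the point `φ y`.
  step : ∀ j k y, |pr (τ j) (φ y)| ≤ P ∨ |pr (τ k) y| ≤ P
  trans : ∀ y, |pr (τ 0) y| ≤ P ∨ |pr (τ 1) y| ≤ P
  le : Q ≤ P
  long : 2 * P + 2 * Q < L
  far : ∀ j, 2 * (P + 3 * Q) + 1 ≤ dist o ((f j * φ) o)

namespace Schottky

variable {X : Type*} [MetricSpace X] [CatZero X] {o : X} {φ : X ≃ᵢ X} {f : Fin 2 → X ≃ᵢ X}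
  {τ : Fin 2 → ℝ → X} {L P Q : ℝ}

theorem pr_mul_apply (h : Schottky o φ f τ L P Q) (j : Fin 2) (y : X) :
    pr (τ j) ((f j * φ) y) = pr (τ j) (φ y) + L :=
  (h.axis j).pr_apply _

theorem nonneg (h : Schottky o φ f τ L P Q) : 0 ≤ Q := (h.tight 0).nonneg

theorem pr_base_le (h : Schottky o φ f τ L P Q) (j : Fin 2) : |pr (τ j) o| ≤ P := by
  have := (h.tight j).line.abs_pr_sub_le_dist o 0
  rw [sub_zero] at this
  exact this.trans ((h.base j).trans h.le)

/-- The ping-pong step. A far projection of `y` forces a bounded projection of `φ y`, which `f j`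
shifts by `L`; as `L - P > P`, the step can be iterated with any letters. -/
theorem le_pr_mul_apply (h : Schottky o φ f τ L P Q) {j k : Fin 2} {y : X}
    (hy : P < pr (τ k) y) : L - P ≤ pr (τ j) ((f j * φ) y) := by
  rw [h.pr_mul_apply]
  rcases h.step j k y with h1 | h1
  · linarith [(abs_le.1 h1).1]
  · linarith [(abs_le.1 h1).2]

theorem pr_le_of_pr_mul_apply_lt (h : Schottky o φ f τ L P Q) {j : Fin 2} (k : Fin 2) {y : X}
    (hy : pr (τ j) ((f j * φ) y) < L - P) : pr (τ k) y ≤ P := by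
  by_contra hlt
  linarith [h.le_pr_mul_apply (j := j) (not_le.1 hlt)]

/-- The parameter `P + Q` keeps the margin `Q` from both projections, because `P + Q ≤ L - P - Q`;
its point on the line is within `P + 2 * Q` of `o`. -/
theorem exists_between (h : Schottky o φ f τ L P Q) {j : Fin 2} {x y : X} (hx : pr (τ j) x ≤ P)
    (hy : L - P ≤ pr (τ j) y) :
    ∃ z, dist x z + dist z y = dist x y ∧ dist z o ≤ P + 3 * Q := by
  have hQ := h.nonneg
  have hP := h.le
  have hL := h.long
  obtain ⟨z, hz, hd⟩ := (h.tight j).squeeze x y (P + Q) (by linarith) (by linarith)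
  refine ⟨z, hz, ?_⟩
  have a := dist_triangle4 z (τ j (P + Q)) (τ j 0) o
  rw [(h.tight j).line, sub_zero, abs_of_nonneg (by linarith), dist_comm (τ j 0) o] at a
  linarith [h.base j]

theorem dist_add_le (h : Schottky o φ f τ L P Q) {j : Fin 2} {x y : X} (hx : pr (τ j) x ≤ P)
    (hy : L - P ≤ pr (τ j) y) : dist x o + dist o y ≤ dist x y + 2 * (P + 3 * Q) := by
  obtain ⟨z, hz, hd⟩ := h.exists_between hx hy
  have a := dist_triangle x z o
  have b := dist_triangle_left o y z
  linarith

theorem le_pr_base (h : Schottky o φ f τ L P Q) (j : Fin 2) :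
    L - P ≤ pr (τ j) ((f j * φ) o) := by
  rw [h.pr_mul_apply]
  linarith [(abs_le.1 (h.proj j)).1]

theorem le_pr_word (h : Schottky o φ f τ L P Q) (j : Fin 2) (l : List (Fin 2)) :
    L - P ≤ pr (τ j) ((((j :: l).map fun j => f j * φ).prod) o) := by
  have hL := h.long
  have hQ := h.nonneg
  induction l generalizing j with
  | nil => simpa using h.le_pr_base j
  | cons k l ih =>
    rw [List.map_cons, List.prod_cons, IsometryEquiv.mul_apply]
    exact h.le_pr_mul_apply (k := k) (by linarith [ih k])

theorem pr_inv_base_le (h : Schottky o φ f τ L P Q) (j k : Fin 2) :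
    pr (τ k) ((f j * φ)⁻¹ o) ≤ P := by
  have hL := h.long
  have hQ := h.nonneg
  refine h.pr_le_of_pr_mul_apply_lt (j := j) k ?_
  rw [show (f j * φ) ((f j * φ)⁻¹ o) = o from (f j * φ).apply_symm_apply o]
  linarith [(abs_le.1 (h.pr_base_le j)).2]

/-- Induction on the first letter `a = f j * φ`. The point `a⁻¹ o` has projections at most `P`,
while the rest `w` of the word, if nonempty, sends `o` beyond `L - P`. The geodesic between them
passes near `o`, so applying `a` splits `dist o (a (w o))` with error at most `2 * (P + 3 * Q)`. -/
theorem abs_dist_word_sub_le (h : Schottky o φ f τ L P Q) (l : List (Fin 2)) :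
    |dist o (((l.map fun j => f j * φ).prod) o) - (l.map fun j => dist o ((f j * φ) o)).sum| ≤
      2 * (P + 3 * Q) * l.length := by
  have hQ := h.nonneg
  have hP := h.le
  induction l with
  | nil => simp
  | cons j l ih =>
    rw [List.map_cons, List.prod_cons, List.map_cons, List.sum_cons, IsometryEquiv.mul_apply,
      List.length_cons]
    push_cast
    set w := (l.map fun j => f j * φ).prod with hw
    set S := (l.map fun j => dist o ((f j * φ) o)).sum
    have h1 := dist_triangle o ((f j * φ) o) ((f j * φ) (w o))
    rw [(f j * φ).dist_eq] at h1
    have h2 : dist o ((f j * φ) o) + dist o (w o) ≤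
        dist o ((f j * φ) (w o)) + 2 * (P + 3 * Q) := by
      cases l with
      | nil => simp [hw]; linarith
      | cons k l =>
        have := h.dist_add_le (h.pr_inv_base_le j k) (h.le_pr_word k l)
        rw [← (f j * φ).dist_eq, ← (f j * φ).dist_eq ((f j * φ)⁻¹ o) _,
          show (f j * φ) ((f j * φ)⁻¹ o) = o from (f j * φ).apply_symm_apply o] at this
        exact this
    rw [abs_le] at ih ⊢
    constructor <;> linarith [ih.1, ih.2]

/-- Common first letters cancel. Words with different first letters would put one point far out on
both lines, against `trans`, and a nonempty word moves `o` far out on a line. -/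
theorem word_injective (h : Schottky o φ f τ L P Q) (l l' : List (Fin 2))
    (heq : (l.map fun j => f j * φ).prod = (l'.map fun j => f j * φ).prod) : l = l' := by
  have hL := h.long
  have hQ := h.nonneg
  have key : ∀ (j : Fin 2) (l : List (Fin 2)), ((j :: l).map fun j => f j * φ).prod ≠ 1 := by
    intro j l he
    have h1 := h.le_pr_word j l
    rw [he] at h1
    have h2 := (abs_le.1 (h.pr_base_le j)).2
    have h3 : (1 : X ≃ᵢ X) o = o := rfl
    rw [h3] at h1
    linarith
  have hne : ∀ l l' : List (Fin 2), ((0 :: l).map fun j => f j * φ).prod ≠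
      ((1 :: l').map fun j => f j * φ).prod := by
    intro l l' he
    have h1 := h.le_pr_word 0 l
    have h2 := h.le_pr_word 1 l'
    rw [← he] at h2
    rcases h.trans ((((0 :: l).map fun j => f j * φ).prod) o) with h3 | h3
    · linarith [(abs_le.1 h3).2]
    · linarith [(abs_le.1 h3).2]
  induction l generalizing l' with
  | nil =>
    cases l' with
    | nil => rfl
    | cons k l' => exact absurd heq.symm (key k l')
  | cons j l ih =>
    cases l' with
    | nil => exact absurd heq (key j l)
    | cons k l' =>
      have hjk : j = k := by
        fin_cases j <;> fin_cases k
        · rfl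
        · exact absurd heq (hne l l')
        · exact absurd heq.symm (hne l' l)
        · rfl
      subst hjk
      rw [List.map_cons, List.prod_cons, List.map_cons, List.prod_cons] at heq
      rw [ih l' (mul_left_cancel heq)]

theorem le_pr_pow (h : Schottky o φ f τ L P Q) (j : Fin 2) (n : ℕ) :
    L - P ≤ pr (τ j) (((f j * φ) ^ (n + 1)) o) := by
  have := h.le_pr_word j (List.replicate n j)
  rwa [← List.replicate_succ, List.map_replicate, List.prod_replicate] at this

theorem pr_zpow_neg_le (h : Schottky o φ f τ L P Q) (j : Fin 2) (n : ℕ) :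
    pr (τ j) (((f j * φ) ^ (-(n : ℤ))) o) ≤ P := by
  have hL := h.long
  have hQ := h.nonneg
  induction n with
  | zero => simpa using (abs_le.1 (h.pr_base_le j)).2
  | succ n ih =>
    refine h.pr_le_of_pr_mul_apply_lt (j := j) j ?_
    rw [← IsometryEquiv.mul_apply, ← zpow_one_add]
    rw [show (1 : ℤ) + -((n + 1 : ℕ) : ℤ) = -(n : ℤ) by push_cast; ring]
    linarith

theorem le_dist_pow (h : Schottky o φ f τ L P Q) (j : Fin 2) (n : ℕ) :
    (n : ℝ) ≤ dist o (((f j * φ) ^ n) o) := by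
  have h1 := h.abs_dist_word_sub_le (List.replicate n j)
  rw [List.map_replicate, List.prod_replicate, List.map_replicate, List.sum_replicate,
    List.length_replicate, nsmul_eq_mul] at h1
  have h2 := mul_le_mul_of_nonneg_left (h.far j) (n.cast_nonneg (α := ℝ))
  linarith [(abs_le.1 h1).1]

theorem abs_le_dist_zpow (h : Schottky o φ f τ L P Q) (j : Fin 2) (m : ℤ) :
    |(m : ℝ)| ≤ dist o (((f j * φ) ^ m) o) := by
  obtain ⟨n, rfl | rfl⟩ := m.eq_nat_or_neg
  · rw [zpow_natCast, Int.cast_natCast, Nat.abs_cast]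
    exact h.le_dist_pow j n
  · rw [Int.cast_neg, abs_neg, Int.cast_natCast, Nat.abs_cast,
      ← ((f j * φ) ^ (n : ℤ)).dist_eq o, ← IsometryEquiv.mul_apply, ← zpow_add, add_neg_cancel,
      zpow_zero, dist_comm, zpow_natCast]
    exact h.le_dist_pow j n

/-- For large `n` the points `a ^ (-n) x` and `a ^ n y` lie on the expected sides of `τ j`. If not,
one more or one fewer application of `a` gives a geodesic of length at most `B` from an orbit point
of `o` to the displaced point which passes near `o`; but that orbit point is at distance at least `n
- 1` from `o`. -/
theorem recurrent (h : Schottky o φ f τ L P Q) (j : Fin 2) (B : ℝ) :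
    ∃ N : ℕ, ∀ n : ℕ, N ≤ n → ∀ x y, dist o x ≤ B → dist o y ≤ B →
      ∃ z, dist (((f j * φ) ^ (-(n : ℤ))) x) z + dist z (((f j * φ) ^ (n : ℤ)) y) =
        dist (((f j * φ) ^ (-(n : ℤ))) x) (((f j * φ) ^ (n : ℤ)) y) ∧
        dist z o ≤ P + 3 * Q := by
  have hL := h.long
  have hQ := h.nonneg
  set a := f j * φ with ha
  refine ⟨⌈B + (P + 3 * Q)⌉₊ + 3, fun n hn x y hx hy => ?_⟩
  obtain ⟨m, rfl⟩ : ∃ m, n = m + 2 := ⟨n - 2, by omega⟩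
  have hm : B + (P + 3 * Q) < m + 1 := by
    have h1 := Nat.le_ceil (B + (P + 3 * Q))
    have h2 : ((⌈B + (P + 3 * Q)⌉₊ + 3 : ℕ) : ℝ) ≤ (m + 2 : ℕ) := by exact_mod_cast hn
    push_cast at h2
    linarith
  have hfar : ∀ (k : ℤ) (x z : X), dist o x ≤ B →
      dist ((a ^ k) o) z + dist z ((a ^ k) x) = dist ((a ^ k) o) ((a ^ k) x) →
      dist z o ≤ P + 3 * Q → |(k : ℝ)| ≤ B + (P + 3 * Q) := by
    intro k x z hx hz hd
    rw [(a ^ k).dist_eq] at hz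
    have h1 := h.abs_le_dist_zpow j k
    have h2 := dist_triangle_left o ((a ^ k) o) z
    rw [dist_comm z ((a ^ k) o)] at h2
    linarith [dist_nonneg (x := z) (y := (a ^ k) x)]
  refine h.exists_between (j := j) ?_ ?_
  · by_contra hlt
    have h1 := h.le_pr_mul_apply (j := j) (not_le.1 hlt)
    rw [← ha, ← IsometryEquiv.mul_apply, ← zpow_one_add,
      show (1 : ℤ) + -((m + 2 : ℕ) : ℤ) = -((m + 1 : ℕ) : ℤ) by push_cast; ring] at h1
    obtain ⟨z, hz, hd⟩ := h.exists_between (h.pr_zpow_neg_le j (m + 1)) h1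
    have h2 := hfar _ x z hx hz hd
    push_cast at h2
    rw [abs_neg, abs_of_nonneg (by positivity)] at h2
    linarith
  · by_contra hlt
    rw [show ((m + 2 : ℕ) : ℤ) = 1 + ((m + 1 : ℕ) : ℤ) by push_cast; ring, zpow_one_add,
      IsometryEquiv.mul_apply] at hlt
    have h1 := h.pr_le_of_pr_mul_apply_lt j (not_le.1 hlt)
    have h2 := h.le_pr_pow j m
    rw [← ha, ← zpow_natCast] at h2
    obtain ⟨z, hz, hd⟩ := h.exists_between h1 h2
    have h3 := hfar (m + 1 : ℕ) y z hy (by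
      rw [dist_comm ((a ^ ((m + 1 : ℕ) : ℤ)) o) z, dist_comm z ((a ^ ((m + 1 : ℕ) : ℤ)) y),
        add_comm, dist_comm ((a ^ ((m + 1 : ℕ) : ℤ)) o), hz]) hd
    push_cast at h3
    rw [abs_of_nonneg (by positivity)] at h3
    linarith

theorem isRankOne [ProperSpace X] (h : Schottky o φ f τ L P Q) (j : Fin 2) :
    IsRankOne (f j * φ) ∧
      |translationLength (f j * φ) - dist o ((f j * φ) o)| ≤ 2 * (P + 3 * Q) :=
  isRankOne_of_recurrent (h.recurrent j) (h.le_dist_pow j)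

/-- The line `τ 1` separates the orbit points, so the geodesic between them passes near `o`. For `n
< 0` this holds only after applying `b`, whence the term `2 * dist o (b o)`. -/
theorem exists_le_dist_zpow_zpow (h : Schottky o φ f τ L P Q) :
    ∃ E, ∀ m n : ℤ, |(m : ℝ)| + |(n : ℝ)| - E ≤
      dist (((f 0 * φ) ^ m) o) (((f 1 * φ) ^ n) o) := by
  have hL := h.long
  have hQ := h.nonneg
  have hP := h.le
  set a := f 0 * φ with ha
  set b := f 1 * φ with hb
  refine ⟨2 * (P + 3 * Q) + 2 * dist o (b o), fun m n => ?_⟩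
  have hm := h.abs_le_dist_zpow 0 m
  have hn := h.abs_le_dist_zpow 1 n
  rw [← ha] at hm
  rw [← hb] at hn
  have hb0 : 0 ≤ dist o (b o) := dist_nonneg
  rcases lt_trichotomy n 0 with h0 | h0 | h0
  · obtain ⟨k, rfl⟩ : ∃ k : ℕ, n = -((k + 1 : ℕ) : ℤ) := ⟨(-n - 1).toNat, by omega⟩
    have h1 : pr (τ 1) (b ((b ^ (-((k + 1 : ℕ) : ℤ))) o)) ≤ P := by
      rw [← IsometryEquiv.mul_apply, ← zpow_one_add,
        show (1 : ℤ) + -((k + 1 : ℕ) : ℤ) = -(k : ℤ) by push_cast; ring]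
      exact h.pr_zpow_neg_le 1 k
    have h2 : L - P ≤ pr (τ 1) (b ((a ^ m) o)) := by
      rcases lt_trichotomy m 0 with hm0 | hm0 | hm0
      · obtain ⟨i, rfl⟩ : ∃ i : ℕ, m = -((i + 1 : ℕ) : ℤ) := ⟨(-m - 1).toNat, by omega⟩
        have h3 := h.pr_zpow_neg_le 0 i
        rw [show -(i : ℤ) = 1 + -((i + 1 : ℕ) : ℤ) by push_cast; ring, zpow_one_add,
          IsometryEquiv.mul_apply, h.pr_mul_apply] at h3
        rw [hb, h.pr_mul_apply]
        -- By `h3` the projection of this point to `τ 0` is at most `P - L < -P`, so its projection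
        -- to `τ 1` is the bounded one.
        rcases h.trans (φ (((f 0 * φ) ^ (-((i + 1 : ℕ) : ℤ))) o)) with h4 | h4
        · linarith [(abs_le.1 h4).1]
        · linarith [(abs_le.1 h4).1]
      · subst hm0
        exact h.le_pr_base 1
      · obtain ⟨i, rfl⟩ : ∃ i : ℕ, m = ((i + 1 : ℕ) : ℤ) := ⟨(m - 1).toNat, by omega⟩
        have h3 := h.le_pr_pow 0 i
        rw [zpow_natCast]
        exact h.le_pr_mul_apply (k := 0) (by linarith)
    have h3 := h.dist_add_le h1 h2
    rw [b.dist_eq] at h3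
    have h4 := dist_triangle4 o (b o) (b ((b ^ (-((k + 1 : ℕ) : ℤ))) o)) o
    have h5 := dist_triangle o (b o) (b ((a ^ m) o))
    have h6 := dist_triangle_left (b o) (b ((b ^ (-((k + 1 : ℕ) : ℤ))) o)) o
    have h7 := dist_triangle_left (b o) (b ((a ^ m) o)) o
    rw [b.dist_eq] at h6 h7
    rw [dist_comm _ o, dist_comm ((b ^ (-((k + 1 : ℕ) : ℤ))) o)] at h3
    linarith
  · subst h0
    simp only [Int.cast_zero, abs_zero, zpow_zero]
    rw [dist_comm ((a ^ m) o)]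
    change _ ≤ dist o ((a ^ m) o)
    linarith
  · obtain ⟨k, rfl⟩ : ∃ k : ℕ, n = ((k + 1 : ℕ) : ℤ) := ⟨(n - 1).toNat, by omega⟩
    have h1 : L - P ≤ pr (τ 1) ((b ^ ((k + 1 : ℕ) : ℤ)) o) := by
      rw [zpow_natCast]; exact h.le_pr_pow 1 k
    have h2 : pr (τ 1) ((a ^ m) o) ≤ P := by
      rcases le_or_gt m 0 with hm0 | hm0
      · rcases hm0.eq_or_lt with hm0 | hm0
        · subst hm0
          exact (abs_le.1 (h.pr_base_le 1)).2
        · obtain ⟨i, rfl⟩ : ∃ i : ℕ, m = -((i + 1 : ℕ) : ℤ) := ⟨(-m - 1).toNat, by omega⟩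
          refine h.pr_le_of_pr_mul_apply_lt (j := 0) 1 ?_
          have h3 := h.pr_zpow_neg_le 0 i
          rw [show -(i : ℤ) = 1 + -((i + 1 : ℕ) : ℤ) by push_cast; ring, zpow_one_add,
            IsometryEquiv.mul_apply] at h3
          linarith
      · obtain ⟨i, rfl⟩ : ∃ i : ℕ, m = ((i + 1 : ℕ) : ℤ) := ⟨(m - 1).toNat, by omega⟩
        have h3 := h.le_pr_pow 0 i
        rw [zpow_natCast]
        rcases h.trans ((a ^ (i + 1)) o) with h4 | h4
        · linarith [(abs_le.1 h4).2]
        · exact (abs_le.1 h4).2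
    have h3 := h.dist_add_le h2 h1
    rw [dist_comm _ o] at h3
    linarith

theorem areIndependent (h : Schottky o φ f τ L P Q) : AreIndependent (f 0 * φ) (f 1 * φ) := by
  intro x
  obtain ⟨E, hE⟩ := h.exists_le_dist_zpow_zpow
  rw [isProperMap_iff_isCompact_preimage]
  refine ⟨continuous_of_discreteTopology, fun K hK => Set.Finite.isCompact ?_⟩
  obtain ⟨B, hB⟩ := hK.isBounded.subset_closedBall 0
  obtain ⟨M, hM⟩ := exists_nat_ge (B + E + 2 * dist o x)
  refine ((Set.finite_Icc (-(M : ℤ)) M).prod (Set.finite_Icc (-(M : ℤ)) M)).subset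
    fun p hp => ?_
  have h1 : dist (((f 0 * φ) ^ p.1) x) (((f 1 * φ) ^ p.2) x) ≤ B := by
    have := hB hp
    rwa [Metric.mem_closedBall, NNReal.dist_eq, coe_nndist, NNReal.coe_zero, sub_zero,
      abs_of_nonneg dist_nonneg] at this
  have h2 := hE p.1 p.2
  have h3 := dist_triangle4 (((f 0 * φ) ^ p.1) o) (((f 0 * φ) ^ p.1) x)
    (((f 1 * φ) ^ p.2) x) (((f 1 * φ) ^ p.2) o)
  rw [((f 0 * φ) ^ p.1).dist_eq, ((f 1 * φ) ^ p.2).dist_eq, dist_comm x o] at h3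
  have h4 : |(p.1 : ℝ)| ≤ M := by linarith [abs_nonneg (p.2 : ℝ)]
  have h5 : |(p.2 : ℝ)| ≤ M := by linarith [abs_nonneg (p.1 : ℝ)]
  have h6 := abs_le.1 h4
  have h7 := abs_le.1 h5
  exact ⟨⟨by exact_mod_cast h6.1, by exact_mod_cast h6.2⟩,
    ⟨by exact_mod_cast h7.1, by exact_mod_cast h7.2⟩⟩

end Schottky

end HadamardProducts

namespace HadamardProducts

open Filter Topology

/-! ### Words in two letters -/

section Words

/-- The list of letters of a non-empty word. -/
def letters (w : FreeSemigroup (Fin 2)) : List (Fin 2) := w.head :: w.tail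

theorem letters_mul (w w' : FreeSemigroup (Fin 2)) :
    letters (w * w') = letters w ++ letters w' := rfl

theorem letters_of (j : Fin 2) : letters (FreeSemigroup.of j) = [j] := rfl

theorem length_letters (w : FreeSemigroup (Fin 2)) : (letters w).length = w.length := rfl

theorem letters_injective : Function.Injective letters := by
  rintro ⟨a, l⟩ ⟨b, m⟩ h
  simp only [letters, List.cons.injEq] at h
  rw [h.1, h.2]

variable {G : Type u} [Group G]

theorem wordValue_of (α β : G) (j : Fin 2) :
    wordValue α β (FreeSemigroup.of j) = ![α, β] j := by
  simp [wordValue]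

theorem wordValue_eq_prod (α β : G) (w : FreeSemigroup (Fin 2)) :
    wordValue α β w = ((letters w).map ![α, β]).prod := by
  induction w using FreeSemigroup.recOnMul with
  | ih1 j => rw [wordValue_of, letters_of]; simp
  | ih2 j w h1 h2 => rw [map_mul, h1, h2, letters_mul, List.map_append, List.prod_append]

theorem wordValue_mem (α β : G) (w : FreeSemigroup (Fin 2)) :
    wordValue α β w ∈ semigroupGen α β := by
  induction w using FreeSemigroup.recOnMul with
  | ih1 j =>
    rw [wordValue_of]
    fin_cases j
    · exact left_mem_semigroupGen α β
    · exact right_mem_semigroupGen α β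
  | ih2 j w h1 h2 => rw [map_mul]; exact mul_mem h1 h2

theorem exists_wordValue_eq {α β : G} (γ : semigroupGen α β) : ∃ w, wordValue α β w = γ := by
  have hle : semigroupGen α β ≤ MulHom.srange (wordValue α β) := by
    refine Subsemigroup.closure_le.2 ?_
    rintro x (rfl | rfl)
    · exact ⟨FreeSemigroup.of 0, wordValue_of _ _ 0⟩
    · exact ⟨FreeSemigroup.of 1, wordValue_of _ _ 1⟩
  exact hle γ.2

theorem IsSemigroupHomSending.eq_sum {V : Type*} [AddCommGroup V] {α β : G}
    {Φ : semigroupGen α β → V} {a b : V} (h : IsSemigroupHomSending Φ a b)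
    (w : FreeSemigroup (Fin 2)) :
    Φ ⟨wordValue α β w, wordValue_mem α β w⟩ = ((letters w).map ![a, b]).sum := by
  induction w using FreeSemigroup.recOnMul with
  | ih1 j =>
    rw [letters_of]
    fin_cases j
    · simpa [wordValue_of] using h.2.1
    · simpa [wordValue_of] using h.2.2
  | ih2 j w h1 h2 =>
    rw [letters_mul, List.map_append, List.sum_append, ← h1, ← h2, ← h.1]
    congr 1
    exact Subtype.ext (map_mul _ _ _)

theorem exists_unique_semigroupHom {V : Type*} [AddCommGroup V] {α β : G}
    (hfree : GeneratesFreeSemigroup α β) (a b : V) :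
    ∃ Φ : semigroupGen α β → V, IsSemigroupHomSending Φ a b ∧
      (∀ Ψ : semigroupGen α β → V, IsSemigroupHomSending Ψ a b → Ψ = Φ) ∧
      ∀ (γ : semigroupGen α β) (w : FreeSemigroup (Fin 2)), wordValue α β w = γ →
        Φ γ = ((letters w).map ![a, b]).sum := by
  choose word hword using fun γ : semigroupGen α β => exists_wordValue_eq γ
  set Φ : semigroupGen α β → V := fun γ => ((letters (word γ)).map ![a, b]).sum with hΦ
  have hval : ∀ (γ : semigroupGen α β) (w : FreeSemigroup (Fin 2)), wordValue α β w = γ →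
      Φ γ = ((letters w).map ![a, b]).sum := by
    intro γ w hw
    have : word γ = w := hfree ((hword γ).trans hw.symm)
    rw [hΦ, ← this]
  refine ⟨Φ, ⟨fun γ δ => ?_, ?_, ?_⟩, fun Ψ hΨ => funext fun γ => ?_, hval⟩
  · rw [hval (γ * δ) (word γ * word δ) (by rw [map_mul, hword, hword]; rfl), letters_mul,
      List.map_append, List.sum_append]
  · rw [hval _ (FreeSemigroup.of 0) (wordValue_of _ _ 0), letters_of]; simp
  · rw [hval _ (FreeSemigroup.of 1) (wordValue_of _ _ 1), letters_of]; simp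
  · rw [hval γ _ (hword γ), ← hΨ.eq_sum (word γ)]
    congr 1
    exact Subtype.ext (hword γ).symm

end Words

/-! ### Families of transversal contracting axes -/

section

variable {X : Type*} [MetricSpace X] {σ : ℝ → X}

theorem IsAxis.conj {f : X ≃ᵢ X} {l : ℝ} (h : IsAxis f l σ) (c : X ≃ᵢ X) :
    IsAxis (c * f * c⁻¹) l fun t => c (σ t) := by
  refine ⟨h.1, h.2.1.comp_isometryEquiv c, fun t => ?_⟩
  rw [IsometryEquiv.mul_apply, IsometryEquiv.mul_apply,
    show c⁻¹ (c (σ t)) = σ t from c.symm_apply_apply _, h.2.2]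

theorem IsAxis.pow {f : X ≃ᵢ X} {l : ℝ} (h : IsAxis f l σ) {n : ℕ} (hn : 0 < n) :
    IsAxis (f ^ n) (n * l) σ := by
  refine ⟨mul_pos (by exact_mod_cast hn) h.1, h.2.1, fun t => ?_⟩
  rw [← zpow_natCast, h.zpow_apply]
  push_cast
  rfl

theorem exists_axis_of_areIndependent [CatZero X] [ProperSpace X] {g h : X ≃ᵢ X}
    (hg : IsRankOne g) (hh : IsRankOne h) (hind : AreIndependent g h) :
    ∃ (l : ℝ) (τ : ℝ → X) (Q : ℝ) (N : ℕ), IsAxis h l τ ∧ Tight τ Q ∧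
      ∀ q : ℤ, N ≤ q.natAbs → ∃ C, ∀ t, |pr τ ((g ^ q) (τ t))| ≤ C := by
  obtain ⟨-, lg, σ, hσ, -, hσr⟩ := hg
  obtain ⟨-, l, τ, hτ, -, hτr⟩ := hh
  obtain ⟨Q, hQ⟩ := hσ.exists_tight hσr
  obtain ⟨Q', hQ'⟩ := hτ.exists_tight hτr
  obtain ⟨C, hC⟩ := exists_bound_pr_of_areIndependent hσ hτ hQ hind
  obtain ⟨N, hN⟩ := exists_bound_pr_zpow hσ hQ hτ.2.1 hC
  exact ⟨l, τ, Q', N, hτ, hQ', hN⟩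

/-- The mutual position of the lines `j` and `k` is that of `τ` and its image under `g ^ (p * (k -
j))`, an exponent of absolute value at least `N`. Finitely many lines then share one constant. -/
theorem exists_family_bound [CatZero X] {g : X ≃ᵢ X} {τ : ℝ → X} {Q : ℝ} {N p : ℕ}
    (hτ : Tight τ Q) (hN : ∀ q : ℤ, N ≤ q.natAbs → ∃ C, ∀ t, |pr τ ((g ^ q) (τ t))| ≤ C)
    (hp : N ≤ p) (o : X) (m : ℕ) :
    ∃ Q', (∀ j : Fin m, Tight (fun t => (g ^ (p * j : ℕ)) (τ t)) Q') ∧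
      (∀ j : Fin m, dist o ((g ^ (p * j : ℕ)) (τ 0)) ≤ Q') ∧
      ∀ j k : Fin m, j ≠ k → ∀ t, |pr (fun t => (g ^ (p * j : ℕ)) (τ t))
        ((g ^ (p * k : ℕ)) (τ t))| ≤ Q' := by
  obtain ⟨B, hB⟩ := Finite.exists_le fun j : Fin m => dist o ((g ^ (p * j : ℕ)) (τ 0))
  have hex : ∀ jk : Fin m × Fin m, ∃ C, jk.1 ≠ jk.2 →
      ∀ t, |pr (fun t => (g ^ (p * jk.1 : ℕ)) (τ t)) ((g ^ (p * jk.2 : ℕ)) (τ t))| ≤ C := by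
    rintro ⟨j, k⟩
    by_cases hjk : j = k
    · exact ⟨0, fun hne => absurd hjk hne⟩
    have hdiff : 1 ≤ ((k : ℤ) - j).natAbs := by
      have : (j : ℕ) ≠ k := fun hh => hjk (Fin.ext hh)
      omega
    obtain ⟨C, hC⟩ := hN (p * ((k : ℤ) - j)) (by
      rw [Int.natAbs_mul, Int.natAbs_natCast]
      exact hp.trans (Nat.le_mul_of_pos_right p hdiff))
    refine ⟨C, fun _ t => ?_⟩
    have e : (g ^ (p * k : ℕ)) (τ t) =
        (g ^ (p * j : ℕ)) ((g ^ ((p : ℤ) * ((k : ℤ) - j))) (τ t)) := by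
      rw [← IsometryEquiv.mul_apply, ← zpow_natCast g (p * j), ← zpow_natCast g (p * k), ← zpow_add]
      congr 2
      push_cast
      ring
    change |pr (fun t => (g ^ (p * j : ℕ)) (τ t)) ((g ^ (p * k : ℕ)) (τ t))| ≤ C
    rw [e, hτ.line.pr_map]
    exact hC t
  choose C hC using hex
  obtain ⟨B', hB'⟩ := Finite.exists_le C
  refine ⟨max Q (max B B'), fun j => (hτ.comp _).mono (le_max_left _ _), fun j => ?_,
    fun j k hjk t => ?_⟩
  · exact (hB j).trans ((le_max_left _ _).trans (le_max_right _ _))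
  · exact (hC (j, k) hjk t).trans ((hB' (j, k)).trans
      ((le_max_right _ _).trans (le_max_right _ _)))

/-- Behrstock for lines with constant `Q` gives the threshold `5 * Q + 1`. `Tight.abs_pr_map_le`
turns it into `8 * Q + 1` once `φ` moves `o` by more than `3 * (5 * Q + 1) + 9 * Q = 24 * Q + 3`,
and Behrstock again gives `P = 12 * Q + 2`. The bounds `26 * Q + 4` and `30 * Q + 5` are `2 * P + 2
* Q` and `2 * (P + 3 * Q) + 1`. -/
theorem Schottky.of_transversal [CatZero X] {o : X} {φ : X ≃ᵢ X} {f : Fin 2 → X ≃ᵢ X}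
    {τ : Fin 2 → ℝ → X} {L Q : ℝ} (haxis : ∀ j, IsAxis (f j) L (τ j))
    (htight : ∀ j, Tight (τ j) Q) (hbase : ∀ j, dist o (τ j 0) ≤ Q)
    (htrans : ∀ j k, j ≠ k → ∀ t, |pr (τ j) (τ k t)| ≤ Q)
    (hφ : ∀ j, |pr (τ j) (φ o)| ≤ 5 * Q + 1) (hφ' : ∀ j, |pr (τ j) (φ⁻¹ o)| ≤ 5 * Q + 1)
    (hL : 26 * Q + 4 < L) (hfar : 24 * Q + 3 < dist o (φ o))
    (hfar' : ∀ j, 30 * Q + 5 ≤ dist o ((f j * φ) o)) :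
    Schottky o φ f τ L (12 * Q + 2) Q := by
  have hQ := (htight 0).nonneg
  have hinv : dist o (φ⁻¹ o) = dist o (φ o) := by
    rw [← φ.dist_eq, show φ (φ⁻¹ o) = o from φ.apply_symm_apply o, dist_comm]
  refine ⟨haxis, htight, hbase, fun j => (hφ j).trans (by linarith), fun j k y => ?_, fun y => ?_,
    by linarith, by linarith, fun j => by linarith [hfar' j]⟩
  · have h1 : ∀ t, |pr (τ j) (φ (τ k t)) - 0| ≤ 8 * Q + 1 := fun t => by
      rw [sub_zero]
      refine ((htight j).abs_pr_map_le (htight k).line (hbase j) (hbase k) (hφ j) (hφ' k)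
        (by linarith) t).trans (by linarith)
    have h2 : ∀ t, |pr (fun t => φ (τ k t)) (τ j t) - 0| ≤ 8 * Q + 1 := fun t => by
      rw [sub_zero]
      have e : τ j t = φ (φ⁻¹ (τ j t)) := (φ.apply_symm_apply _).symm
      rw [e, (htight k).line.pr_map]
      refine ((htight k).abs_pr_map_le (htight j).line (φ := φ⁻¹) (hbase k) (hbase j) (hφ' k) ?_
        (by linarith) t).trans (by linarith)
      rw [inv_inv]; exact hφ j
    have := (htight j).behrstock ((htight k).comp φ) h1 h2 (φ y)
    rw [(htight k).line.pr_map, sub_zero, sub_zero] at this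
    rcases this with h | h
    · exact Or.inl (by linarith)
    · exact Or.inr (by linarith)
  · have := (htight 0).behrstock (htight 1) (a := 0) (b := 0) (C := Q)
      (fun t => by rw [sub_zero]; exact htrans 0 1 (by decide) t)
      (fun t => by rw [sub_zero]; exact htrans 1 0 (by decide) t) y
    rw [sub_zero, sub_zero] at this
    rcases this with h | h
    · exact Or.inl (by linarith)
    · exact Or.inr (by linarith)

end

/-- Each condition spoils at most one index, so at least two of the `m` indices survive all of them.
-/
theorem exists_two_common_good {ι : Type*} [Fintype ι] {m : ℕ} (bad : ι → Fin m → Prop)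
    (hbad : ∀ i j k, bad i j → bad i k → j = k) (hm : Fintype.card ι + 2 ≤ m) :
    ∃ j k, j ≠ k ∧ ∀ i, ¬ bad i j ∧ ¬ bad i k := by
  classical
  set B : Finset (Fin m) := Finset.univ.biUnion fun i => Finset.univ.filter (bad i) with hB
  have hcard : B.card ≤ Fintype.card ι := by
    refine (Finset.card_biUnion_le_card_mul _ _ 1 fun i _ => ?_).trans (by simp)
    rw [Finset.card_le_one]
    intro j hj k hk
    exact hbad i j k (Finset.mem_filter.1 hj).2 (Finset.mem_filter.1 hk).2
  have hc : 1 < Bᶜ.card := by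
    rw [Finset.card_compl, Fintype.card_fin]
    omega
  obtain ⟨j, hj, k, hk, hjk⟩ := Finset.one_lt_card.1 hc
  have hgood : ∀ j ∈ Bᶜ, ∀ i, ¬ bad i j := fun j hj i hij =>
    Finset.mem_compl.1 hj (Finset.mem_biUnion.2 ⟨i, Finset.mem_univ _,
      Finset.mem_filter.2 ⟨Finset.mem_univ _, hij⟩⟩)
  exact ⟨j, k, hjk, fun i => ⟨hgood j hj i, hgood k hk i⟩⟩

/-! ### Vectors and cones -/

theorem norm_le_of_forall_abs_le {r : ℕ} {v : EuclideanSpace ℝ (Fin r)} {c : ℝ} (hc : 0 ≤ c)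
    (h : ∀ i, |v i| ≤ c) : ‖v‖ ≤ r * c := by
  rw [EuclideanSpace.norm_eq]
  refine Real.sqrt_le_iff.2 ⟨by positivity, ?_⟩
  calc ∑ i, ‖v i‖ ^ 2 ≤ ∑ _i : Fin r, c ^ 2 :=
        Finset.sum_le_sum fun i _ => pow_le_pow_left₀ (norm_nonneg _) (h i) 2
    _ = r * c ^ 2 := by simp
    _ ≤ (r * c) ^ 2 := by
      rw [mul_pow]
      refine mul_le_mul_of_nonneg_right ?_ (by positivity)
      exact_mod_cast Nat.le_self_pow two_ne_zero r

theorem IsOpenConeInPosOrthant.mem_of_near {r : ℕ} {C : Set (EuclideanSpace ℝ (Fin r))}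
    (hC : IsOpenConeInPosOrthant C) {v x : EuclideanSpace ℝ (Fin r)} {ε s e : ℝ}
    (hv : Metric.ball v ε ⊆ C) (hs : 0 < s) (he : 0 ≤ e) (hx : ∀ i, |x i - s * v i| ≤ e)
    (hlt : r * e < ε * s) : x ∈ C := by
  have h1 : s⁻¹ • x ∈ C := by
    apply hv
    rw [Metric.mem_ball, dist_eq_norm]
    have h2 : ‖x - s • v‖ ≤ r * e := norm_le_of_forall_abs_le he fun i => by simpa using hx i
    have h3 : s⁻¹ • x - v = s⁻¹ • (x - s • v) := by
      rw [smul_sub, smul_smul, inv_mul_cancel₀ hs.ne', one_smul]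
    rw [h3, norm_smul, norm_inv, Real.norm_of_nonneg hs.le, inv_mul_lt_iff₀ hs]
    linarith
  have := hC.smul_mem _ h1 s hs
  rwa [smul_smul, mul_inv_cancel₀ hs.ne', one_smul] at this

theorem IsOpenConeInPosOrthant.exists_translationVec_mem {r : ℕ} (hr : 1 ≤ r) {X : Fin r → Type u}
    [∀ i, MetricSpace (X i)] {Γ : Subgroup (IsomProd X)} {C : Set (EuclideanSpace ℝ (Fin r))}
    (hC : IsOpenConeInPosOrthant C) (hne : (C ∩ limitCone Γ).Nonempty) :
    ∃ γ ∈ Γ, IsRegularAxial γ ∧ translationVec γ ∈ C := by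
  obtain ⟨v, hvC, hv⟩ := hne
  obtain ⟨w, hwC, γ, hγ, hreg, t, ht, rfl⟩ := mem_closure_iff.1 hv C hC.isOpen hvC
  refine ⟨γ, hγ, hreg, ?_⟩
  -- The origin is not in the cone, as coordinates there are positive and `r ≥ 1`.
  have ht0 : 0 < t := by
    refine ht.lt_of_ne fun h0 => ?_
    have := hC.pos _ hwC ⟨0, hr⟩
    rw [← h0, zero_smul] at this
    simp at this
  have := hC.smul_mem _ hwC t⁻¹ (inv_pos.2 ht0)
  rwa [smul_smul, inv_mul_cancel₀ ht0.ne', one_smul] at this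

theorem abs_dist_pow_sub_le {X : Type*} [MetricSpace X] {f : X ≃ᵢ X} {l : ℝ} {σ : ℝ → X}
    (h : IsAxis f l σ) (o : X) (n : ℕ) :
    |dist o ((f ^ n) o) - n * l| ≤ 2 * dist o (σ 0) := by
  have h1 : dist (σ 0) ((f ^ n) (σ 0)) = n * l := by
    have hl := h.1
    rw [← zpow_natCast, h.zpow_apply, h.2.1, zero_sub, abs_neg, zero_add, Int.cast_natCast,
      abs_of_nonneg (by positivity)]
  have h2 := dist_triangle4 o (σ 0) ((f ^ n) (σ 0)) ((f ^ n) o)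
  have h3 := dist_triangle4 (σ 0) o ((f ^ n) o) ((f ^ n) (σ 0))
  rw [(f ^ n).dist_eq, h1, dist_comm (σ 0) o] at h2 h3
  rw [abs_le]
  constructor <;> linarith

theorem _root_.List.abs_sum_map_sub_le {ι : Type*} (l : List ι) (a b : ι → ℝ) {c : ℝ}
    (h : ∀ j, |a j - b j| ≤ c) : |(l.map a).sum - (l.map b).sum| ≤ c * l.length := by
  induction l with
  | nil => simp
  | cons j l ih =>
    have h1 := abs_le.1 (h j)
    have h2 := abs_le.1 ih
    rw [List.map_cons, List.map_cons, List.sum_cons, List.sum_cons, List.length_cons, abs_le]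
    push_cast
    constructor <;> linarith

end HadamardProducts

/-! ### Simultaneous choice of the generators in all factors -/

theorem proposition6p3 {r : ℕ} (hr : 1 ≤ r) (X : Fin r → Type u) [∀ i, MetricSpace (X i)]
    [∀ i, LocallyCompactSpace (X i)] (hX : ∀ i, IsHadamardSpace (X i))
    (Γ : Subgroup (IsomProd X)) (hΓ : ActsProperlyDiscontinuously Γ)
    (g h : IsomProd X) (hg : g ∈ Γ) (hh : h ∈ Γ) (hgh : AreIndependentRegularAxial g h)
    (o : ∀ i, X i) (ho : o ∈ axisSet h) :
    ∃ κ : ℝ, 0 < κ ∧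
      ∀ C : Set (EuclideanSpace ℝ (Fin r)), IsOpenConeInPosOrthant C →
        (C ∩ limitCone Γ).Nonempty →
        ∃ α ∈ Γ, ∃ β ∈ Γ, AreIndependentRegularAxial α β ∧
          translationVec α ∈ C ∧ translationVec β ∈ C ∧
          GeneratesFreeSemigroup α β ∧
          ∃ Φ : semigroupGen α β → EuclideanSpace ℝ (Fin r),
            IsSemigroupHomSending Φ (translationVec α) (translationVec β) ∧
            (∀ Ψ : semigroupGen α β → EuclideanSpace ℝ (Fin r),
              IsSemigroupHomSending Ψ (translationVec α) (translationVec β) → Ψ = Φ) ∧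
            ∀ (γ : semigroupGen α β) (w : FreeSemigroup (Fin 2)),
              wordValue α β w = (γ : IsomProd X) →
                distVec o (act γ o) ∈ C ∧
                ‖distVec o (act γ o) - Φ γ‖ ≤ κ * (w.length : ℝ) := by
  have : ∀ i, CatZero (X i) := fun i => (hX i).catZero
  have : ∀ i, ProperSpace (X i) := fun i => (hX i).properSpace
  obtain ⟨hgr, hhr, hind⟩ := hgh
  choose l τ₀ Q₀ N hax htight hN using
    fun i => exists_axis_of_areIndependent (hgr i) (hhr i) (hind i)
  obtain ⟨p, hp⟩ := Finite.exists_le N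
  -- There are `2 * r` conditions on an index, one for `φ i (o i)` and one for its inverse
  -- counterpart in each factor; two further lines guarantee two good indices.
  choose Q₁ hQt hQb hQtr using
    fun i => exists_family_bound (g := g i) (htight i) (hN i) (hp i) (o i) (2 * r + 2)
  obtain ⟨Q, hQ⟩ := Finite.exists_le Q₁
  set τ : ∀ i, Fin (2 * r + 2) → ℝ → X i :=
    fun i j t => (g i ^ (p * j : ℕ)) (τ₀ i t) with hτ
  have hτt : ∀ i j, Tight (τ i j) Q := fun i j => (hQt i j).mono (hQ i)
  have hτb : ∀ i j, dist (o i) (τ i j 0) ≤ Q := fun i j => (hQb i j).trans (hQ i)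
  have hτtr : ∀ i j k, j ≠ k → ∀ t, |pr (τ i j) (τ i k t)| ≤ Q :=
    fun i j k hjk t => (hQtr i j k hjk t).trans (hQ i)
  have hQ0 : 0 ≤ Q := (hτt ⟨0, hr⟩ 0).nonneg
  obtain ⟨K, hK⟩ := Finite.exists_le fun i => ⌈(26 * Q + 4) / l i⌉₊
  have hKl : ∀ i, 26 * Q + 4 < (K + 1 : ℕ) * l i := fun i => by
    have h1 := Nat.le_of_ceil_le (hK i)
    have h2 := (hax i).1
    rw [div_le_iff₀ h2] at h1
    push_cast
    linarith
  set F : Fin (2 * r + 2) → IsomProd X :=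
    fun j => g ^ (p * j : ℕ) * h ^ (K + 1) * (g ^ (p * j : ℕ))⁻¹ with hF
  have hFΓ : ∀ j, F j ∈ Γ := fun j =>
    Γ.mul_mem (Γ.mul_mem (Γ.pow_mem hg _) (Γ.pow_mem hh _)) (Γ.inv_mem (Γ.pow_mem hg _))
  have hFax : ∀ i j, IsAxis (F j i) ((K + 1 : ℕ) * l i) (τ i j) := fun i j =>
    ((hax i).pow K.succ_pos).conj _
  obtain ⟨A, hA⟩ := Finite.exists_le
    fun ij : Fin r × Fin (2 * r + 2) => dist (o ij.1) (F ij.2 ij.1 (o ij.1))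
  have hA0 : 0 ≤ A := dist_nonneg.trans (hA (⟨0, hr⟩, 0))
  have hr0 : (0 : ℝ) < r := by exact_mod_cast hr
  -- Per letter and coordinate, `2 * (15 * Q + 2)` is lost in adding displacements and as much in
  -- replacing them by translation lengths, where `15 * Q + 2 = P + 3 * Q`. The factor `r` bounds
  -- the norm by the coordinates.
  refine ⟨r * (4 * (15 * Q + 2)), by positivity, fun C hC hne => ?_⟩
  obtain ⟨γ, hγ, hγreg, hγC⟩ := hC.exists_translationVec_mem hr hne
  choose lγ σγ hγax using fun i => (hγreg i).1
  set v := translationVec γ with hv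
  have hvi : ∀ i, v i = lγ i := fun i => translationLength_eq (hγax i)
  obtain ⟨B, hB⟩ := Finite.exists_le fun i => 2 * dist (o i) (σγ i 0)
  have hB0 : 0 ≤ B := le_trans (by positivity) (hB ⟨0, hr⟩)
  obtain ⟨ε, hε, hball⟩ := Metric.isOpen_iff.1 hC.isOpen v hγC
  set E := 2 * (15 * Q + 2) + (A + B) with hE
  have hE0 : 0 ≤ E := by positivity
  -- `n₁` makes the displacement large enough for ping-pong, even after losing `A` to `F j` and `B`
  -- to the base point; `n₂` makes the error `E` small relative to `n` times the radius `ε` of the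
  -- ball around `v`.
  obtain ⟨n₁, hn₁⟩ := Finite.exists_le fun i => ⌈(30 * Q + 5 + A + B) / lγ i⌉₊
  obtain ⟨n₂, hn₂⟩ := exists_nat_gt (r * E / ε)
  set n := n₁ + n₂ + 1 with hn
  have hn0 : (0 : ℝ) < n := by positivity
  have hnl : ∀ i, 30 * Q + 5 + A + B ≤ n * lγ i := fun i => by
    have h1 := Nat.le_of_ceil_le (hn₁ i)
    have h2 := (hγax i).1
    rw [div_le_iff₀ h2] at h1
    refine h1.trans (mul_le_mul_of_nonneg_right ?_ h2.le)
    exact_mod_cast (by omega : n₁ ≤ n)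
  have hnε : r * E < ε * n := by
    rw [div_lt_iff₀ hε] at hn₂
    have : (n₂ : ℝ) ≤ n := by exact_mod_cast (by omega : n₂ ≤ n)
    nlinarith
  set φ := γ ^ n with hφ
  have hφd : ∀ i, |dist (o i) (φ i (o i)) - n * v i| ≤ B := fun i => by
    rw [hvi]
    exact (abs_dist_pow_sub_le (hγax i) (o i) n).trans (hB i)
  have hφfar : ∀ i, 30 * Q + 5 + A ≤ dist (o i) (φ i (o i)) := fun i => by
    have h1 := (abs_le.1 (hφd i)).1
    have h2 := hnl i
    rw [hvi] at h1
    linarith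
  obtain ⟨j₀, j₁, hne01, hgood⟩ := exists_two_common_good
    (ι := Fin r × Bool) (m := 2 * r + 2)
    (fun ib j => 5 * Q + 1 <
      |pr (τ ib.1 j) (cond ib.2 (φ ib.1 (o ib.1)) ((φ ib.1)⁻¹ (o ib.1)))|)
    (fun ib j k hj hk => by
      by_contra hjk
      have := (hτt ib.1 j).behrstock (hτt ib.1 k) (a := 0) (b := 0) (C := Q)
        (fun t => by rw [sub_zero]; exact hτtr _ j k hjk t)
        (fun t => by rw [sub_zero]; exact hτtr _ k j (Ne.symm hjk) t)
        (cond ib.2 (φ ib.1 (o ib.1)) ((φ ib.1)⁻¹ (o ib.1)))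
      rw [sub_zero, sub_zero] at this
      rcases this with h1 | h1 <;> linarith)
    (by simp; omega)
  set jj : Fin 2 → Fin (2 * r + 2) := ![j₀, j₁] with hjj
  have hjj_ne : ∀ s t, s ≠ t → jj s ≠ jj t := by
    intro s t hst
    fin_cases s <;> fin_cases t
    · exact absurd rfl hst
    · exact hne01
    · exact hne01.symm
    · exact absurd rfl hst
  have hgood' : ∀ (ib : Fin r × Bool) (s : Fin 2), |pr (τ ib.1 (jj s))
      (cond ib.2 (φ ib.1 (o ib.1)) ((φ ib.1)⁻¹ (o ib.1)))| ≤ 5 * Q + 1 := by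
    intro ib s
    fin_cases s
    · exact not_lt.1 (hgood ib).1
    · exact not_lt.1 (hgood ib).2
  set a : Fin 2 → IsomProd X := fun s => F (jj s) * φ with ha
  have hdist : ∀ i s, |dist (o i) (a s i (o i)) - dist (o i) (φ i (o i))| ≤ A := fun i s => by
    have h1 : dist (o i) (F (jj s) i (o i)) ≤ A := hA (i, jj s)
    have h2 := dist_triangle (o i) (F (jj s) i (o i)) (F (jj s) i (φ i (o i)))
    have h3 := dist_triangle_left (F (jj s) i (o i)) (F (jj s) i (φ i (o i))) (o i)
    rw [(F (jj s) i).dist_eq] at h2 h3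
    change |dist (o i) (F (jj s) i (φ i (o i))) - _| ≤ A
    rw [abs_le]
    constructor <;> linarith
  have hS : ∀ i, Schottky (o i) (φ i) (fun s => F (jj s) i) (fun s => τ i (jj s))
      ((K + 1 : ℕ) * l i) (12 * Q + 2) Q := fun i =>
    Schottky.of_transversal (fun s => hFax i (jj s)) (fun s => hτt i (jj s))
      (fun s => hτb i (jj s)) (fun s t hst => hτtr i _ _ (hjj_ne s t hst))
      (fun s => hgood' (i, true) s) (fun s => hgood' (i, false) s) (hKl i)
      (by linarith [hφfar i]) (fun s => by
        have h1 := (abs_le.1 (hdist i s)).1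
        have h2 := hφfar i
        change 30 * Q + 5 ≤ dist (o i) (a s i (o i))
        linarith)
  have hrank : ∀ i s, IsRankOne (a s i) ∧
      |translationLength (a s i) - dist (o i) (a s i (o i))| ≤ 2 * (15 * Q + 2) := fun i s => by
    have := (hS i).isRankOne s
    rwa [show 12 * Q + 2 + 3 * Q = 15 * Q + 2 by ring] at this
  have haΓ : ∀ s, a s ∈ Γ := fun s => Γ.mul_mem (hFΓ _) (Γ.pow_mem hγ _)
  have hdv : ∀ i s, |dist (o i) (a s i (o i)) - n * v i| ≤ A + B := fun i s => by
    have h1 := abs_le.1 (hdist i s)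
    have h2 := abs_le.1 (hφd i)
    rw [abs_le]
    constructor <;> linarith
  have hLC : ∀ s, translationVec (a s) ∈ C := fun s =>
    hC.mem_of_near hball hn0 hE0 (fun i => by
      have h1 := abs_le.1 (hrank i s).2
      have h2 := abs_le.1 (hdv i s)
      change |translationLength (a s i) - _| ≤ E
      rw [abs_le]
      constructor <;> linarith) hnε
  have haeq : ![a 0, a 1] = a := by
    ext s : 1
    fin_cases s <;> rfl
  have hword : ∀ (w : FreeSemigroup (Fin 2)) i, wordValue (a 0) (a 1) w i =
      ((letters w).map fun s => F (jj s) i * φ i).prod := fun w i => by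
    rw [wordValue_eq_prod, haeq]
    have h1 := map_list_prod (Pi.evalMonoidHom (fun i => X i ≃ᵢ X i) i) ((letters w).map a)
    rw [List.map_map] at h1
    exact h1
  have hfree : GeneratesFreeSemigroup (a 0) (a 1) := fun w w' hww => by
    refine letters_injective ((hS ⟨0, hr⟩).word_injective _ _ ?_)
    rw [← hword, ← hword, hww]
  refine ⟨a 0, haΓ 0, a 1, haΓ 1, ⟨fun i => (hrank i 0).1, fun i => (hrank i 1).1,
    fun i => (hS i).areIndependent⟩, hLC 0, hLC 1, hfree, ?_⟩
  obtain ⟨Φ, hΦ, hΦu, hΦv⟩ :=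
    exists_unique_semigroupHom hfree (translationVec (a 0)) (translationVec (a 1))
  refine ⟨Φ, hΦ, hΦu, fun δ w hw => ?_⟩
  have hlen : (0 : ℝ) < w.length := by
    rw [← length_letters]
    exact_mod_cast Nat.succ_pos _
  have hest : ∀ i, |distVec o (act δ o) i -
      ((letters w).map fun s => dist (o i) (a s i (o i))).sum| ≤
        2 * (15 * Q + 2) * w.length := fun i => by
    have h1 := (hS i).abs_dist_word_sub_le (letters w)
    rw [← hword, hw, length_letters, show 12 * Q + 2 + 3 * Q = 15 * Q + 2 by ring] at h1
    exact h1
  constructor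
  -- For a word of length `k` each coordinate is within `E * k` of `k * n * v i`. Error and main
  -- term both scale with `k`, so the choice of `n` for single letters suffices.
  · refine hC.mem_of_near hball (mul_pos hn0 hlen) (mul_nonneg hE0 hlen.le) (fun i => ?_)
      (by nlinarith)
    have h1 := (letters w).abs_sum_map_sub_le (fun s => dist (o i) (a s i (o i)))
      (fun _ => n * v i) (hdv i)
    rw [List.map_const', List.sum_replicate, nsmul_eq_mul, length_letters] at h1
    have h2 := abs_le.1 h1
    have h3 := abs_le.1 (hest i)
    rw [hE, abs_le]
    constructor <;> linarith
  · rw [hΦv δ w hw, mul_assoc]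
    refine norm_le_of_forall_abs_le (by positivity) fun i => ?_
    have hsum : ((letters w).map ![translationVec (a 0), translationVec (a 1)]).sum i =
        ((letters w).map fun s => translationLength (a s i)).sum := by
      have h1 := map_list_sum (EuclideanSpace.proj i : EuclideanSpace ℝ (Fin r) →L[ℝ] ℝ)
        ((letters w).map ![translationVec (a 0), translationVec (a 1)])
      rw [List.map_map] at h1
      refine h1.trans (congrArg List.sum (List.map_congr_left fun s _ => ?_))
      fin_cases s <;> rfl
    have h1 := (letters w).abs_sum_map_sub_le (fun s => translationLength (a s i))
      (fun s => dist (o i) (a s i (o i))) (fun s => (hrank i s).2)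
    rw [length_letters] at h1
    have h2 := abs_le.1 h1
    have h3 := abs_le.1 (hest i)
    rw [PiLp.sub_apply, hsum, abs_le]
    constructor <;> linarith
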